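/- Conventions. Let $G$ be a finitely presented group. A graph is a connected graph, loops and multiple edges allowed, regarded as a geodesic metric space in which every edge has length $1$. For a finite generating set $S$ of $G$, the Cayley graph $\Gamma(G,S)$ has vertex set $G$ and an edge from $g$ to $gs$ for all $g\in G$, $s\in S$; its canonical action is left multiplication. A metric space $X$ is Gromov hyperbolic if for some $\delta\ge 0$ one has $(x|y)_o\ge\min\{(x|z)_o,(z|y)_o\}-\delta$ for all $o,x,y,z\in X$, where $(x|y)_o=\tfrac12(d(x,o)+d(y,o)-d(x,y))$. It has the bottleneck property if there is $\Delta>0$ such that all $x,y\in X$ have a midpoint $m$ (that is, $d(x,m)=d(y,m)=\tfrac12 d(x,y)$) such that every path from $x$ to $y$ passes within less than $\Delta$ of $m$. Let $G$ act by isometries on $X$. A $(K,L)$-quasi-geodesic ($K\ge1$, $L\ge0$) is a map $l:\mathbb R\to X$ with $\tfrac1K|s-t|-L\le d(l(s),l(t))\le K|s-t|+L$ for all $s,t$. An element $g\in G$ is hyperbolic if $t\mapsto g^{\lfloor t\rfloor}x$ is a quasi-geodesic (with some constants) for every $x\in X$. A $(K,L)$-quasi-axis of $g$ is a $(K,L)$-quasi-geodesic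 $l$ such that for some $\tau>0$, $g\,l(t)=l(t+\tau)$ for all $t$. Hyperbolic elements $g_1,g_2$ are independent if no ray contained in a quasi-axis of $g_1$ is at finite Hausdorff distance from a ray contained in a quasi-axis of $g_2$. For hyperbolic $g_1,g_2$ write $g_1\sim g_2$ if there are constants $K,L,B$ and $(K,L)$-quasi-axes $l_1$ of $g_1$ and $l_2$ of $g_2$ such that for arbitrarily long intervals $[a,b]$ there is $g\in G$ for which $g\,l_1([a,b])$ lies in the $B$-neighbourhood of $l_2$, and $g$ preserves the orientation, i.e. there are $s<t$ with $d(g\,l_1(a),l_2(s))\le B$ and $d(g\,l_1(b),l_2(t))\le B$. The action is nonelementary if there are two independent hyperbolic elements. It is a Bestvina–Fujiwara action if $X$ is Gromov hyperbolic, the action is nonelementary, and there are independent hyperbolic $g_1,g_2\in G$ with $g_1\not\sim g_2$. A pseudocharacter on $G$ is a function $f:G\to\mathbb R$ with $f(g^n)=nf(g)$ for all $g\in G$, $n\in\mathbb Z$ and with $|f(a)+f(b)-f(ab)|$ bounded independently of $a,b\in G$. Let $S$ be a finite generating set of $G$. The sign $\sigma(w)$ of an infinite word $w=w_1w_2\cdots$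 in $S\cup S^{-1}$ is $+1$ (respectively $-1$) if $f(w_1\cdots w_n)\to+\infty$ (respectively $-\infty$) as $n\to\infty$, and $0$ otherwise. Let $E(f)$ be the set of infinite words in $S\cup S^{-1}$ of sign $\pm1$ modulo the equivalence relation $\sim$, where $w\sim v$ if for some constant $C$: $\sigma(w)=\sigma(v)$, and for all $D\in\mathbb R$ with $\sigma(w)D>C$ there are a finite word $d$ in $S\cup S^{-1}$ and prefixes $w_p$ of $w$ and $v_p$ of $v$ with $w_pd=v_p$ in $G$ and $|f(w_pd_p)-D|\le C$ for all prefixes $d_p$ of $d$. Up to canonical bijection $E(f)$ does not depend on $S$. Let $E(f)^\pm\subset E(f)$ be the subsets of classes of sign $\pm1$. The pseudocharacter $f$ is uniform if $|E(f)|=2$; it is unipotent if it is not uniform and $|E(f)^+|=1$ or $|E(f)^-|=1$; and it is bushy if it is not identically zero, not uniform and not unipotent. Corollary. (1) Let $G$ act by isometries on a graph $X$ that has the bottleneck property. If the action is a Bestvina–Fujiwara action (so that in particular $X$ is Gromov hyperbolic), then the real vector space spanned by the bushy pseudocharacters on $G$ has dimension equal to the cardinality of the continuum. (2) Let $S$ be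 a finite generating set of $G$. If the Cayley graph $\Gamma(G,S)$ has the bottleneck property and the canonical action of $G$ on it is a Bestvina–Fujiwara action, then the real vector space spanned by the bushy pseudocharacters on $G$ has dimension equal to the cardinality of the continuum. -/

import Mathlib

/-! ### Connected graphs and their geometric realizations -/

/-- A connected graph with vertex set `V` and edge set `E`; loops and multiple edges are allowed.
An (arbitrary) orientation of the edges is recorded for bookkeeping. -/
structure ConnectedGraph (V : Type*) (E : Type*) where
  src : E → V
  tgt : E → V
  connected : (SimpleGraph.fromRel fun u v => ∃ e, src e = u ∧ tgt e = v).Connected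

namespace ConnectedGraph

variable {V E : Type*}

/-- The combinatorial distance between two vertices (least number of edges of an edge path). -/
noncomputable def vdist (Γ : ConnectedGraph V E) (u v : V) : ℝ :=
  ((SimpleGraph.fromRel fun u v => ∃ e, Γ.src e = u ∧ Γ.tgt e = v).dist u v : ℝ)

/-- Points of the disjoint union of the vertices and of one unit interval for every edge. -/
inductive PrePoint (Γ : ConnectedGraph V E) where
  | vertex (v : V) : PrePoint Γ
  | edge (e : E) (t : unitInterval) : PrePoint Γ

/-- Length of a shortest path from a point to a vertex. -/
noncomputable def toVertex (Γ : ConnectedGraph V E) : Γ.PrePoint → V → ℝ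
  | .vertex v, w => Γ.vdist v w
  | .edge e t, w => min ((t : ℝ) + Γ.vdist (Γ.src e) w) (1 - (t : ℝ) + Γ.vdist (Γ.tgt e) w)

/-- Length of a shortest path between two points among those that pass through a vertex. -/
noncomputable def throughVertex (Γ : ConnectedGraph V E) (p : Γ.PrePoint) : Γ.PrePoint → ℝ
  | .vertex w => Γ.toVertex p w
  | .edge e t => min ((t : ℝ) + Γ.toVertex p (Γ.src e)) (1 - (t : ℝ) + Γ.toVertex p (Γ.tgt e))

open Classical in
/-- The path distance for which every edge has length one. -/
noncomputable def pdist (Γ : ConnectedGraph V E) : Γ.PrePoint → Γ.PrePoint → ℝ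
  | .edge e s, .edge e' t =>
      if e = e' then min |(s : ℝ) - t| (Γ.throughVertex (.edge e s) (.edge e' t))
      else Γ.throughVertex (.edge e s) (.edge e' t)
  | p, q => Γ.throughVertex p q

theorem vdist_self (Γ : ConnectedGraph V E) (u : V) : Γ.vdist u u = 0 := by
  simp [vdist]

theorem vdist_nonneg (Γ : ConnectedGraph V E) (u v : V) : 0 ≤ Γ.vdist u v := by
  simp [vdist]

theorem vdist_comm (Γ : ConnectedGraph V E) (u v : V) : Γ.vdist u v = Γ.vdist v u := by
  simp [vdist, SimpleGraph.dist_comm]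

theorem vdist_triangle (Γ : ConnectedGraph V E) (u v w : V) :
    Γ.vdist u w ≤ Γ.vdist u v + Γ.vdist v w := by
  unfold vdist
  exact_mod_cast Γ.connected.dist_triangle

theorem vdist_edge (Γ : ConnectedGraph V E) (e : E) : Γ.vdist (Γ.src e) (Γ.tgt e) ≤ 1 := by
  by_cases h : Γ.src e = Γ.tgt e
  · rw [h, vdist_self]; norm_num
  · unfold vdist
    have := SimpleGraph.dist_eq_one_iff_adj.2
      ((SimpleGraph.fromRel_adj (fun u v => ∃ e, Γ.src e = u ∧ Γ.tgt e = v) _ _).2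
        ⟨h, Or.inl ⟨e, rfl, rfl⟩⟩)
    rw [this]; norm_num

theorem toVertex_edge (Γ : ConnectedGraph V E) (e : E) (t : unitInterval) (w : V) :
    Γ.toVertex (.edge e t) w =
      min ((t : ℝ) + Γ.vdist (Γ.src e) w) (1 - (t : ℝ) + Γ.vdist (Γ.tgt e) w) := rfl

theorem toVertex_nonneg (Γ : ConnectedGraph V E) (p : Γ.PrePoint) (w : V) :
    0 ≤ Γ.toVertex p w := by
  cases p with
  | vertex v => exact Γ.vdist_nonneg _ _
  | edge e t =>
    have h0 := t.2.1
    have h1 := t.2.2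
    have := Γ.vdist_nonneg (Γ.src e) w
    have := Γ.vdist_nonneg (Γ.tgt e) w
    exact le_min (by linarith) (by linarith)

theorem toVertex_le (Γ : ConnectedGraph V E) (p : Γ.PrePoint) (u w : V) :
    Γ.toVertex p w ≤ Γ.toVertex p u + Γ.vdist u w := by
  cases p with
  | vertex v => exact Γ.vdist_triangle _ _ _
  | edge e t =>
    have h1 := Γ.vdist_triangle (Γ.src e) u w
    have h2 := Γ.vdist_triangle (Γ.tgt e) u w
    simp only [toVertex]
    grind

theorem vdist_le_toVertex (Γ : ConnectedGraph V E) (p : Γ.PrePoint) (u w : V) :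
    Γ.vdist u w ≤ Γ.toVertex p u + Γ.toVertex p w := by
  cases p with
  | vertex v =>
    have := Γ.vdist_triangle u v w
    have := Γ.vdist_comm u v
    simp only [toVertex]; linarith
  | edge e t =>
    have h0 := t.2.1
    have h1 := t.2.2
    have := Γ.vdist_triangle u (Γ.src e) w
    have := Γ.vdist_triangle u (Γ.tgt e) w
    have := Γ.vdist_triangle u (Γ.src e) (Γ.tgt e)
    have := Γ.vdist_triangle u (Γ.tgt e) (Γ.src e)
    have := Γ.vdist_comm u (Γ.src e)
    have := Γ.vdist_comm u (Γ.tgt e)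
    have := Γ.vdist_comm (Γ.src e) (Γ.tgt e)
    have := Γ.vdist_edge e
    simp only [toVertex]
    grind

theorem throughVertex_le (Γ : ConnectedGraph V E) (p q : Γ.PrePoint) (w : V) :
    Γ.throughVertex p q ≤ Γ.toVertex p w + Γ.toVertex q w := by
  cases q with
  | vertex v =>
    have := Γ.toVertex_le p w v
    have := Γ.vdist_comm v w
    simp only [throughVertex, toVertex] at *; linarith
  | edge e t =>
    have := Γ.toVertex_le p w (Γ.src e)
    have := Γ.toVertex_le p w (Γ.tgt e)
    have := Γ.vdist_comm w (Γ.src e)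
    have := Γ.vdist_comm w (Γ.tgt e)
    simp only [throughVertex, toVertex_edge]
    grind

theorem exists_throughVertex (Γ : ConnectedGraph V E) (p q : Γ.PrePoint) :
    ∃ w, Γ.throughVertex p q = Γ.toVertex p w + Γ.toVertex q w := by
  suffices h : ∃ w, Γ.toVertex p w + Γ.toVertex q w ≤ Γ.throughVertex p q by
    obtain ⟨w, hw⟩ := h
    exact ⟨w, le_antisymm (Γ.throughVertex_le p q w) hw⟩
  cases q with
  | vertex v => exact ⟨v, by simp [throughVertex, toVertex, vdist_self]⟩
  | edge e t =>
    rcases min_choice ((t : ℝ) + Γ.toVertex p (Γ.src e)) (1 - (t : ℝ) + Γ.toVertex p (Γ.tgt e))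
      with h | h
    · refine ⟨Γ.src e, ?_⟩
      have := Γ.vdist_self (Γ.src e)
      simp only [throughVertex, h]
      rw [toVertex_edge]
      grind
    · refine ⟨Γ.tgt e, ?_⟩
      have := Γ.vdist_self (Γ.tgt e)
      simp only [throughVertex, h]
      rw [toVertex_edge]
      grind

theorem throughVertex_comm (Γ : ConnectedGraph V E) (p q : Γ.PrePoint) :
    Γ.throughVertex p q = Γ.throughVertex q p := by
  apply le_antisymm
  · obtain ⟨w, hw⟩ := Γ.exists_throughVertex q p
    rw [hw, add_comm]; exact Γ.throughVertex_le p q w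
  · obtain ⟨w, hw⟩ := Γ.exists_throughVertex p q
    rw [hw, add_comm]; exact Γ.throughVertex_le q p w

theorem pdist_le_throughVertex (Γ : ConnectedGraph V E) (p q : Γ.PrePoint) :
    Γ.pdist p q ≤ Γ.throughVertex p q := by
  cases p <;> cases q <;> simp only [pdist, le_refl]
  split_ifs
  · exact min_le_right _ _
  · exact le_rfl

theorem throughVertex_triangle (Γ : ConnectedGraph V E) (p q r : Γ.PrePoint) :
    Γ.throughVertex p r ≤ Γ.throughVertex p q + Γ.throughVertex q r := by
  obtain ⟨u, hu⟩ := Γ.exists_throughVertex p q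
  obtain ⟨w, hw⟩ := Γ.exists_throughVertex q r
  have := Γ.throughVertex_le p r w
  have := Γ.toVertex_le p u w
  have := Γ.vdist_le_toVertex q u w
  linarith

theorem toVertex_edge_le (Γ : ConnectedGraph V E) (e : E) (s t : unitInterval) (w : V) :
    Γ.toVertex (.edge e s) w ≤ |(s : ℝ) - t| + Γ.toVertex (.edge e t) w := by
  have := le_abs_self ((s : ℝ) - t)
  have := neg_abs_le ((s : ℝ) - t)
  simp only [toVertex]
  grind

/-- Two points are joined either inside one edge or through a vertex. -/
theorem pdist_cases (Γ : ConnectedGraph V E) (p q : Γ.PrePoint) :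
    Γ.pdist p q = Γ.throughVertex p q ∨
      ∃ e s t, p = .edge e s ∧ q = .edge e t ∧ Γ.pdist p q = |(s : ℝ) - t| := by
  cases p with
  | vertex v => exact Or.inl rfl
  | edge e s =>
    cases q with
    | vertex v => exact Or.inl rfl
    | edge e' t =>
      by_cases h : e = e'
      · subst h
        simp only [pdist, if_true]
        rcases min_choice |(s : ℝ) - t| (Γ.throughVertex (.edge e s) (.edge e t)) with h | h
        · exact Or.inr ⟨e, s, t, rfl, rfl, h⟩
        · exact Or.inl h
      · exact Or.inl (by simp [pdist, h])

theorem pdist_edge_le (Γ : ConnectedGraph V E) (e : E) (s t : unitInterval) :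
    Γ.pdist (.edge e s) (.edge e t) ≤ |(s : ℝ) - t| := by
  simp [pdist]

theorem pdist_nonneg (Γ : ConnectedGraph V E) (p q : Γ.PrePoint) : 0 ≤ Γ.pdist p q := by
  rcases Γ.pdist_cases p q with h | ⟨e, s, t, -, -, h⟩
  · obtain ⟨w, hw⟩ := Γ.exists_throughVertex p q
    rw [h, hw]
    exact add_nonneg (Γ.toVertex_nonneg _ _) (Γ.toVertex_nonneg _ _)
  · rw [h]; exact abs_nonneg _

theorem pdist_self (Γ : ConnectedGraph V E) (p : Γ.PrePoint) : Γ.pdist p p = 0 := by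
  cases p with
  | vertex v => exact Γ.vdist_self v
  | edge e t =>
    refine le_antisymm ?_ (Γ.pdist_nonneg _ _)
    simpa using Γ.pdist_edge_le e t t

theorem pdist_comm_le (Γ : ConnectedGraph V E) (p q : Γ.PrePoint) :
    Γ.pdist p q ≤ Γ.pdist q p := by
  rcases Γ.pdist_cases q p with h | ⟨e, s, t, rfl, rfl, h⟩
  · rw [h, Γ.throughVertex_comm]; exact Γ.pdist_le_throughVertex p q
  · rw [h, abs_sub_comm]; exact Γ.pdist_edge_le e t s

theorem pdist_triangle (Γ : ConnectedGraph V E) (p q r : Γ.PrePoint) :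
    Γ.pdist p r ≤ Γ.pdist p q + Γ.pdist q r := by
  rcases Γ.pdist_cases p q with h1 | ⟨e, s, t, rfl, rfl, h1⟩
  · rcases Γ.pdist_cases q r with h2 | ⟨e', s', t', rfl, rfl, h2⟩
    · rw [h1, h2]
      exact (Γ.pdist_le_throughVertex p r).trans (Γ.throughVertex_triangle p q r)
    · rw [h1, h2]
      obtain ⟨w, hw⟩ := Γ.exists_throughVertex p (.edge e' s')
      have := Γ.pdist_le_throughVertex p (.edge e' t')
      have := Γ.throughVertex_le p (.edge e' t') w
      have := Γ.toVertex_edge_le e' t' s' w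
      have := abs_sub_comm (s' : ℝ) t'
      linarith
  · rcases Γ.pdist_cases (.edge e t) r with h2 | ⟨e', s', t', h3, rfl, h2⟩
    · rw [h1, h2]
      obtain ⟨w, hw⟩ := Γ.exists_throughVertex (.edge e t) r
      have := Γ.pdist_le_throughVertex (.edge e s) r
      have := Γ.throughVertex_le (.edge e s) r w
      have := Γ.toVertex_edge_le e s t w
      linarith
    · cases h3
      rw [h1, h2]
      have := Γ.pdist_edge_le e s t'
      have := abs_sub_le (s : ℝ) t t'
      linarith

noncomputable instance (Γ : ConnectedGraph V E) : PseudoMetricSpace Γ.PrePoint where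
  dist := Γ.pdist
  dist_self := Γ.pdist_self
  dist_comm p q := le_antisymm (Γ.pdist_comm_le p q) (Γ.pdist_comm_le q p)
  dist_triangle := Γ.pdist_triangle

/-- The geometric realization of the graph, every edge being a segment of length one, with the
path metric: points at distance zero (endpoints of edges and the corresponding vertices)
are identified. -/
abbrev Realization (Γ : ConnectedGraph V E) : Type _ := SeparationQuotient Γ.PrePoint

end ConnectedGraph

/-! ### Cayley graphs -/

section Cayley

variable {G : Type*} [Group G]

/-- The Cayley graph `Γ(G, S)`: vertices are the elements of `G`, and for all `g ∈ G`, `s ∈ S` there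
is an edge from `g` to `g * s`. -/
def cayleyGraph (S : Finset G) (hS : Subgroup.closure (S : Set G) = ⊤) :
    ConnectedGraph G (G × S) where
  src e := e.1
  tgt e := e.1 * e.2
  connected := by
    set R := SimpleGraph.fromRel fun u v : G => ∃ e : G × S, e.1 = u ∧ e.1 * (e.2 : G) = v with hR
    have step : ∀ (g s : G), s ∈ S → R.Reachable g (g * s) := by
      intro g s hs
      by_cases h : g = g * s
      · rw [← h]
      · exact SimpleGraph.Adj.reachable
          ((SimpleGraph.fromRel_adj _ _ _).2 ⟨h, Or.inl ⟨(g, ⟨s, hs⟩), rfl, rfl⟩⟩)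
    have key : ∀ x : G, ∀ g : G, R.Reachable g (g * x) := by
      intro x
      have hx : x ∈ Subgroup.closure (S : Set G) := by rw [hS]; trivial
      induction hx using Subgroup.closure_induction with
      | mem x hx => exact fun g => step g x hx
      | one => intro g; rw [mul_one]
      | mul x y _ _ ihx ihy =>
        intro g
        rw [← mul_assoc]
        exact (ihx g).trans (ihy (g * x))
      | inv x _ ih =>
        intro g
        have := ih (g * x⁻¹)
        rw [inv_mul_cancel_right] at this
        exact this.symm
    have : Nonempty G := ⟨1⟩
    refine SimpleGraph.Connected.mk fun u v => ?_
    have := key (u⁻¹ * v) u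
    rwa [mul_inv_cancel_left] at this

variable {S : Finset G} {hS : Subgroup.closure (S : Set G) = ⊤}

/-- The canonical action of `G` on its Cayley graph by left multiplication. -/
instance : MulAction G (cayleyGraph S hS).PrePoint where
  smul g
    | .vertex v => .vertex (g * v)
    | .edge e t => .edge (g * e.1, e.2) t
  one_smul := by rintro (v | ⟨e, t⟩) <;> simp [HSMul.hSMul]
  mul_smul := by rintro g h (v | ⟨e, t⟩) <;> simp [HSMul.hSMul, mul_assoc]

theorem cayleyGraph_vdist_mul (g u v : G) :
    (cayleyGraph S hS).vdist (g * u) (g * v) = (cayleyGraph S hS).vdist u v := by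
  have key : ∀ g u v : G,
      (cayleyGraph S hS).vdist (g * u) (g * v) ≤ (cayleyGraph S hS).vdist u v := by
    intro g u v
    obtain ⟨p, hp⟩ := (cayleyGraph S hS).connected.exists_walk_length_eq_dist u v
    let φ : (SimpleGraph.fromRel fun u v => ∃ e, (cayleyGraph S hS).src e = u ∧
        (cayleyGraph S hS).tgt e = v) →g (SimpleGraph.fromRel fun u v => ∃ e,
        (cayleyGraph S hS).src e = u ∧ (cayleyGraph S hS).tgt e = v) :=
      { toFun := fun x => g * x
        map_rel' := by
          intro a b hab
          rw [SimpleGraph.fromRel_adj] at hab ⊢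
          refine ⟨fun h => hab.1 (mul_left_cancel h), ?_⟩
          rcases hab.2 with ⟨e, rfl, rfl⟩ | ⟨e, rfl, rfl⟩
          · exact Or.inl ⟨(g * e.1, e.2), rfl, mul_assoc _ _ _⟩
          · exact Or.inr ⟨(g * e.1, e.2), rfl, mul_assoc _ _ _⟩ }
    have := SimpleGraph.dist_le (p.map φ)
    rw [SimpleGraph.Walk.length_map, hp] at this
    unfold ConnectedGraph.vdist
    exact_mod_cast this
  refine le_antisymm (key g u v) ?_
  simpa using key g⁻¹ (g * u) (g * v)

theorem cayleyGraph_toVertex_smul (g : G) (p : (cayleyGraph S hS).PrePoint) (w : G) :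
    (cayleyGraph S hS).toVertex (g • p) (g * w) = (cayleyGraph S hS).toVertex p w := by
  cases p with
  | vertex v => exact cayleyGraph_vdist_mul g v w
  | edge e t =>
    have h1 := cayleyGraph_vdist_mul (hS := hS) g e.1 w
    have h2 := cayleyGraph_vdist_mul (hS := hS) g (e.1 * e.2) w
    rw [← mul_assoc] at h2
    change min ((t : ℝ) + (cayleyGraph S hS).vdist (g * e.1) (g * w))
      (1 - (t : ℝ) + (cayleyGraph S hS).vdist (g * e.1 * e.2) (g * w)) = _
    rw [h1, h2]
    rfl

theorem cayleyGraph_throughVertex_smul_le (g : G) (p q : (cayleyGraph S hS).PrePoint) :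
    (cayleyGraph S hS).throughVertex (g • p) (g • q) ≤ (cayleyGraph S hS).throughVertex p q := by
  obtain ⟨w, hw⟩ := (cayleyGraph S hS).exists_throughVertex p q
  have := (cayleyGraph S hS).throughVertex_le (g • p) (g • q) (g * w)
  rw [cayleyGraph_toVertex_smul, cayleyGraph_toVertex_smul] at this
  rw [hw]; exact this

theorem cayleyGraph_dist_smul_le (g : G) (p q : (cayleyGraph S hS).PrePoint) :
    dist (g • p) (g • q) ≤ dist p q := by
  change (cayleyGraph S hS).pdist _ _ ≤ (cayleyGraph S hS).pdist _ _
  rcases (cayleyGraph S hS).pdist_cases p q with h | ⟨e, s, t, rfl, rfl, h⟩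
  · rw [h]
    exact ((cayleyGraph S hS).pdist_le_throughVertex _ _).trans
      (cayleyGraph_throughVertex_smul_le g p q)
  · rw [h]
    exact (cayleyGraph S hS).pdist_edge_le (g * e.1, e.2) s t

instance : IsIsometricSMul G (cayleyGraph S hS).PrePoint where
  isometry_smul g := by
    refine Isometry.of_dist_eq fun p q => le_antisymm (cayleyGraph_dist_smul_le g p q) ?_
    simpa using cayleyGraph_dist_smul_le g⁻¹ (g • p) (g • q)

instance : IsIsometricSMul G (cayleyGraph S hS).Realization where
  isometry_smul g := by
    refine Isometry.of_dist_eq fun p q => ?_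
    obtain ⟨p, rfl⟩ := SeparationQuotient.surjective_mk p
    obtain ⟨q, rfl⟩ := SeparationQuotient.surjective_mk q
    rw [← SeparationQuotient.mk_smul, ← SeparationQuotient.mk_smul, SeparationQuotient.dist_mk,
      SeparationQuotient.dist_mk, dist_smul]

end Cayley

/-! ### Hyperbolicity and the bottleneck property -/

section Hyperbolic

/-- The Gromov product `(x | y)_o`. -/
noncomputable def gromovProduct {X : Type*} [MetricSpace X] (o x y : X) : ℝ :=
  (dist x o + dist y o - dist x y) / 2

/-- Gromov hyperbolicity. -/
def IsGromovHyperbolic (X : Type*) [MetricSpace X] : Prop :=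
  ∃ δ : ℝ, 0 ≤ δ ∧ ∀ o x y z : X,
    min (gromovProduct o x z) (gromovProduct o z y) - δ ≤ gromovProduct o x y

/-- The bottleneck property. -/
def HasBottleneckProperty (X : Type*) [MetricSpace X] : Prop :=
  ∃ Δ : ℝ, 0 < Δ ∧ ∀ x y : X, ∃ m : X,
    dist x m = dist x y / 2 ∧ dist y m = dist x y / 2 ∧ ∀ γ : Path x y, ∃ t, dist (γ t) m < Δ

/-- A bi-infinite `(K, L)`-quasi-geodesic. -/
def IsQuasiGeodesic {X : Type*} [MetricSpace X] (K L : ℝ) (l : ℝ → X) : Prop :=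
  1 ≤ K ∧ 0 ≤ L ∧ ∀ s t : ℝ, |s - t| / K - L ≤ dist (l s) (l t) ∧
    dist (l s) (l t) ≤ K * |s - t| + L

end Hyperbolic

/-! ### Bestvina–Fujiwara actions -/

section Action

variable {G : Type*} [Group G] {X : Type*} [MetricSpace X] [MulAction G X]

variable (X) in
/-- `g` acts hyperbolically: the orbit maps `t ↦ g ^ ⌊t⌋ • x` are quasi-geodesics. -/
def IsHyperbolicElement (g : G) : Prop :=
  ∀ x : X, ∃ K L : ℝ, IsQuasiGeodesic K L fun t : ℝ => g ^ ⌊t⌋ • x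

/-- `l` is a `(K, L)`-quasi-axis of `g` carrying the `g`-orientation: `g` acts on `l` as a
positive translation. -/
def IsQuasiAxis (K L : ℝ) (g : G) (l : ℝ → X) : Prop :=
  IsQuasiGeodesic K L l ∧ ∃ τ : ℝ, 0 < τ ∧ ∀ t, g • l t = l (t + τ)

variable (X) in
/-- Two hyperbolic elements are independent if their quasi-axes do not contain rays at finite
Hausdorff distance. -/
def AreIndependent (g₁ g₂ : G) : Prop :=
  IsHyperbolicElement X g₁ ∧ IsHyperbolicElement X g₂ ∧
    ∀ (K₁ L₁ K₂ L₂ : ℝ) (l₁ l₂ : ℝ → X), IsQuasiAxis K₁ L₁ g₁ l₁ → IsQuasiAxis K₂ L₂ g₂ l₂ →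
      ∀ (a b : ℝ) (I J : Set ℝ), I = Set.Ici a ∨ I = Set.Iic a → J = Set.Ici b ∨ J = Set.Iic b →
        Metric.hausdorffEDist (l₁ '' I) (l₂ '' J) = ⊤

variable (X) in
/-- The relation `g₁ ∼ g₂`: for some constants, arbitrarily long segments of a quasi-axis of `g₁`
can be moved by elements of `G` into the `B`-neighbourhood of a quasi-axis of `g₂`, preserving
orientation (a point of the second axis close to the image of the terminal endpoint is ahead of
a point close to the image of the initial endpoint). The constant `B` is the same for
all segments. -/
def BFRel (g₁ g₂ : G) : Prop :=
  ∃ (K L B : ℝ) (l₁ l₂ : ℝ → X), IsQuasiAxis K L g₁ l₁ ∧ IsQuasiAxis K L g₂ l₂ ∧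
    ∀ R : ℝ, ∃ a b : ℝ, R ≤ b - a ∧ ∃ g : G,
      (∀ u ∈ Set.Icc a b, ∃ v, dist (g • l₁ u) (l₂ v) ≤ B) ∧
      ∃ s t : ℝ, s < t ∧ dist (g • l₁ a) (l₂ s) ≤ B ∧ dist (g • l₁ b) (l₂ t) ≤ B

variable (G X) in
/-- A nonelementary action: there are two independent hyperbolic elements. -/
def IsNonelementaryAction : Prop := ∃ g₁ g₂ : G, AreIndependent X g₁ g₂

variable (G X) in
/-- A Bestvina–Fujiwara action: a nonelementary isometric action on a hyperbolic space with
independent hyperbolic elements `g₁ ≁ g₂`. -/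
def IsBestvinaFujiwaraAction [IsIsometricSMul G X] : Prop :=
  IsGromovHyperbolic X ∧ IsNonelementaryAction G X ∧
    ∃ g₁ g₂ : G, AreIndependent X g₁ g₂ ∧ ¬ BFRel X g₁ g₂

end Action

/-! ### Pseudocharacters -/

section Pseudocharacter

variable {G : Type*} [Group G]

/-- Pseudocharacters (homogeneous quasi-homomorphisms). -/
def IsPseudocharacter (f : G → ℝ) : Prop :=
  (∀ (g : G) (n : ℤ), f (g ^ n) = n * f g) ∧ ∃ C : ℝ, ∀ a b : G, |f a + f b - f (a * b)| ≤ C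

/-- The group element represented by the prefix of length `n` of an infinite word. -/
def prefixElt (w : ℕ → G) (n : ℕ) : G := ((List.range n).map w).prod

open Classical Filter in
/-- The sign of an infinite word: `1` if `f` tends to `+∞` along the path that starts at the identity
and spells `w`, `-1` if it tends to `-∞`, and `0` otherwise. Since the extension
of `f` to the path is affine on the edges, it is enough to look at the vertices. -/
noncomputable def wordSign (f : G → ℝ) (w : ℕ → G) : ℤ :=
  if Tendsto (fun n => f (prefixElt w n)) atTop atTop then 1
  else if Tendsto (fun n => f (prefixElt w n)) atTop atBot then -1 else 0

/-- The infinite words in `S ∪ S⁻¹` of sign `1` or `-1`. -/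
def signedWords (f : G → ℝ) (S : Finset G) : Set (ℕ → G) :=
  {w | (∀ i, w i ∈ S ∨ (w i)⁻¹ ∈ S) ∧ (wordSign f w = 1 ∨ wordSign f w = -1)}

/-- The relation `w ∼_C v`; the list `d` is the connecting word, and the group elements represented
by the prefixes of `d` are the products of `d.take k`, `k ≤ d.length`. -/
def WordRel (f : G → ℝ) (S : Finset G) (C : ℝ) (w v : ℕ → G) : Prop :=
  wordSign f w = wordSign f v ∧ ∀ D : ℝ, C < wordSign f w * D →
    ∃ d : List G, (∀ x ∈ d, x ∈ S ∨ x⁻¹ ∈ S) ∧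
      ∃ m n : ℕ, prefixElt w m * d.prod = prefixElt v n ∧
        ∀ k ≤ d.length, |f (prefixElt w m * (d.take k).prod) - D| ≤ C

/-- The class of `w` for the equivalence relation `∼` (`w ∼_C v` for some `C`). -/
def endClass (f : G → ℝ) (S : Finset G) (w : ℕ → G) : Set (ℕ → G) :=
  {v | v ∈ signedWords f S ∧ ∃ C : ℝ, WordRel f S C w v}

/-- `E(f, S)`, the set of equivalence classes of signed words. -/
def endSet (f : G → ℝ) (S : Finset G) : Set (Set (ℕ → G)) := endClass f S '' signedWords f S

/-- `E(f, S)⁺`. -/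
def posEndSet (f : G → ℝ) (S : Finset G) : Set (Set (ℕ → G)) :=
  endClass f S '' {w | w ∈ signedWords f S ∧ wordSign f w = 1}

/-- `E(f, S)⁻`. -/
def negEndSet (f : G → ℝ) (S : Finset G) : Set (Set (ℕ → G)) :=
  endClass f S '' {w | w ∈ signedWords f S ∧ wordSign f w = -1}

/-- `|E(f)| = 2`. -/
def IsUniformFor (f : G → ℝ) (S : Finset G) : Prop := (endSet f S).encard = 2

/-- `|E(f)⁺| = 1` or `|E(f)⁻| = 1`, and `f` is not uniform. -/
def IsUnipotentFor (f : G → ℝ) (S : Finset G) : Prop :=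
  ((posEndSet f S).encard = 1 ∨ (negEndSet f S).encard = 1) ∧ ¬ IsUniformFor f S

/-- A bushy pseudocharacter: a nontrivial pseudocharacter that is neither uniform nor unipotent
(for every finite generating set; the set of ends does not depend on it). -/
def IsBushy (f : G → ℝ) : Prop :=
  IsPseudocharacter f ∧ f ≠ 0 ∧ ∀ S : Finset G, Subgroup.closure (S : Set G) = ⊤ →
    ¬ IsUniformFor f S ∧ ¬ IsUnipotentFor f S

variable (G) in
/-- The real vector space spanned by the bushy pseudocharacters on `G`. -/
def bushySpan : Submodule ℝ (G → ℝ) := Submodule.span ℝ {f | IsBushy f}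

end Pseudocharacter

/-! The bottleneck property makes `X` a quasi-tree. It is used in the form `IsCoarseTree`: a chain
of points, with steps of any length, has a step that comes close to every point between its ends
(`exists_isCoarseTree`).

On such a space counting quasimorphisms are easy to build. Travel is discounted by a constant `W`
along the translates of a segment from `x₀` to `w • x₀`, and `c` is the resulting chain distance.
Since `c` is additive, up to a bounded error, at points between the ends, `c x y - c y x` is a
quasi-cocycle (`chainDist_quasicocycle`). Homogenizing `g ↦ c x₀ (g • x₀) - c (g • x₀) x₀` gives a
pseudocharacter bounded by the displacement of `x₀`. It vanishes on an element whose orbit has no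
copies of the segment in either direction, and is negative on `w * r` if the backward orbit has no
copies and the forward discounts are not outweighed by backtracking
(`exists_counting_pseudocharacter`).

Independent `g₁`, `g₂` play ping-pong: products of alternating long powers trace almost geodesics.
The condition `g₁ ≁ g₂` prevents long `g₁`-segments from running along `g₂`-segments in the same
direction (`exists_noOverlap`), and then `g₁⁻¹` cannot match both `g₁` and `g₂`. For the words `w i
= g₁ ^ n * g₂ ^ m * g₁ ^ k i` with rapidly growing `k i`, and the elements `e i = w i * g₂ ^ l`, the
pseudocharacters `f i` satisfy `f i (e j) = 0` for `j < i` and `f i (e i) ≠ 0`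
(`exists_pseudocharacter_family`).

Every nonzero pseudocharacter `F` bounded by a multiple of the displacement is bushy
(`isBushy_of_le_dist`). If `F g > 0`, then `g` is undistorted and has a conjugate whose forward
orbit diverges from that of `g`. A path connecting these two orbits passes near `x₀`, where `F` is
small, so the two orbits define different positive ends; the same applies to `-F`.

Finally, after normalizing defects, the series `∑ t ^ i • f i` with `0 < t < 1` are again such
pseudocharacters. Triangularity and a Vandermonde argument make them linearly independent
(`linearIndependent_tsum_pow_mul`), which gives continuum many. Conversely, `G` is countable, so `G
→ ℝ` has no larger dimension. -/

/-! ### Almost geodesic paths in the realization of a graph -/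

namespace ConnectedGraph

variable {V E : Type*} (Γ : ConnectedGraph V E)

/-- A vertex as a point of the realization. -/
noncomputable def vertexPoint (v : V) : Γ.Realization := SeparationQuotient.mk (.vertex v)

/-- The segment of the realization that corresponds to an edge. -/
noncomputable def edgeSegment (e : E) (t : unitInterval) : Γ.Realization := SeparationQuotient.mk (.edge e t)

theorem dist_vertexPoint (u v : V) : dist (Γ.vertexPoint u) (Γ.vertexPoint v) = Γ.vdist u v := by
  rw [vertexPoint, vertexPoint, SeparationQuotient.dist_mk]
  rfl

theorem dist_edgeSegment_le (e : E) (s t : unitInterval) :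
    dist (Γ.edgeSegment e s) (Γ.edgeSegment e t) ≤ |(s : ℝ) - t| := by
  rw [edgeSegment, edgeSegment, SeparationQuotient.dist_mk]
  exact Γ.pdist_edge_le e s t

theorem dist_edgeSegment_le_one (e : E) (s t : unitInterval) :
    dist (Γ.edgeSegment e s) (Γ.edgeSegment e t) ≤ 1 := by
  refine (Γ.dist_edgeSegment_le e s t).trans ?_
  have := s.2.1; have := s.2.2; have := t.2.1; have := t.2.2
  rw [abs_le]; constructor <;> linarith

theorem continuous_edgeSegment (e : E) : Continuous (Γ.edgeSegment e) :=
  (LipschitzWith.of_dist_le_mul (K := 1) fun s t => by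
    simpa [Subtype.dist_eq, Real.dist_eq] using Γ.dist_edgeSegment_le e s t).continuous

theorem edgeSegment_zero (e : E) : Γ.edgeSegment e 0 = Γ.vertexPoint (Γ.src e) := by
  rw [← dist_eq_zero, edgeSegment, vertexPoint, SeparationQuotient.dist_mk]
  refine le_antisymm ?_ (Γ.pdist_nonneg _ _)
  change min _ _ ≤ (0 : ℝ)
  simp [vdist_self]

theorem edgeSegment_one (e : E) : Γ.edgeSegment e 1 = Γ.vertexPoint (Γ.tgt e) := by
  rw [← dist_eq_zero, edgeSegment, vertexPoint, SeparationQuotient.dist_mk]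
  refine le_antisymm ?_ (Γ.pdist_nonneg _ _)
  change min _ _ ≤ (0 : ℝ)
  simp [vdist_self]

theorem exists_path_edgeSegment (e : E) (s t : unitInterval) :
    ∃ γ : Path (Γ.edgeSegment e s) (Γ.edgeSegment e t), ∀ r, ∃ r', γ r = Γ.edgeSegment e r' := by
  have : PathConnectedSpace unitInterval := isPathConnected_iff_pathConnectedSpace.1
    ((convex_Icc (0 : ℝ) 1).isPathConnected ⟨0, by simp⟩)
  exact ⟨(PathConnectedSpace.somePath s t).map (Γ.continuous_edgeSegment e), fun _ => ⟨_, rfl⟩⟩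

/-- A point on an edge is within `1` of both ends of that edge. This costs the constant `2` once;
the other edges are paid for by the length of the walk. -/
theorem exists_path_walk {u v : V}
    (p : (SimpleGraph.fromRel fun u v => ∃ e, Γ.src e = u ∧ Γ.tgt e = v).Walk u v) :
    ∃ γ : Path (Γ.vertexPoint u) (Γ.vertexPoint v), ∀ t,
      dist (Γ.vertexPoint u) (γ t) + dist (γ t) (Γ.vertexPoint v) ≤ p.length + 2 := by
  induction p with
  | nil => exact ⟨Path.refl _, by simp⟩
  | @cons u v w h p ih =>
    obtain ⟨γ, hγ⟩ := ih
    have hvw : dist (Γ.vertexPoint v) (Γ.vertexPoint w) ≤ p.length := by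
      rw [dist_vertexPoint, vdist]
      exact_mod_cast SimpleGraph.dist_le p
    obtain ⟨α, hα⟩ : ∃ α : Path (Γ.vertexPoint u) (Γ.vertexPoint v), ∀ t,
        dist (Γ.vertexPoint u) (α t) ≤ 1 ∧ dist (α t) (Γ.vertexPoint v) ≤ 1 := by
      rw [SimpleGraph.fromRel_adj] at h
      rcases h.2 with ⟨e, rfl, rfl⟩ | ⟨e, rfl, rfl⟩
      · rw [← edgeSegment_zero, ← edgeSegment_one]
        obtain ⟨α, hα⟩ := Γ.exists_path_edgeSegment e 0 1
        refine ⟨α, fun t => ?_⟩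
        obtain ⟨r, hr⟩ := hα t
        rw [hr]
        exact ⟨Γ.dist_edgeSegment_le_one e _ _, Γ.dist_edgeSegment_le_one e _ _⟩
      · rw [← edgeSegment_zero, ← edgeSegment_one]
        obtain ⟨α, hα⟩ := Γ.exists_path_edgeSegment e 1 0
        refine ⟨α, fun t => ?_⟩
        obtain ⟨r, hr⟩ := hα t
        rw [hr]
        exact ⟨Γ.dist_edgeSegment_le_one e _ _, Γ.dist_edgeSegment_le_one e _ _⟩
    refine ⟨α.trans γ, fun t => ?_⟩
    have huv : dist (Γ.vertexPoint u) (Γ.vertexPoint v) ≤ 1 := by simpa using (hα 1).1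
    have ht : α.trans γ t ∈ Set.range α ∪ Set.range γ := by
      rw [← Path.trans_range]; exact Set.mem_range_self t
    rw [SimpleGraph.Walk.length_cons]
    push_cast
    rcases ht with ⟨s, hs⟩ | ⟨s, hs⟩
    · rw [← hs]
      have := hα s
      have := dist_triangle (α s) (Γ.vertexPoint v) (Γ.vertexPoint w)
      linarith
    · rw [← hs]
      have := hγ s
      have := dist_triangle (Γ.vertexPoint u) (Γ.vertexPoint v) (γ s)
      linarith

theorem exists_path_vertex (x : Γ.Realization) :
    ∃ (v : V) (γ : Path x (Γ.vertexPoint v)), ∀ t, dist x (γ t) ≤ 1 := by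
  obtain ⟨p, rfl⟩ := SeparationQuotient.surjective_mk x
  cases p with
  | vertex v =>
    change ∃ (w : V) (γ : Path (Γ.vertexPoint v) (Γ.vertexPoint w)), ∀ t,
      dist (Γ.vertexPoint v) (γ t) ≤ 1
    exact ⟨v, Path.refl _, fun t => by simp⟩
  | edge e s =>
    change ∃ (w : V) (γ : Path (Γ.edgeSegment e s) (Γ.vertexPoint w)), ∀ t,
      dist (Γ.edgeSegment e s) (γ t) ≤ 1
    refine ⟨Γ.src e, ?_⟩
    rw [← edgeSegment_zero]
    obtain ⟨α, hα⟩ := Γ.exists_path_edgeSegment e s 0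
    refine ⟨α, fun t => ?_⟩
    obtain ⟨r, hr⟩ := hα t
    rw [hr]
    exact Γ.dist_edgeSegment_le_one e _ _

/-- The constant `6` has three shares of `2`: moving `x` and `y` to vertices may lengthen the
distance by `2`, the walk wastes at most `2`, and reaching its ends from `x` and `y` costs another
`2`. -/
theorem exists_almost_geodesic (x y : Γ.Realization) :
    ∃ γ : Path x y, ∀ t, dist x (γ t) + dist (γ t) y ≤ dist x y + 6 := by
  obtain ⟨u, α, hα⟩ := Γ.exists_path_vertex x
  obtain ⟨v, β, hβ⟩ := Γ.exists_path_vertex y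
  obtain ⟨p, hp⟩ := Γ.connected.exists_walk_length_eq_dist u v
  obtain ⟨γ, hγ⟩ := Γ.exists_path_walk p
  have hp' : (p.length : ℝ) = dist (Γ.vertexPoint u) (Γ.vertexPoint v) := by
    rw [dist_vertexPoint, hp]; rfl
  have hx : dist x (Γ.vertexPoint u) ≤ 1 := by simpa using hα 1
  have hy : dist y (Γ.vertexPoint v) ≤ 1 := by simpa using hβ 1
  have h4 := dist_triangle4 (Γ.vertexPoint u) x y (Γ.vertexPoint v)
  rw [dist_comm (Γ.vertexPoint u) x] at h4
  refine ⟨(α.trans γ).trans β.symm, fun t => ?_⟩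
  have ht : (α.trans γ).trans β.symm t ∈ (Set.range α ∪ Set.range γ) ∪ Set.range β := by
    rw [← Path.trans_range, ← Path.symm_range β, ← Path.trans_range]; exact Set.mem_range_self t
  rcases ht with (⟨s, hs⟩ | ⟨s, hs⟩) | ⟨s, hs⟩ <;> rw [← hs]
  · have := hα s
    have := dist_triangle_left (α s) y x
    linarith
  · have := hγ s
    have := dist_triangle x (Γ.vertexPoint u) (γ s)
    have := dist_triangle (γ s) (Γ.vertexPoint v) y
    have := dist_comm (Γ.vertexPoint v) y
    linarith
  · have := hβ s
    have := dist_triangle x y (β s)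
    have := dist_comm y (β s)
    linarith

end ConnectedGraph

/-! ### Coarse trees -/

/-- The length of the detour through `p` on the way from `x` to `y`. -/
noncomputable def detour {X : Type*} [MetricSpace X] (x p y : X) : ℝ :=
  dist x p + dist p y - dist x y

/-- A metric space that looks like a tree up to an additive error: a chain of points from `x` to
`y` has a step that comes close to every point between `x` and `y`. -/
structure IsCoarseTree (X : Type*) [MetricSpace X] (D : ℝ) : Prop where
  nonneg : 0 ≤ D
  chain : ∀ (z : ℕ → X) (n : ℕ) (p : X), 0 < n →
    ∃ i < n, detour (z i) p (z (i + 1)) ≤ detour (z 0) p (z n) + D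
  inter : ∀ (x y : X) (r : ℝ), 0 ≤ r → r ≤ dist x y → ∃ q, dist x q = r ∧ detour x q y ≤ D

section BottleneckToCoarseTree

variable {X : Type*} [MetricSpace X]

theorem four_point_of_gromovProduct {δ : ℝ} (h : ∀ o x y z : X,
      min (gromovProduct o x z) (gromovProduct o z y) - δ ≤ gromovProduct o x y) (x y z w : X) :
    dist x y + dist z w ≤ dist x z + dist y w + 2 * δ ∨
      dist x y + dist z w ≤ dist x w + dist y z + 2 * δ := by
  have h := h w x y z
  have := dist_comm y z
  simp only [gromovProduct] at h
  rcases min_choice ((dist x w + dist z w - dist x z) / 2) ((dist z w + dist y w - dist z y) / 2)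
    with h' | h' <;> rw [h'] at h
  · left; linarith
  · right; linarith

theorem exists_between_of_path {E : ℝ} (hE : ∀ x y : X, ∃ γ : Path x y, ∀ t, detour x (γ t) y ≤ E)
    (x y : X) (r : ℝ) (h0 : 0 ≤ r) (hr : r ≤ dist x y) :
    ∃ q, dist x q = r ∧ detour x q y ≤ E := by
  obtain ⟨γ, hγ⟩ := hE x y
  have hc : Continuous fun t => dist x (γ t) := by fun_prop
  obtain ⟨t, ht⟩ := intermediate_value_univ 0 1 hc (show r ∈ Set.Icc _ _ by simpa using ⟨h0, hr⟩)
  exact ⟨γ t, ht, hγ t⟩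

/-- The bottleneck property only speaks about midpoints. To apply it at `q`, the path is extended by
almost geodesics from `x'` to `x` and from `y` to `y'`, where `x'` and `y'` lie at distance about
`s` on the two sides of `q`. Then `q` is close to the midpoint of `x'` and `y'`, and the added
pieces stay far from `q`, so `γ` itself passes nearby. -/
theorem path_near_of_bottleneck {δ E Δ : ℝ} (hΔ : 0 < Δ) (hE0 : 0 ≤ E) (hδ : 0 ≤ δ)
    (h4 : ∀ x y z w : X, dist x y + dist z w ≤ dist x z + dist y w + 2 * δ ∨
      dist x y + dist z w ≤ dist x w + dist y z + 2 * δ)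
    (hE : ∀ x y : X, ∃ γ : Path x y, ∀ t, detour x (γ t) y ≤ E)
    (hb : ∀ x y : X, ∃ m : X, dist x m = dist x y / 2 ∧ dist y m = dist x y / 2 ∧
      ∀ γ : Path x y, ∃ t, dist (γ t) m < Δ)
    {x y q : X} (hq : detour x q y ≤ E) (γ : Path x y) :
    ∃ t, dist (γ t) q ≤ 2 * Δ + 4 * E + 8 * δ + 1 := by
  -- The added pieces stay at distance at least `s - 2 * E` from `q`, which must exceed `Δ` plus the
  -- distance `E + 4 * δ` from `q` to the midpoint.
  set s := Δ + 3 * E + 4 * δ + 1 with hs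
  unfold detour at hq
  rcases le_or_gt (dist x q) s with h1 | h1
  · exact ⟨0, by simp only [γ.source]; linarith⟩
  rcases le_or_gt (dist q y) (s + E) with h2 | h2
  · exact ⟨1, by simp only [γ.target]; rw [dist_comm]; linarith⟩
  obtain ⟨x', hx', hx''⟩ := exists_between_of_path hE x y (dist x q - s) (by linarith)
    (by linarith)
  obtain ⟨y', hy', hy''⟩ := exists_between_of_path hE x y (dist x q + s) (by linarith)
    (by linarith)
  obtain ⟨α, hα⟩ := hE x' x
  obtain ⟨β, hβ⟩ := hE y y'
  obtain ⟨m, hm1, hm2, hm⟩ := hb x' y'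
  unfold detour at hx'' hy'' hα hβ
  have e1 : dist x' q ≤ s + E + 2 * δ := by
    rcases h4 x' q x y with h | h <;> simp only [dist_comm] at * <;> linarith
  have e2 : dist q y' ≤ s + E + 2 * δ := by
    rcases h4 q y' x y with h | h <;> simp only [dist_comm] at * <;> linarith
  have e3 : 2 * s ≤ dist x' y' := by
    have := dist_triangle x x' y'; linarith
  have e4 : dist q m ≤ E + 4 * δ := by
    rcases h4 q m x' y' with h | h <;> simp only [dist_comm] at * <;> linarith
  obtain ⟨t, ht⟩ := hm ((α.trans γ).trans β)
  have ht' : (α.trans γ).trans β t ∈ (Set.range α ∪ Set.range γ) ∪ Set.range β := by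
    rw [← Path.trans_range, ← Path.trans_range]; exact Set.mem_range_self t
  have e5 := dist_triangle ((α.trans γ).trans β t) m q
  rw [dist_comm m q] at e5
  rcases ht' with (⟨r, hr⟩ | ⟨r, hr⟩) | ⟨r, hr⟩ <;> rw [← hr] at e5 ht
  · have := hα r
    have := dist_triangle x (α r) q
    rw [dist_comm x' x, dist_comm _ x] at *
    linarith [dist_nonneg (x := x') (y := α r), dist_comm (α r) x]
  · exact ⟨r, by linarith⟩
  · have := hβ r
    have := dist_triangle q (β r) y
    have := dist_triangle x q y
    linarith [dist_nonneg (x := β r) (y := y'), dist_comm (β r) q, dist_comm (β r) y,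
      dist_comm y y']

theorem exists_path_through {E : ℝ}
    (hE : ∀ x y : X, ∃ γ : Path x y, ∀ t, detour x (γ t) y ≤ E) (z : ℕ → X) (n : ℕ) :
    ∃ γ : Path (z 0) (z (n + 1)), ∀ t, ∃ i < n + 1, detour (z i) (γ t) (z (i + 1)) ≤ E := by
  induction n with
  | zero =>
    obtain ⟨γ, hγ⟩ := hE (z 0) (z 1)
    exact ⟨γ, fun t => ⟨0, by simp, hγ t⟩⟩
  | succ n ih =>
    obtain ⟨γ, hγ⟩ := ih
    obtain ⟨α, hα⟩ := hE (z (n + 1)) (z (n + 1 + 1))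
    refine ⟨γ.trans α, fun t => ?_⟩
    have ht : γ.trans α t ∈ Set.range γ ∪ Set.range α := by
      rw [← Path.trans_range]; exact Set.mem_range_self t
    rcases ht with ⟨s, hs⟩ | ⟨s, hs⟩ <;> rw [← hs]
    · obtain ⟨i, hi, h⟩ := hγ s
      exact ⟨i, by omega, h⟩
    · exact ⟨n + 1, by omega, hα s⟩

/-- A hyperbolic space with the bottleneck property and almost geodesic paths is a
coarse tree. -/
theorem exists_isCoarseTree (hyp : IsGromovHyperbolic X) (hb : HasBottleneckProperty X) {E : ℝ}
    (hE0 : 0 ≤ E) (hE : ∀ x y : X, ∃ γ : Path x y, ∀ t, detour x (γ t) y ≤ E) :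
    ∃ D, IsCoarseTree X D := by
  obtain ⟨δ, hδ, hyp⟩ := hyp
  obtain ⟨Δ, hΔ, hb⟩ := hb
  have h4 := four_point_of_gromovProduct hyp
  set C := 2 * Δ + 4 * E + 8 * δ + 1 with hC
  -- The point `q` below is a coarse projection of `p` to a geodesic from `x` to `y`: its distance
  -- from `x` is the Gromov product `(p | y)_x`, so `p` is at distance about half its detour from
  -- `q`, and `γ` passes near `q`.
  have near : ∀ (x y p : X) (γ : Path x y),
      ∃ t, 2 * dist (γ t) p ≤ detour x p y + 2 * C + 2 * E + 4 * δ := by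
    intro x y p γ
    have t1 := dist_triangle_left x y p
    have t2 := dist_triangle x p y
    have t3 := dist_triangle_right p y x
    have c1 := dist_comm p x
    have c2 := dist_comm y p
    have c3 := dist_comm y x
    obtain ⟨q, hq, hq'⟩ := exists_between_of_path hE x y ((dist x p + dist x y - dist p y) / 2)
      (by linarith [dist_triangle_left p y x]) (by linarith [dist_triangle_left x p y])
    obtain ⟨t, ht⟩ := path_near_of_bottleneck hΔ hE0 hδ h4 hE hb hq' γ
    refine ⟨t, ?_⟩
    have := dist_triangle (γ t) q p
    have := dist_comm q p
    unfold detour at *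
    rcases h4 p q x y with h | h
    · linarith
    · have := dist_comm q x
      linarith
  refine ⟨E + 2 * C + 2 * E + 4 * δ, by positivity, fun z n p hn => ?_, fun x y r h0 hr => ?_⟩
  · obtain ⟨n, rfl⟩ := Nat.exists_eq_add_of_le' hn
    -- The chain is joined by almost geodesics; the point of this path near `p` lies on one piece,
    -- and that piece is the required step.
    obtain ⟨γ, hγ⟩ := exists_path_through hE z n
    obtain ⟨t, ht⟩ := near _ _ p γ
    obtain ⟨i, hi, h⟩ := hγ t
    refine ⟨i, hi, ?_⟩
    have t1 := dist_triangle (z i) (γ t) p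
    have t2 := dist_triangle p (γ t) (z (i + 1))
    have := dist_comm p (γ t)
    have e : detour (z i) p (z (i + 1)) ≤ detour (z i) (γ t) (z (i + 1)) + 2 * dist (γ t) p := by
      unfold detour; linarith
    linarith
  · obtain ⟨q, h1, h2⟩ := exists_between_of_path hE x y r h0 hr
    exact ⟨q, h1, by linarith⟩

end BottleneckToCoarseTree

namespace IsCoarseTree

variable {X : Type*} [MetricSpace X] {D : ℝ}

/-- This is the chain axiom for the two-step chain `x, z, y` and the point `w`. -/
theorem four_point (hX : IsCoarseTree X D) (x y z w : X) :
    dist x y + dist z w ≤ dist x z + dist y w + D ∨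
      dist x y + dist z w ≤ dist x w + dist y z + D := by
  obtain ⟨i, hi, h⟩ := hX.chain (fun i => if i = 0 then x else if i = 1 then z else y) 2 w
    (by norm_num)
  have := dist_comm w z
  have := dist_comm w y
  have := dist_comm y z
  unfold detour at h
  interval_cases i
  · left; simp at h; linarith
  · right; simp at h; linarith

theorem exists_center (hX : IsCoarseTree X D) (x y z : X) :
    ∃ p, detour x p y ≤ 3 * D ∧ detour y p z ≤ 3 * D ∧ detour x p z ≤ 3 * D := by
  have hD := hX.nonneg
  -- In a tree the branch point lies at distance `(y | z)_x` from `x` on the way to `y`.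
  obtain ⟨p, hp, hp'⟩ := hX.inter x y ((dist x z + dist x y - dist z y) / 2)
    (by linarith [dist_triangle_left z y x]) (by linarith [dist_triangle_right x z y, dist_comm z y])
  refine ⟨p, by linarith, ?_⟩
  unfold detour at *
  have := dist_comm y p
  have := dist_comm z p
  have := dist_comm z y
  have := dist_comm z x
  have := dist_comm p x
  rcases hX.four_point z p x y with h | h <;> constructor <;> linarith

/-- A chain of points with steps of bounded length comes close to every point between
its endpoints. -/
theorem exists_near (hX : IsCoarseTree X D) {M C : ℝ} {z : ℕ → X} {i j : ℕ} (hij : i ≤ j) {p : X}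
    (hM : ∀ k, i ≤ k → k < j → dist (z k) (z (k + 1)) ≤ M) (hM0 : 0 ≤ M)
    (hp : detour (z i) p (z j) ≤ C) :
    ∃ k, i ≤ k ∧ k ≤ j ∧ dist (z k) p ≤ C + D + M := by
  have hD := hX.nonneg
  obtain ⟨n, rfl⟩ := Nat.exists_eq_add_of_le hij
  rcases Nat.eq_zero_or_pos n with rfl | hn
  · refine ⟨i, le_rfl, le_rfl, ?_⟩
    simp only [detour, add_zero, dist_self] at hp
    linarith [dist_comm p (z i), dist_nonneg (x := z i) (y := p)]
  · obtain ⟨k, hk, h⟩ := hX.chain (fun k => z (i + k)) n p hn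
    refine ⟨i + k, by omega, by omega, ?_⟩
    simp only [add_zero] at h
    have h1 := hM (i + k) (by omega) (by omega)
    have h4 : detour (z (i + k)) p (z (i + k + 1)) ≤ C + D := by
      have : i + (k + 1) = i + k + 1 := by ring
      rw [this] at h
      linarith
    unfold detour at h4
    linarith [dist_nonneg (x := p) (y := z (i + k + 1))]

end IsCoarseTree

/-! ### Homogenization of quasimorphisms -/

section Homogenization

open Filter Topology

variable {G : Type*} [Group G]

theorem quasimorphism_pow_sub_le {H : G → ℝ} {C : ℝ} (hH : ∀ a b, |H a + H b - H (a * b)| ≤ C)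
    (h1 : H 1 = 0) (g : G) (n : ℕ) : |H (g ^ n) - n * H g| ≤ n * C := by
  induction n with
  | zero => simp [h1]
  | succ n ih =>
    have := hH (g ^ n) g
    rw [← pow_succ] at this
    push_cast
    rw [abs_le] at *
    constructor <;> linarith

theorem exists_tendsto_quasimorphism_pow {H : G → ℝ} {C : ℝ}
    (hH : ∀ a b, |H a + H b - H (a * b)| ≤ C) (h1 : H 1 = 0) (g : G) :
    ∃ l, Tendsto (fun n : ℕ => H (g ^ n) / n) atTop (𝓝 l) := by
  have hC : 0 ≤ C := (abs_nonneg _).trans (hH 1 1)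
  -- Adding the defect makes the sequence subadditive, so Fekete's lemma gives the limit; the extra
  -- `C / n` vanishes.
  have hs : Subadditive fun n => H (g ^ n) + C := by
    intro m n
    have := hH (g ^ m) (g ^ n)
    rw [← pow_add] at this
    rw [abs_le] at this
    linarith
  have hb : BddBelow (Set.range fun n : ℕ => (H (g ^ n) + C) / n) := by
    refine ⟨-(|H g| + C), ?_⟩
    rintro _ ⟨n, rfl⟩
    rcases Nat.eq_zero_or_pos n with rfl | hn
    · simp only [Nat.cast_zero, div_zero]
      linarith [abs_nonneg (H g)]
    · have hn' : (0 : ℝ) < n := by exact_mod_cast hn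
      have := quasimorphism_pow_sub_le hH h1 g n
      rw [abs_le] at this
      have h2 := mul_le_mul_of_nonneg_left (neg_abs_le (H g)) hn'.le
      simp only
      rw [le_div_iff₀ hn']
      nlinarith
  refine ⟨hs.lim, ?_⟩
  have h2 := (hs.tendsto_lim hb).sub (tendsto_const_div_atTop_nhds_zero_nat C)
  rw [sub_zero] at h2
  refine h2.congr fun n => ?_
  ring

/-- The homogenization of an antisymmetric quasimorphism is a pseudocharacter. -/
theorem exists_homogenization {H : G → ℝ} {C : ℝ} (hH : ∀ a b, |H a + H b - H (a * b)| ≤ C)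
    (hinv : ∀ a, H a⁻¹ = -H a) :
    ∃ f : G → ℝ, IsPseudocharacter f ∧
      ∀ g, Tendsto (fun n : ℕ => H (g ^ n) / n) atTop (𝓝 (f g)) := by
  have h1 : H 1 = 0 := by
    have := hinv 1
    rw [inv_one] at this
    linarith
  choose f hf using exists_tendsto_quasimorphism_pow hH h1
  have hfH : ∀ g, |f g - H g| ≤ C := by
    intro g
    refine le_of_tendsto ((hf g).sub_const (H g)).abs ?_
    filter_upwards [eventually_gt_atTop 0] with n hn
    have hn' : (0 : ℝ) < n := by exact_mod_cast hn
    have := quasimorphism_pow_sub_le hH h1 g n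
    have e : H (g ^ n) / n - H g = (H (g ^ n) - n * H g) / n := by field_simp
    rw [e, abs_div, abs_of_pos hn', div_le_iff₀ hn']
    linarith
  have hnat : ∀ (g : G) (m : ℕ), f (g ^ m) = m * f g := by
    intro g m
    rcases Nat.eq_zero_or_pos m with rfl | hm
    · have := hf 1
      simp only [one_pow, h1, zero_div] at this
      simp [tendsto_nhds_unique this tendsto_const_nhds]
    · have h2 : Tendsto (fun n : ℕ => m * n) atTop atTop :=
        tendsto_id.const_mul_atTop' hm
      have h3 := ((hf g).comp h2).const_mul (m : ℝ)
      refine tendsto_nhds_unique (hf (g ^ m)) (h3.congr fun n => ?_)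
      have hm' : (m : ℝ) ≠ 0 := by positivity
      simp only [Function.comp_apply, pow_mul, Nat.cast_mul]
      rcases Nat.eq_zero_or_pos n with rfl | hn
      · simp
      · have hn' : (n : ℝ) ≠ 0 := by positivity
        field_simp
  have hneg : ∀ g : G, f g⁻¹ = -f g := by
    intro g
    refine tendsto_nhds_unique (hf g⁻¹) ((hf g).neg.congr fun n => ?_)
    rw [inv_pow, hinv, neg_div]
  refine ⟨f, ⟨fun g n => ?_, 4 * C, fun a b => ?_⟩, hf⟩
  · obtain ⟨m, rfl | rfl⟩ := n.eq_nat_or_neg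
    · simpa using hnat g m
    · rw [zpow_neg, zpow_natCast, hneg, hnat]
      simp
  · have h2 := hfH a
    have h3 := hfH b
    have h4 := hfH (a * b)
    have h5 := hH a b
    rw [abs_le] at *
    constructor <;> linarith

end Homogenization

/-! ### Chain distances -/

section ChainDist

variable {X : Type*}

/-- The cost of the chain `z 0, …, z n`. -/
noncomputable def chainCost (κ : X → X → ℝ) (z : ℕ → X) (n : ℕ) : ℝ :=
  ∑ i ∈ Finset.range n, κ (z i) (z (i + 1))

/-- The least cost of a chain from `x` to `y`. -/
noncomputable def chainDist (κ : X → X → ℝ) (x y : X) : ℝ :=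
  sInf {r | ∃ (z : ℕ → X) (n : ℕ), z 0 = x ∧ z n = y ∧ chainCost κ z n = r}

variable {κ : X → X → ℝ}

theorem chainDist_le_chainCost (hκ : ∀ x y, 0 ≤ κ x y) (z : ℕ → X) (n : ℕ) :
    chainDist κ (z 0) (z n) ≤ chainCost κ z n :=
  csInf_le ⟨0, by rintro _ ⟨z, n, -, -, rfl⟩; exact Finset.sum_nonneg fun _ _ => hκ _ _⟩
    ⟨z, n, rfl, rfl, rfl⟩

theorem exists_chain (κ : X → X → ℝ) (x y : X) :
    ∃ z : ℕ → X, z 0 = x ∧ z 1 = y ∧ chainCost κ z 1 = κ x y :=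
  ⟨fun i => if i = 0 then x else y, by simp [chainCost]⟩

theorem le_chainDist {x y : X} {r : ℝ}
    (h : ∀ (z : ℕ → X) (n : ℕ), z 0 = x → z n = y → r ≤ chainCost κ z n) :
    r ≤ chainDist κ x y := by
  obtain ⟨z, h0, h1, -⟩ := exists_chain κ x y
  refine le_csInf ⟨_, z, 1, h0, h1, rfl⟩ ?_
  rintro _ ⟨z, n, h0, hn, rfl⟩
  exact h z n h0 hn

theorem chainDist_le (hκ : ∀ x y, 0 ≤ κ x y) (x y : X) : chainDist κ x y ≤ κ x y := by
  obtain ⟨z, rfl, rfl, h⟩ := exists_chain κ x y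
  exact (chainDist_le_chainCost hκ z 1).trans h.le

theorem chainDist_nonneg (hκ : ∀ x y, 0 ≤ κ x y) (x y : X) : 0 ≤ chainDist κ x y :=
  le_chainDist fun _ _ _ _ => Finset.sum_nonneg fun _ _ => hκ _ _

theorem chainDist_triangle (hκ : ∀ x y, 0 ≤ κ x y) (x y z : X) :
    chainDist κ x z ≤ chainDist κ x y + chainDist κ y z := by
  rw [← sub_le_iff_le_add]
  refine le_chainDist fun u m hu0 hum => ?_
  rw [sub_le_comm]
  refine le_chainDist fun v n hv0 hvn => ?_
  rw [sub_le_iff_le_add, add_comm]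
  have h := chainDist_le_chainCost hκ (fun i => if i ≤ m then u i else v (i - m)) (m + n)
  have e : chainCost κ (fun i => if i ≤ m then u i else v (i - m)) (m + n) =
      chainCost κ u m + chainCost κ v n := by
    unfold chainCost
    rw [Finset.sum_range_add]
    congr 1
    · refine Finset.sum_congr rfl fun i hi => ?_
      have := Finset.mem_range.1 hi
      simp [this.le, Nat.succ_le_of_lt this]
    · refine Finset.sum_congr rfl fun i hi => ?_
      rcases Nat.eq_zero_or_pos i with rfl | hi
      · simp [hum, hv0]
      · have h1 : ¬ i = 0 := by omega
        have h2 : m + i + 1 - m = i + 1 := by omega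
        simp only [add_le_iff_nonpos_right, Nat.le_zero, h1, if_false, h2, add_tsub_cancel_left]
        rw [if_neg (by omega)]
  rw [e] at h
  have e2 : (if m + n ≤ m then u (m + n) else v (m + n - m)) = z := by
    rcases Nat.eq_zero_or_pos n with rfl | hn
    · simp [hum, ← hv0, hvn]
    · simp [hn.ne', hvn]
  simp only [e2, zero_le, if_true, hu0] at h
  exact h

theorem chainDist_smul {G : Type*} [Group G] [MulAction G X]
    (hG : ∀ (g : G) x y, κ (g • x) (g • y) = κ x y) (g : G) (x y : X) :
    chainDist κ (g • x) (g • y) = chainDist κ x y := by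
  unfold chainDist
  congr 1
  ext r
  constructor
  · rintro ⟨z, n, h0, hn, rfl⟩
    refine ⟨fun i => g⁻¹ • z i, n, by simp [h0], by simp [hn], ?_⟩
    simp [chainCost, hG]
  · rintro ⟨z, n, h0, hn, rfl⟩
    refine ⟨fun i => g • z i, n, by simp [h0], by simp [hn], ?_⟩
    simp [chainCost, hG]

/-- A potential that increases by at most the cost along each step bounds the chain distance. -/
theorem le_chainDist_of_potential {φ : X → ℝ} (hφ : ∀ u v, φ v - φ u ≤ κ u v) (x y : X) :
    φ y - φ x ≤ chainDist κ x y := by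
  refine le_chainDist fun z n h0 hn => ?_
  rw [← h0, ← hn, ← Finset.sum_range_sub (fun i => φ (z i))]
  exact Finset.sum_le_sum fun i _ => hφ _ _

/-- The chain distance is almost additive along points between `x` and `y`. -/
theorem chainDist_add_le [MetricSpace X] (hκ : ∀ x y, 0 ≤ κ x y) {D W : ℝ} (hX : IsCoarseTree X D) (hle : ∀ x y, κ x y ≤ dist x y)
    (hW : ∀ x y, dist x y - W ≤ κ x y) (x p y : X) :
    chainDist κ x p + chainDist κ p y ≤ chainDist κ x y + (W + detour x p y + D) := by
  have hD := hX.nonneg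
  have hW0 : 0 ≤ W := by linarith [hle x y, hW x y]
  rw [← sub_le_iff_le_add]
  refine le_chainDist fun z n h0 hn => ?_
  have hxp := (chainDist_le hκ x p).trans (hle x p)
  have hpy := (chainDist_le hκ p y).trans (hle p y)
  rcases Nat.eq_zero_or_pos n with rfl | hnpos
  · have hxy : x = y := h0.symm.trans hn
    subst hxy
    simp only [chainCost, Finset.range_zero, Finset.sum_empty, detour, dist_self]
    linarith
  -- One step of the chain has a small detour through `p`. Inserting `p` there, at full price, loses
  -- at most the discount `W` of that step and the detour.
  · obtain ⟨i, hi, h⟩ := hX.chain z n p hnpos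
    rw [h0, hn] at h
    have h1 : chainDist κ x (z i) ≤ chainCost κ z i := by
      rw [← h0]; exact chainDist_le_chainCost hκ z i
    have h2 : chainDist κ (z (i + 1)) y ≤ chainCost κ (fun k => z (i + 1 + k)) (n - (i + 1)) := by
      have := chainDist_le_chainCost hκ (fun k => z (i + 1 + k)) (n - (i + 1))
      simp only [add_zero] at this
      rwa [show i + 1 + (n - (i + 1)) = n by omega, hn] at this
    have h3 : chainCost κ z n = chainCost κ z i + κ (z i) (z (i + 1)) +
        chainCost κ (fun k => z (i + 1 + k)) (n - (i + 1)) := by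
      unfold chainCost
      rw [← Finset.sum_range_succ]
      conv_lhs => rw [show n = (i + 1) + (n - (i + 1)) by omega, Finset.sum_range_add]
      rfl
    have h4 := chainDist_triangle hκ x (z i) p
    have h5 := chainDist_triangle hκ p (z (i + 1)) y
    have h6 := (chainDist_le hκ (z i) p).trans (hle _ _)
    have h7 := (chainDist_le hκ p (z (i + 1))).trans (hle _ _)
    have h8 := hW (z i) (z (i + 1))
    unfold detour at *
    linarith

/-- The antisymmetrized chain distance is a quasi-cocycle. -/
theorem chainDist_quasicocycle [MetricSpace X] (hκ : ∀ x y, 0 ≤ κ x y) {D W : ℝ} (hX : IsCoarseTree X D) (hle : ∀ x y, κ x y ≤ dist x y)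
    (hW : ∀ x y, dist x y - W ≤ κ x y) (x y z : X) :
    |(chainDist κ x y - chainDist κ y x) + (chainDist κ y z - chainDist κ z y)
      - (chainDist κ x z - chainDist κ z x)| ≤ 3 * (W + 4 * D) := by
  -- Each of the six chain distances splits at the center `p` up to `W + 4 * D`. After the splitting
  -- all terms cancel, and the three positive or the three negative distances give the total error.
  obtain ⟨p, h1, h2, h3⟩ := hX.exists_center x y z
  have hc : ∀ u v : X, detour u p v = detour v p u := by
    intro u v
    simp only [detour, dist_comm]
    ring
  have a1 := chainDist_add_le hκ hX hle hW x p y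
  have a2 := chainDist_add_le hκ hX hle hW y p z
  have a3 := chainDist_add_le hκ hX hle hW x p z
  have a4 := chainDist_add_le hκ hX hle hW y p x
  have a5 := chainDist_add_le hκ hX hle hW z p y
  have a6 := chainDist_add_le hκ hX hle hW z p x
  rw [hc] at a4 a5 a6
  have b1 := chainDist_triangle hκ x p y
  have b2 := chainDist_triangle hκ y p z
  have b3 := chainDist_triangle hκ x p z
  have b4 := chainDist_triangle hκ y p x
  have b5 := chainDist_triangle hκ z p y
  have b6 := chainDist_triangle hκ z p x
  rw [abs_le]
  constructor <;> linarith

end ChainDist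

/-! ### Counting pseudocharacters -/

section Counting

variable {G : Type*} [Group G] {X : Type*} [MetricSpace X] [MulAction G X]

/-- No translate of the segment from `x₀` to `w • x₀` runs along the way from `a` to `b`, in the
sense that the projection of the translate advances by the length of the segment up to
an error less than `W`. -/
def NotAligned (x₀ : X) (w : G) (W : ℝ) (a b : X) : Prop :=
  ∀ γ : G, (dist ((γ * w) • x₀) a - dist ((γ * w) • x₀) b) - (dist (γ • x₀) a - dist (γ • x₀) b) ≤
    2 * (dist x₀ (w • x₀) - W)

open Classical in
/-- The distance, discounted by `W` on the translates of the segment from `x₀` to `w • x₀`. -/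
noncomputable def discountCost (x₀ : X) (w : G) (W : ℝ) (u v : X) : ℝ :=
  if ∃ γ : G, γ • x₀ = u ∧ (γ * w) • x₀ = v then max 0 (dist u v - W) else dist u v

theorem discountCost_nonneg (x₀ : X) (w : G) (W : ℝ) (u v : X) :
    0 ≤ discountCost x₀ w W u v := by
  unfold discountCost
  split_ifs
  · exact le_max_left _ _
  · exact dist_nonneg

theorem discountCost_le {W : ℝ} (hW : 0 ≤ W) (x₀ : X) (w : G) (u v : X) :
    discountCost x₀ w W u v ≤ dist u v := by
  unfold discountCost
  split_ifs
  · exact max_le dist_nonneg (by linarith)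
  · exact le_rfl

theorem le_discountCost {W : ℝ} (hW : 0 ≤ W) (x₀ : X) (w : G) (u v : X) :
    dist u v - W ≤ discountCost x₀ w W u v := by
  unfold discountCost
  split_ifs
  · exact le_max_right _ _
  · linarith

variable [IsIsometricSMul G X]

theorem discountCost_smul (x₀ : X) (w : G) (W : ℝ) (g : G) (u v : X) :
    discountCost x₀ w W (g • u) (g • v) = discountCost x₀ w W u v := by
  have : (∃ γ : G, γ • x₀ = g • u ∧ (γ * w) • x₀ = g • v) ↔
      ∃ γ : G, γ • x₀ = u ∧ (γ * w) • x₀ = v := by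
    constructor
    · rintro ⟨γ, h1, h2⟩
      refine ⟨g⁻¹ * γ, ?_, ?_⟩
      · rw [mul_smul, h1, inv_smul_smul]
      · rw [mul_assoc, mul_smul, h2, inv_smul_smul]
    · rintro ⟨γ, h1, h2⟩
      refine ⟨g * γ, ?_, ?_⟩
      · rw [mul_smul, h1]
      · rw [mul_assoc, mul_smul, h2]
  unfold discountCost
  rw [dist_smul]
  by_cases h : ∃ γ : G, γ • x₀ = u ∧ (γ * w) • x₀ = v
  · rw [if_pos h, if_pos (this.2 h)]
  · rw [if_neg h, if_neg (mt this.1 h)]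

/-- The potential `(dist y a - dist y b) / 2` is `1`-Lipschitz and grows by `dist a b` from `a` to
`b`. Non-alignment says exactly that it grows on a discounted step by no more than the discounted
price, so no chain can profit from a discount. -/
theorem NotAligned.chainDist_eq {x₀ : X} {w : G} {W : ℝ} (hW : 0 ≤ W) {a b : X}
    (h : NotAligned x₀ w W a b) : chainDist (discountCost x₀ w W) a b = dist a b := by
  refine le_antisymm ((chainDist_le (discountCost_nonneg x₀ w W) a b).trans
    (discountCost_le hW x₀ w a b)) ?_
  have := le_chainDist_of_potential (κ := discountCost x₀ w W)
    (φ := fun y => (dist y a - dist y b) / 2) ?_ a b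
  · simp only [dist_self] at this
    linarith [dist_comm a b]
  · intro u v
    unfold discountCost
    have h1 := dist_triangle v u a
    have h2 := dist_triangle u v b
    have h3 := dist_comm u v
    split_ifs with hγ
    · obtain ⟨γ, rfl, rfl⟩ := hγ
      have := h γ
      have e : dist (γ • x₀) ((γ * w) • x₀) = dist x₀ (w • x₀) := by rw [mul_smul, dist_smul]
      rw [e]
      exact le_max_of_le_right (by linarith)
    · linarith

/-- The counting pseudocharacter of a segment. -/
theorem exists_counting_pseudocharacter {D : ℝ} (hX : IsCoarseTree X D) (x₀ : X) (w : G) {W : ℝ}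
    (hW : 0 ≤ W) : ∃ f : G → ℝ, IsPseudocharacter f ∧ (∀ g, |f g| ≤ dist x₀ (g • x₀)) ∧
      (∀ e : G, (∀ n : ℕ, NotAligned x₀ w W x₀ (e ^ n • x₀)) →
        (∀ n : ℕ, NotAligned x₀ w W (e ^ n • x₀) x₀) → f e = 0) ∧
      ∀ r : G, W ≤ dist x₀ (w • x₀) → (∀ n : ℕ, NotAligned x₀ w W ((w * r) ^ n • x₀) x₀) →
        (∀ n : ℕ, n * (dist x₀ (w • x₀) + dist x₀ (r • x₀) - W + 1) ≤
          dist x₀ ((w * r) ^ n • x₀)) → f (w * r) ≤ -1 := by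
  set c := chainDist (discountCost x₀ w W) with hc
  have hκ := discountCost_nonneg x₀ w W
  have hle := discountCost_le hW x₀ w
  have hge := le_discountCost hW x₀ w
  have hcle : ∀ u v, c u v ≤ dist u v := fun u v => (chainDist_le hκ u v).trans (hle u v)
  have hc0 : ∀ u v, 0 ≤ c u v := chainDist_nonneg hκ
  have hinv : ∀ (g : G) (u v : X), c (g • u) (g • v) = c u v :=
    chainDist_smul (discountCost_smul x₀ w W)
  have hinv' : ∀ g : G, c x₀ (g⁻¹ • x₀) = c (g • x₀) x₀ := fun g => by
    rw [← hinv g, smul_inv_smul]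
  obtain ⟨f, hf, hlim⟩ := exists_homogenization
    (H := fun g : G => c x₀ (g • x₀) - c (g • x₀) x₀) (C := 3 * (W + 4 * D)) (fun a b => by
      have := chainDist_quasicocycle hκ hX hle hge x₀ (a • x₀) ((a * b) • x₀)
      rw [← hc] at this
      rw [mul_smul, hinv, hinv] at this
      rw [mul_smul]
      exact this) (fun a => by
      have h1 := hinv' a
      have h2 := hinv' a⁻¹
      rw [inv_inv] at h2
      simp only [h1, ← h2]
      ring)
  refine ⟨f, hf, fun g => ?_, fun e h1 h2 => ?_, fun r hwW h1 h2 => ?_⟩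
  · refine le_of_tendsto (hlim g).abs ?_
    filter_upwards [Filter.eventually_gt_atTop 0] with n hn
    have hn' : (0 : ℝ) < n := by exact_mod_cast hn
    have h3 : dist x₀ (g ^ n • x₀) ≤ n * dist x₀ (g • x₀) := by
      clear hn hn'
      induction n with
      | zero => simp
      | succ n ih =>
        have := dist_triangle x₀ (g ^ n • x₀) (g ^ (n + 1) • x₀)
        rw [pow_succ, mul_smul, dist_smul] at this
        rw [pow_succ, mul_smul]
        push_cast
        linarith
    rw [abs_div, abs_of_pos hn', div_le_iff₀ hn', mul_comm]
    refine le_trans ?_ h3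
    rw [abs_le]
    have a1 := hcle x₀ (g ^ n • x₀)
    have a2 := hcle (g ^ n • x₀) x₀
    have a3 := hc0 x₀ (g ^ n • x₀)
    have a4 := hc0 (g ^ n • x₀) x₀
    rw [dist_comm] at a2
    constructor <;> linarith
  · refine tendsto_nhds_unique (hlim e) (Filter.Tendsto.congr (fun n => ?_) tendsto_const_nhds)
    rw [hc, (h1 n).chainDist_eq hW, (h2 n).chainDist_eq hW, dist_comm, sub_self, zero_div]
  -- Forward, every period `w * r` earns one discount `W`; backward, the price is the full distance.
  -- The assumed growth of the distance leaves a gap of at least `1` per period.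
  · refine le_of_tendsto (hlim (w * r)) ?_
    filter_upwards [Filter.eventually_gt_atTop 0] with n hn
    have hn' : (0 : ℝ) < n := by exact_mod_cast hn
    rw [div_le_iff₀ hn', hc, (h1 n).chainDist_eq hW, ← hc]
    have h3 : c x₀ (w • x₀) ≤ dist x₀ (w • x₀) - W := by
      refine (chainDist_le hκ _ _).trans ?_
      unfold discountCost
      rw [if_pos ⟨1, by simp⟩]
      exact max_le (by linarith) le_rfl
    have h4 : c x₀ ((w * r) • x₀) ≤ dist x₀ (w • x₀) + dist x₀ (r • x₀) - W := by
      have a1 := chainDist_triangle hκ x₀ (w • x₀) ((w * r) • x₀)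
      rw [← hc, mul_smul, hinv] at a1
      rw [mul_smul]
      linarith [hcle x₀ (r • x₀)]
    have h5 : c x₀ ((w * r) ^ n • x₀) ≤ n * (dist x₀ (w • x₀) + dist x₀ (r • x₀) - W) := by
      clear hn hn'
      induction n with
      | zero => simpa using hcle x₀ x₀
      | succ n ih =>
        have a1 := chainDist_triangle hκ x₀ ((w * r) ^ n • x₀) ((w * r) ^ (n + 1) • x₀)
        rw [← hc, pow_succ, mul_smul, hinv] at a1
        rw [pow_succ, mul_smul]
        push_cast
        linarith
    have h6 := h2 n
    rw [dist_comm _ x₀]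
    linarith

end Counting

/-! ### Orbits of hyperbolic elements of a coarse tree -/

section Orbits

variable {G : Type*} [Group G]

theorem image_Ici_floor_zpow {Y : Type*} [MulAction G Y] (x₀ : Y) (g : G) :
    (fun t : ℝ => g ^ ⌊t⌋ • x₀) '' Set.Ici 0 = Set.range fun n : ℕ => g ^ n • x₀ := by
  ext x
  constructor
  · rintro ⟨t, ht, rfl⟩
    obtain ⟨n, hn⟩ := Int.eq_ofNat_of_zero_le (Int.floor_nonneg.2 (Set.mem_Ici.1 ht))
    exact ⟨n, by simp [hn]⟩
  · rintro ⟨n, rfl⟩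
    exact ⟨n, Set.mem_Ici.2 (Nat.cast_nonneg n), by simp⟩

theorem image_Iic_floor_zpow {Y : Type*} [MulAction G Y] (x₀ : Y) (g : G) :
    (fun t : ℝ => g ^ ⌊t⌋ • x₀) '' Set.Iic 0 = Set.range fun n : ℕ => g⁻¹ ^ n • x₀ := by
  ext x
  constructor
  · rintro ⟨t, ht, rfl⟩
    have h0 : ⌊t⌋ ≤ 0 := by
      have : ⌊t⌋ ≤ ⌊(0 : ℝ)⌋ := Int.floor_le_floor ht
      simpa using this
    obtain ⟨n, hn⟩ := Int.eq_ofNat_of_zero_le (neg_nonneg.2 h0)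
    refine ⟨n, ?_⟩
    have : ⌊t⌋ = -(n : ℤ) := by omega
    simp [this]
  · rintro ⟨n, rfl⟩
    refine ⟨-n, by simp, ?_⟩
    have : ⌊-(n : ℝ)⌋ = -(n : ℤ) := by
      rw [← Int.cast_natCast, ← Int.cast_neg, Int.floor_intCast]
    simp [this]

variable {X : Type*} [MetricSpace X] [MulAction G X]

theorem detour_comm (x p y : X) : detour x p y = detour y p x := by
  simp only [detour, dist_comm]
  ring

theorem detour_le_detour_add (x p q y : X) : detour x p y ≤ detour x q y + 2 * dist p q := by
  have h1 := dist_triangle x q p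
  have h2 := dist_triangle p q y
  have h3 := dist_comm p q
  unfold detour
  linarith

theorem detour_le_detour_add_ends (x p y x' y' : X) :
    detour x p y ≤ detour x' p y' + 2 * (dist x x' + dist y y') := by
  have h1 := dist_triangle x x' p
  have h2 := dist_triangle_right p y y'
  have h3 := dist_triangle4_left x' y' x y
  have h4 := dist_comm y y'
  have h5 := dist_triangle4 x' x y y'
  have h6 := dist_comm x' x
  unfold detour
  linarith

theorem detour_le_two_mul (x p y : X) : detour x p y ≤ 2 * dist x p := by
  have h1 := dist_triangle p x y
  have h2 := dist_comm p x
  unfold detour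
  linarith

theorem detour_smul [IsIsometricSMul G X] (g : G) (x p y : X) :
    detour (g • x) (g • p) (g • y) = detour x p y := by
  simp only [detour, dist_smul]

/-- The positive powers of `g` move `x₀` at a linear rate. -/
def IsUndistorted (x₀ : X) (g : G) : Prop :=
  ∃ K L : ℝ, 0 ≤ K ∧ ∀ n : ℕ, (n : ℝ) ≤ K * dist x₀ (g ^ n • x₀) + L

theorem IsHyperbolicElement.isUndistorted {g : G} (h : IsHyperbolicElement X g) (x₀ : X) :
    IsUndistorted x₀ g := by
  obtain ⟨K, L, hK, hL, h⟩ := h x₀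
  refine ⟨K, K * L, by linarith, fun n => ?_⟩
  have := (h 0 n).1
  simp only [Int.floor_zero, zpow_zero, one_smul, Int.floor_natCast, zpow_natCast, zero_sub,
    abs_neg, Nat.abs_cast] at this
  rw [sub_le_iff_le_add, div_le_iff₀ (by linarith)] at this
  linarith

theorem IsUndistorted.exists_le_dist {x₀ : X} {g : G} (h : IsUndistorted x₀ g) (T : ℝ) :
    ∃ n : ℕ, ∀ m, n ≤ m → T ≤ dist x₀ (g ^ m • x₀) := by
  obtain ⟨K, L, hK, h⟩ := h
  obtain ⟨n, hn⟩ := exists_nat_gt (K * T + L)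
  refine ⟨n, fun m hm => ?_⟩
  by_contra! hlt
  have h1 := h m
  have h2 : (n : ℝ) ≤ m := by exact_mod_cast hm
  have := mul_le_mul_of_nonneg_left hlt.le hK
  linarith

theorem isQuasiAxis_orbit {K L : ℝ} {x₀ : X} {g : G}
    (h : IsQuasiGeodesic K L fun t : ℝ => g ^ ⌊t⌋ • x₀) :
    IsQuasiAxis K L g fun t : ℝ => g ^ ⌊t⌋ • x₀ := by
  refine ⟨h, 1, one_pos, fun t => ?_⟩
  beta_reduce
  rw [Int.floor_add_one, smul_smul, add_comm, zpow_add, zpow_one]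

variable [IsIsometricSMul G X]

theorem dist_pow_smul_le (x₀ : X) (g : G) (n : ℕ) :
    dist x₀ (g ^ n • x₀) ≤ n * dist x₀ (g • x₀) := by
  induction n with
  | zero => simp
  | succ n ih =>
    have := dist_triangle x₀ (g ^ n • x₀) (g ^ (n + 1) • x₀)
    rw [pow_succ, mul_smul, dist_smul] at this
    rw [pow_succ, mul_smul]
    push_cast
    linarith

theorem dist_pow_smul_pow_smul (x₀ : X) (g : G) {i j : ℕ} (h : i ≤ j) :
    dist (g ^ i • x₀) (g ^ j • x₀) = dist x₀ (g ^ (j - i) • x₀) := by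
  conv_lhs => rw [← Nat.add_sub_cancel' h, pow_add, mul_smul, dist_smul]

theorem dist_pow_smul_succ (x₀ : X) (g : G) (i : ℕ) :
    dist (g ^ i • x₀) (g ^ (i + 1) • x₀) = dist x₀ (g • x₀) := by
  rw [pow_succ, mul_smul, dist_smul]

theorem dist_inv_pow_smul (x₀ : X) (g : G) (n : ℕ) :
    dist x₀ (g⁻¹ ^ n • x₀) = dist x₀ (g ^ n • x₀) := by
  rw [← dist_smul (g ^ n), smul_smul, inv_pow, mul_inv_cancel, one_smul, dist_comm]

theorem IsUndistorted.inv {x₀ : X} {g : G} (h : IsUndistorted x₀ g) : IsUndistorted x₀ g⁻¹ := by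
  obtain ⟨K, L, hK, h⟩ := h
  exact ⟨K, L, hK, fun n => by rw [dist_inv_pow_smul]; exact h n⟩

/-- Orbits of undistorted elements are close to geodesics. -/
theorem IsUndistorted.exists_detour_le {D : ℝ} (hX : IsCoarseTree X D) {x₀ : X} {g : G}
    (hg : IsUndistorted x₀ g) : ∃ C, 0 ≤ C ∧ ∀ i j k : ℕ, i ≤ j → j ≤ k →
      detour (g ^ i • x₀) (g ^ j • x₀) (g ^ k • x₀) ≤ C := by
  obtain ⟨K, L, hK, hg⟩ := hg
  have hD := hX.nonneg
  set M := dist x₀ (g • x₀) with hM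
  have hM0 : 0 ≤ M := dist_nonneg
  set s := 4 * D + M with hs
  have hL : 0 ≤ L := by simpa using hg 0
  refine ⟨2 * ((K * (2 * s) + L) * M + s) + 3 * D, by positivity, fun i j k hij hjk => ?_⟩
  -- The orbit passes near the center `q` both at a time `a ≤ j` and at a time `b ≥ j`.
  -- Undistortedness bounds `b - a`, hence `j - a`, so `g ^ j • x₀` is near `q` as well.
  obtain ⟨q, h1, h2, h3⟩ := hX.exists_center (g ^ i • x₀) (g ^ j • x₀) (g ^ k • x₀)
  obtain ⟨a, ha1, ha2, ha⟩ := hX.exists_near (z := fun n => g ^ n • x₀) (M := M) hij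
    (fun n _ _ => (dist_pow_smul_succ x₀ g n).le) hM0 h1
  obtain ⟨b, hb1, hb2, hb⟩ := hX.exists_near (z := fun n => g ^ n • x₀) (M := M) hjk
    (fun n _ _ => (dist_pow_smul_succ x₀ g n).le) hM0 h2
  have e1 := dist_triangle_right (g ^ a • x₀) (g ^ b • x₀) q
  rw [dist_pow_smul_pow_smul x₀ g (ha2.trans hb1)] at e1
  have e2 := hg (b - a)
  have e3 : ((j - a : ℕ) : ℝ) ≤ K * (2 * s) + L := by
    have : ((j - a : ℕ) : ℝ) ≤ (b - a : ℕ) := by exact_mod_cast Nat.sub_le_sub_right hb1 a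
    have := mul_le_mul_of_nonneg_left (show dist x₀ (g ^ (b - a) • x₀) ≤ 2 * s by linarith) hK
    linarith
  have e4 := dist_pow_smul_le x₀ g (j - a)
  rw [← dist_pow_smul_pow_smul x₀ g ha2] at e4
  have e5 := mul_le_mul_of_nonneg_right e3 hM0
  have e6 := dist_triangle_left (g ^ j • x₀) q (g ^ a • x₀)
  have e7 := detour_le_detour_add (g ^ i • x₀) (g ^ j • x₀) q (g ^ k • x₀)
  linarith

/-- If Gromov products between two orbit rays are unbounded, then the first is contained in a
neighbourhood of the second. -/
theorem exists_near_of_unbounded {D : ℝ} (hX : IsCoarseTree X D) {x₀ : X} {a b : G}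
    (ha : IsUndistorted x₀ a)
    (h : ∀ c, ∃ i j : ℕ, c < detour (a ^ i • x₀) x₀ (b ^ j • x₀)) :
    ∃ B, ∀ i : ℕ, ∃ j : ℕ, dist (a ^ i • x₀) (b ^ j • x₀) ≤ B := by
  obtain ⟨C, hC, ha⟩ := ha.exists_detour_le hX
  have hD := hX.nonneg
  refine ⟨C + D + dist x₀ (b • x₀), fun i => ?_⟩
  set p := a ^ i • x₀ with hp
  obtain ⟨i', j', hij⟩ := h (2 * (i * dist x₀ (a • x₀)) + 2 * dist p x₀ + C + D)
  have hi : i ≤ i' := by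
    by_contra! hlt
    have h1 := detour_le_two_mul (a ^ i' • x₀) x₀ (b ^ j' • x₀)
    have h2 := dist_pow_smul_le x₀ a i'
    have h3 : (i' : ℝ) * dist x₀ (a • x₀) ≤ i * dist x₀ (a • x₀) := by gcongr
    have := dist_comm x₀ (a ^ i' • x₀)
    linarith [dist_nonneg (x := p) (y := x₀)]
  have hd := ha 0 i i' (Nat.zero_le _) hi
  rw [pow_zero, one_smul] at hd
  -- The chain follows the `b`-orbit up to `b ^ j' • x₀` and then jumps to `a ^ i' • x₀`. The jump
  -- has a huge detour through `x₀`, hence through `p`, so the step close to `p` belongs to the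
  -- `b`-orbit.
  obtain ⟨k, hk, h⟩ := hX.chain (fun n => if n ≤ j' then b ^ n • x₀ else a ^ i' • x₀) (j' + 1) p
    (by omega)
  have e1 : ¬ j' + 1 ≤ j' := by omega
  simp only [Nat.zero_le, if_true, pow_zero, one_smul, e1, if_false, Nat.le_of_lt_succ hk] at h
  rcases Nat.lt_or_eq_of_le (Nat.le_of_lt_succ hk) with hlt | rfl
  · rw [if_pos (by omega)] at h
    refine ⟨k, ?_⟩
    have := dist_pow_smul_succ x₀ b k
    unfold detour at h hd
    rw [dist_comm]
    linarith [dist_nonneg (x := p) (y := b ^ (k + 1) • x₀)]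
  · exfalso
    rw [if_neg (by omega)] at h
    have := detour_le_detour_add (b ^ k • x₀) x₀ p (a ^ i' • x₀)
    rw [detour_comm] at this
    have := dist_comm x₀ p
    have : 0 ≤ (i : ℝ) * dist x₀ (a • x₀) := by positivity
    linarith

theorem exists_detour_le_of_hausdorffEDist {D : ℝ} (hX : IsCoarseTree X D) {x₀ : X} {a b : G}
    (ha : IsUndistorted x₀ a) (hb : IsUndistorted x₀ b)
    (h : Metric.hausdorffEDist (Set.range fun n : ℕ => a ^ n • x₀)
      (Set.range fun n : ℕ => b ^ n • x₀) = ⊤) :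
    ∃ c, ∀ i j : ℕ, detour (a ^ i • x₀) x₀ (b ^ j • x₀) ≤ c := by
  by_contra! hc
  obtain ⟨B₁, h1⟩ := exists_near_of_unbounded hX ha hc
  obtain ⟨B₂, h2⟩ := exists_near_of_unbounded hX hb (a := b) (b := a) fun c => by
    obtain ⟨i, j, hij⟩ := hc c
    exact ⟨j, i, by rwa [detour_comm]⟩
  have : Metric.hausdorffEDist (Set.range fun n : ℕ => a ^ n • x₀)
      (Set.range fun n : ℕ => b ^ n • x₀) ≤ ENNReal.ofReal (max B₁ B₂) := by
    refine Metric.hausdorffEDist_le_of_mem_edist ?_ ?_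
    · rintro _ ⟨i, rfl⟩
      obtain ⟨j, hj⟩ := h1 i
      refine ⟨_, ⟨j, rfl⟩, ?_⟩
      rw [edist_dist]
      exact ENNReal.ofReal_le_ofReal (hj.trans (le_max_left _ _))
    · rintro _ ⟨i, rfl⟩
      obtain ⟨j, hj⟩ := h2 i
      refine ⟨_, ⟨j, rfl⟩, ?_⟩
      rw [edist_dist]
      exact ENNReal.ofReal_le_ofReal (hj.trans (le_max_right _ _))
  rw [h] at this
  exact ENNReal.ofReal_ne_top (top_le_iff.1 this)

/-- Gromov products between the orbits of independent elements are bounded. -/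
theorem AreIndependent.exists_detour_le {D : ℝ} (hX : IsCoarseTree X D) {g₁ g₂ : G}
    (h : AreIndependent X g₁ g₂) (x₀ : X) :
    ∃ c, 0 ≤ c ∧ ∀ i j : ℤ, detour (g₁ ^ i • x₀) x₀ (g₂ ^ j • x₀) ≤ c := by
  obtain ⟨h1, h2, h⟩ := h
  have u1 := h1.isUndistorted x₀
  have u2 := h2.isUndistorted x₀
  obtain ⟨K₁, L₁, q1⟩ := h1 x₀
  obtain ⟨K₂, L₂, q2⟩ := h2 x₀
  have h := h K₁ L₁ K₂ L₂ _ _ (isQuasiAxis_orbit q1) (isQuasiAxis_orbit q2) 0 0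
  have a1 := h _ _ (Or.inl rfl) (Or.inl rfl)
  have a2 := h _ _ (Or.inl rfl) (Or.inr rfl)
  have a3 := h _ _ (Or.inr rfl) (Or.inl rfl)
  have a4 := h _ _ (Or.inr rfl) (Or.inr rfl)
  simp only [image_Ici_floor_zpow, image_Iic_floor_zpow] at a1 a2 a3 a4
  obtain ⟨c1, b1⟩ := exists_detour_le_of_hausdorffEDist hX u1 u2 a1
  obtain ⟨c2, b2⟩ := exists_detour_le_of_hausdorffEDist hX u1 u2.inv a2
  obtain ⟨c3, b3⟩ := exists_detour_le_of_hausdorffEDist hX u1.inv u2 a3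
  obtain ⟨c4, b4⟩ := exists_detour_le_of_hausdorffEDist hX u1.inv u2.inv a4
  refine ⟨|c1| + |c2| + |c3| + |c4|, by positivity, fun i j => ?_⟩
  have := abs_nonneg c1
  have := abs_nonneg c2
  have := abs_nonneg c3
  have := abs_nonneg c4
  obtain ⟨m, rfl | rfl⟩ := i.eq_nat_or_neg <;> obtain ⟨n, rfl | rfl⟩ := j.eq_nat_or_neg <;>
    simp only [zpow_neg, zpow_natCast, ← inv_pow]
  · linarith [b1 m n, le_abs_self c1]
  · linarith [b2 m n, le_abs_self c2]
  · linarith [b3 m n, le_abs_self c3]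
  · linarith [b4 m n, le_abs_self c4]

/-- A translate of an orbit segment of `g` of length at least `r` connects points close to the
endpoints of an orbit segment of `h`. -/
def OrbitsMatch (x₀ : X) (B : ℝ) (r : ℕ) (g h : G) : Prop :=
  ∃ (γ : G) (n m : ℕ), r ≤ n ∧ dist (γ • x₀) x₀ ≤ B ∧ dist ((γ * g ^ n) • x₀) (h ^ m • x₀) ≤ B

/-- Matching endpoints force the whole segments to fellow-travel: an intermediate point of the
`g`-segment lies almost between its ends, hence almost between `x₀` and `h ^ m • x₀`, and the
`h`-orbit is a chain that must pass near it. -/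
theorem IsUndistorted.exists_near_of_match {D : ℝ} (hX : IsCoarseTree X D) {x₀ : X} {g : G}
    (hg : IsUndistorted x₀ g) (h : G) (B : ℝ) : ∃ B', B ≤ B' ∧ ∀ (γ : G) (n m : ℕ),
      dist (γ • x₀) x₀ ≤ B → dist ((γ * g ^ n) • x₀) (h ^ m • x₀) ≤ B →
        ∀ u ≤ n, ∃ v, dist ((γ * g ^ u) • x₀) (h ^ v • x₀) ≤ B' := by
  obtain ⟨C, hC, hg⟩ := hg.exists_detour_le hX
  have hD := hX.nonneg
  refine ⟨C + 4 * |B| + D + dist x₀ (h • x₀), ?_, fun γ n m h1 h2 u hu => ?_⟩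
  · linarith [le_abs_self B, abs_nonneg B, dist_nonneg (x := x₀) (y := h • x₀)]
  · have e1 := hg 0 u n (Nat.zero_le _) hu
    rw [← detour_smul γ, pow_zero, one_smul, smul_smul, smul_smul] at e1
    have e2 := detour_le_detour_add_ends x₀ ((γ * g ^ u) • x₀) (h ^ m • x₀) (γ • x₀)
      ((γ * g ^ n) • x₀)
    rw [dist_comm x₀, dist_comm (h ^ m • x₀)] at e2
    obtain ⟨k, -, -, hk⟩ := hX.exists_near (z := fun n => h ^ n • x₀) (M := dist x₀ (h • x₀))
      (Nat.zero_le m) (p := (γ * g ^ u) • x₀) (C := C + 4 * |B|)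
      (fun n _ _ => (dist_pow_smul_succ x₀ h n).le) dist_nonneg (by
        simp only [pow_zero, one_smul]
        linarith [le_abs_self B])
    exact ⟨k, by rwa [dist_comm]⟩

theorem IsQuasiGeodesic.mono {K L K' L' : ℝ} {l : ℝ → X} (h : IsQuasiGeodesic K L l) (hK : K ≤ K')
    (hL : L ≤ L') : IsQuasiGeodesic K' L' l := by
  obtain ⟨h1, h2, h⟩ := h
  refine ⟨h1.trans hK, h2.trans hL, fun s t => ⟨?_, ?_⟩⟩
  · refine le_trans ?_ (h s t).1
    have : |s - t| / K' ≤ |s - t| / K := by gcongr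
    linarith
  · refine (h s t).2.trans ?_
    gcongr

theorem BFRel.of_match {D : ℝ} (hX : IsCoarseTree X D) {x₀ : X} {g h : G}
    (hg : IsHyperbolicElement X g) (hh : IsHyperbolicElement X h) {B : ℝ}
    (H : ∀ r, OrbitsMatch x₀ B r g h) : BFRel X g h := by
  obtain ⟨B', hB', near⟩ := (hg.isUndistorted x₀).exists_near_of_match hX h B
  obtain ⟨K₁, L₁, q1⟩ := hg x₀
  obtain ⟨K₂, L₂, q2⟩ := hh x₀
  refine ⟨max K₁ K₂, max L₁ L₂, B', _, _,
    isQuasiAxis_orbit (q1.mono (le_max_left _ _) (le_max_left _ _)),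
    isQuasiAxis_orbit (q2.mono (le_max_right _ _) (le_max_right _ _)), fun R => ?_⟩
  obtain ⟨N, hN⟩ := (hg.isUndistorted x₀).exists_le_dist (2 * B + 1)
  obtain ⟨N', hN'⟩ := exists_nat_ge R
  obtain ⟨γ, n, m, hn, h1, h2⟩ := H (max N N')
  -- If `m` were `0`, both ends of the translated segment would be within `B` of `x₀` although they
  -- are at least `2 * B + 1` apart. Positivity of `m` is the preserved orientation.
  have hm : 0 < m := by
    rcases Nat.eq_zero_or_pos m with rfl | hm
    · exfalso
      have e1 := hN n ((le_max_left _ _).trans hn)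
      rw [← dist_smul γ, smul_smul] at e1
      rw [pow_zero, one_smul] at h2
      have := dist_triangle_right (γ • x₀) ((γ * g ^ n) • x₀) x₀
      linarith
    · exact hm
  refine ⟨0, n, ?_, γ, ?_, 0, m, by exact_mod_cast hm, ?_, ?_⟩
  · have : (N' : ℝ) ≤ n := by exact_mod_cast (le_max_right _ _).trans hn
    linarith
  · rintro u ⟨hu0, hun⟩
    obtain ⟨k, hk⟩ := Int.eq_ofNat_of_zero_le (Int.floor_nonneg.2 hu0)
    have hkn : k ≤ n := by
      have h3 : ((⌊u⌋ : ℤ) : ℝ) ≤ n := (Int.floor_le u).trans hun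
      rw [hk] at h3
      exact_mod_cast h3
    obtain ⟨v, hv⟩ := near γ n m h1 h2 k hkn
    refine ⟨v, ?_⟩
    simpa [hk, smul_smul] using hv
  · simpa using h1.trans hB'
  · simpa [smul_smul] using h2.trans hB'

theorem OrbitsMatch.trans {D : ℝ} (hX : IsCoarseTree X D) {x₀ : X} {g h k : G} {B₁ B₂ : ℝ}
    (hh : IsUndistorted x₀ h)
    (h1 : ∀ r, OrbitsMatch x₀ B₁ r g h) (h2 : ∀ r, OrbitsMatch x₀ B₂ r h k) :
    ∃ B, ∀ r, OrbitsMatch x₀ B r g k := by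
  obtain ⟨B₂', hB₂', near⟩ := hh.exists_near_of_match hX k B₂
  refine ⟨B₁ + B₂', fun r => ?_⟩
  obtain ⟨γ, n, m, hn, e1, e2⟩ := h1 r
  -- The second match is taken at least as long as the `h`-segment of the first and is then cut off
  -- at time `m`.
  obtain ⟨δ, n', m', hn', e3, e4⟩ := h2 m
  obtain ⟨v, hv⟩ := near δ n' m' e3 e4 m hn'
  refine ⟨δ * γ, n, v, hn, ?_, ?_⟩
  · have := dist_triangle ((δ * γ) • x₀) (δ • x₀) x₀
    rw [mul_smul, dist_smul] at this
    rw [mul_smul]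
    linarith
  · have := dist_triangle ((δ * γ * g ^ n) • x₀) ((δ * h ^ m) • x₀) (k ^ v • x₀)
    rw [mul_assoc, mul_smul, mul_smul δ (h ^ m), dist_smul] at this
    rw [mul_assoc, mul_smul]
    rw [mul_smul δ (h ^ m)] at hv
    linarith

theorem OrbitsMatch.inv {x₀ : X} {g h : G} {B : ℝ} {r : ℕ} (H : OrbitsMatch x₀ B r g h) :
    OrbitsMatch x₀ B r g⁻¹ h⁻¹ := by
  obtain ⟨γ, n, m, hn, h1, h2⟩ := H
  -- The matched pair is shifted so that its terminal end lies at `x₀`; both segments are then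
  -- traversed backwards.
  refine ⟨(h ^ m)⁻¹ * (γ * g ^ n), n, m, hn, ?_, ?_⟩
  · rw [mul_smul, ← dist_smul (h ^ m), smul_inv_smul]
    exact h2
  · rw [inv_pow, inv_pow, mul_assoc, mul_inv_cancel_right, mul_smul, dist_smul]
    exact h1

end Orbits

/-! ### Broken geodesics and overlaps -/

section Overlap

variable {G : Type*} [Group G] {X : Type*} [MetricSpace X] [MulAction G X]

/-- This is the local-to-global step: when the middle piece from `b` to `p` is longer than the two
defects, one alternative of the four-point condition is impossible. The defect `c₁` does not enter
the bound, so errors do not accumulate along a broken geodesic. -/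
theorem detour_le_of_extend {D : ℝ} (hX : IsCoarseTree X D) {a b p q : X} {c₁ c₂ : ℝ}
    (h1 : detour a b p ≤ c₁) (h2 : detour b p q ≤ c₂) (h3 : c₁ + c₂ + D < 2 * dist b p) :
    detour a p q ≤ c₂ + D := by
  unfold detour at *
  rcases hX.four_point a p b q with h | h
  · linarith [dist_comm p b]
  · have := dist_comm p b
    linarith

/-- The points `u` and `v` lie on the way from `a` to `b`, in this order. -/
def Along (C : ℝ) (a u v b : X) : Prop :=
  dist a u + dist u v + dist v b ≤ dist a b + C

theorem Along.mono {C C' : ℝ} {a u v b : X} (h : Along C a u v b) (hC : C ≤ C') :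
    Along C' a u v b := by
  unfold Along at *
  linarith

theorem Along.dist_sub_le {C : ℝ} {a u v b : X} (h : Along C a u v b) :
    dist u v - C ≤ dist a v - dist a u := by
  have := dist_triangle a v b
  unfold Along at h
  linarith

theorem Along.dist_le {C : ℝ} {a u v b : X} (h : Along C a u v b) :
    dist a v ≤ dist a b + C := by
  have := dist_triangle a u v
  unfold Along at h
  linarith [dist_nonneg (x := v) (y := b)]

theorem broken_geodesic_detour_le {D : ℝ} (hX : IsCoarseTree X D) {z : ℕ → X} {n : ℕ} {c : ℝ}
    (hc0 : 0 ≤ c) (hc : ∀ i, i + 1 < n → detour (z i) (z (i + 1)) (z (i + 2)) ≤ c)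
    (hL : ∀ i < n, c + D < dist (z i) (z (i + 1))) {i : ℕ} (hi : i < n) :
    detour (z 0) (z i) (z (i + 1)) ≤ c + D := by
  have hD := hX.nonneg
  induction i with
  | zero => simp only [detour, dist_self]; linarith
  | succ i ih =>
    have h1 := hc i hi
    have h2 := hL i (by omega)
    exact detour_le_of_extend hX (ih (by omega)) h1 (by linarith)

/-- Broken geodesics with long pieces and small defects are almost geodesic. -/
theorem broken_geodesic_along {D : ℝ} (hX : IsCoarseTree X D) {z : ℕ → X} {n : ℕ} {c : ℝ}
    (hc0 : 0 ≤ c) (hc : ∀ i, i + 1 < n → detour (z i) (z (i + 1)) (z (i + 2)) ≤ c)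
    (hL : ∀ i < n, c + 2 * D < dist (z i) (z (i + 1))) {i : ℕ} (hi : i < n) :
    Along (2 * c + 3 * D) (z 0) (z i) (z (i + 1)) (z n) := by
  have hD := hX.nonneg
  have h1 := broken_geodesic_detour_le hX hc0 hc (fun j hj => by linarith [hL j hj]) hi
  -- The same bound for the reversed chain controls the part behind `z (i + 1)`; the two halves are
  -- then glued along the step from `z i` to `z (i + 1)`.
  have h2 := broken_geodesic_detour_le hX (z := fun j => z (n - j)) (n := n) (i := n - 1 - i) hc0
    (fun j hj => by
      rw [detour_comm]
      have := hc (n - (j + 2)) (by omega)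
      rwa [show n - (j + 2) + 1 = n - (j + 1) by omega, show n - (j + 2) + 2 = n - j by omega]
        at this)
    (fun j hj => by
      have := hL (n - (j + 1)) (by omega)
      rw [show n - (j + 1) + 1 = n - j by omega] at this
      rw [dist_comm]
      linarith) (by omega)
  simp only [Nat.sub_zero] at h2
  rw [show n - (n - 1 - i) = i + 1 by omega, show n - (n - 1 - i + 1) = i by omega,
    detour_comm] at h2
  have h3 := hL i hi
  have h4 := detour_le_of_extend hX h1 h2 (by linarith)
  unfold detour at h1 h4
  unfold Along
  linarith

theorem Along.dist_left_le {D C : ℝ} (hX : IsCoarseTree X D) {a u v b q : X}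
    (h : Along C a u v b) (hq : detour a q b ≤ D) (h1 : dist a u ≤ dist a q) :
    dist u q ≤ dist a q - dist a u + C + 2 * D := by
  have hD := hX.nonneg
  have := dist_triangle4 a u v b
  have := dist_triangle u v b
  unfold Along detour at *
  have := dist_comm u a
  have := dist_comm q a
  rcases hX.four_point u q a b with h | h <;> linarith

theorem Along.dist_right_le {D C : ℝ} (hX : IsCoarseTree X D) {a u v b q : X}
    (h : Along C a u v b) (hq : detour a q b ≤ D) (h1 : dist a q ≤ dist a v) :
    dist q v ≤ dist a v - dist a q + C + 2 * D := by
  have hD := hX.nonneg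
  have := dist_triangle4 a u v b
  have := dist_triangle a u v
  unfold Along detour at *
  have := dist_comm v a
  have := dist_comm q a
  rcases hX.four_point q v a b with h | h <;> linarith

theorem Along.detour_le {D C : ℝ} (hX : IsCoarseTree X D) {a u v b q : X}
    (h : Along C a u v b) (hq : detour a q b ≤ D) (h1 : dist a u ≤ dist a q)
    (h2 : dist a q ≤ dist a v) : detour u q v ≤ 2 * C + 4 * D := by
  have := h.dist_left_le hX hq h1
  have := h.dist_right_le hX hq h2
  have := dist_triangle a u v
  unfold detour
  linarith

/-- A translate of an orbit segment of `g` and a translate of an orbit segment of `h` that lie on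
the way from `a` to `b` in the same direction overlap in an interval of length less
than `ρ`. -/
def NoOverlap (x₀ : X) (C ρ : ℝ) (g h : G) : Prop :=
  ∀ (a b : X) (Q P : G) (k e : ℕ) (α β : ℝ),
    Along C a (Q • x₀) ((Q * g ^ k) • x₀) b → Along C a (P • x₀) ((P * h ^ e) • x₀) b →
    dist a (Q • x₀) ≤ α → β ≤ dist a ((Q * g ^ k) • x₀) →
    dist a (P • x₀) ≤ α → β ≤ dist a ((P * h ^ e) • x₀) → β ≤ dist a b → β - α < ρ

theorem NoOverlap.mono {x₀ : X} {C ρ ρ' : ℝ} {g h : G} (H : NoOverlap x₀ C ρ g h) (hρ : ρ ≤ ρ') :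
    NoOverlap x₀ C ρ' g h :=
  fun a b Q P k e α β h1 h2 h3 h4 h5 h6 h7 => (H a b Q P k e α β h1 h2 h3 h4 h5 h6 h7).trans_le hρ

variable [IsIsometricSMul G X]

/-- Locating two points close to an orbit segment. -/
theorem IsUndistorted.exists_locate {D : ℝ} (hX : IsCoarseTree X D) {x₀ : X} {g : G}
    (hg : IsUndistorted x₀ g) (C : ℝ) : ∃ B, 0 ≤ B ∧ ∀ (P : G) (e : ℕ) (q q' : X),
      detour (P • x₀) q ((P * g ^ e) • x₀) ≤ C → detour (P • x₀) q' ((P * g ^ e) • x₀) ≤ C →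
      dist (P • x₀) q + B ≤ dist (P • x₀) q' →
        ∃ s S, s ≤ S ∧ dist ((P * g ^ s) • x₀) q ≤ B ∧ dist ((P * g ^ S) • x₀) q' ≤ B := by
  obtain ⟨K, hK, hg⟩ := hg.exists_detour_le hX
  have hD := hX.nonneg
  have hM0 : 0 ≤ dist x₀ (g • x₀) := dist_nonneg
  set M := dist x₀ (g • x₀) with hM
  have near : ∀ (P : G) (e : ℕ) (q : X), detour (P • x₀) q ((P * g ^ e) • x₀) ≤ C →
      ∃ s ≤ e, dist ((P * g ^ s) • x₀) q ≤ |C| + D + M := by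
    intro P e q h
    obtain ⟨s, -, hs, h⟩ := hX.exists_near (z := fun n => (P * g ^ n) • x₀) (M := M)
      (Nat.zero_le e) (p := q) (C := |C|) (fun n _ _ => by
        rw [mul_smul, mul_smul, dist_smul, dist_pow_smul_succ]) hM0 (by
        simpa using h.trans (le_abs_self C))
    exact ⟨s, hs, h⟩
  have hC := abs_nonneg C
  refine ⟨2 * (|C| + D + M) + K + 1, by positivity, fun P e q q' h1 h2 h3 => ?_⟩
  obtain ⟨s, hs, hs'⟩ := near P e q h1
  obtain ⟨S, hS, hS'⟩ := near P e q' h2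
  refine ⟨s, S, ?_, by linarith, by linarith⟩
  -- With `S < s` the almost geodesic orbit would visit the point near `q'` before the point near
  -- `q`, against the assumed order of `q` and `q'`.
  by_contra! hlt
  have h4 := hg 0 S s (Nat.zero_le _) hlt.le
  rw [← detour_smul P, pow_zero, one_smul, smul_smul, smul_smul] at h4
  unfold detour at h4
  have h5 := dist_triangle (P • x₀) q ((P * g ^ s) • x₀)
  have h6 := dist_triangle (P • x₀) ((P * g ^ S) • x₀) q'
  rw [dist_comm q] at h5
  linarith [dist_nonneg (x := (P * g ^ S) • x₀) (y := (P * g ^ s) • x₀)]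

/-- The points at distances `α` and `β` on the way from `a` to `b` can be located on both orbit
segments. If `β - α` is large, the sub-segments between them match, with at least `r` steps of `g`,
which is excluded. -/
theorem exists_noOverlap {D : ℝ} (hX : IsCoarseTree X D) {x₀ : X} {g h : G}
    (hg : IsUndistorted x₀ g) (hh : IsUndistorted x₀ h)
    (H : ∀ B, ∃ r, ¬ OrbitsMatch x₀ B r g h) {C : ℝ} (hC : 0 ≤ C) :
    ∃ ρ, NoOverlap x₀ C ρ g h := by
  have hD := hX.nonneg
  obtain ⟨B₁, hB₁, loc1⟩ := hg.exists_locate hX (2 * C + 4 * D)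
  obtain ⟨B₂, hB₂, loc2⟩ := hh.exists_locate hX (2 * C + 4 * D)
  obtain ⟨r, hr⟩ := H (B₁ + B₂)
  refine ⟨r * dist x₀ (g • x₀) + 2 * B₁ + B₂ + C + 2 * D + 1,
    fun a b Q P k e α β h1 h2 h3 h4 h5 h6 h7 => ?_⟩
  by_contra! hlt
  apply hr
  have hM0 : 0 ≤ r * dist x₀ (g • x₀) := by positivity
  have hα : 0 ≤ α := dist_nonneg.trans h3
  obtain ⟨q, hq, hq'⟩ := hX.inter a b α hα (by linarith)
  obtain ⟨p, hp, hp'⟩ := hX.inter a b β (by linarith) h7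
  subst hq hp
  have a1 := h1.detour_le hX hq' h3 (by linarith)
  have a2 := h1.detour_le hX hp' (by linarith) h4
  have a3 := h2.detour_le hX hq' h5 (by linarith)
  have a4 := h2.detour_le hX hp' (by linarith) h6
  have b1 := h1.dist_left_le hX hq' h3
  have b2 := h2.dist_left_le hX hq' h5
  have b3 := dist_triangle a (Q • x₀) p
  have b4 := dist_triangle a (P • x₀) p
  obtain ⟨s, S, hs, c1, c2⟩ := loc1 Q k q p a1 a2 (by linarith)
  obtain ⟨s', S', hs', c3, c4⟩ := loc2 P e q p a3 a4 (by linarith)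
  refine ⟨(P * h ^ s')⁻¹ * (Q * g ^ s), S - s, S' - s', ?_, ?_, ?_⟩
  · by_contra! hlt2
    have d1 := dist_triangle a q p
    have d3 : dist ((Q * g ^ s) • x₀) ((Q * g ^ S) • x₀) ≤ r * dist x₀ (g • x₀) := by
      rw [mul_smul, mul_smul, dist_smul, dist_pow_smul_pow_smul x₀ g hs]
      refine (dist_pow_smul_le x₀ g _).trans ?_
      gcongr
    have d4 := dist_triangle4 q ((Q * g ^ s) • x₀) ((Q * g ^ S) • x₀) p
    rw [dist_comm q ((Q * g ^ s) • x₀)] at d4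
    linarith
  · rw [mul_smul, ← dist_smul (P * h ^ s'), smul_inv_smul]
    exact (dist_triangle_right _ _ q).trans (add_le_add c1 c3)
  · rw [mul_assoc, mul_assoc, ← pow_add, Nat.add_sub_cancel' hs, mul_smul,
      ← dist_smul (P * h ^ s'), smul_inv_smul, smul_smul, mul_assoc P, ← pow_add,
      Nat.add_sub_cancel' hs']
    exact (dist_triangle_right _ _ p).trans (add_le_add c2 c4)

end Overlap

/-! ### Intervals in a subdivided line -/

section Subdivision

/-- The first division point after `α` is at most `L` beyond it, and there is room for two
consecutive blocks, one of each parity. -/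
theorem exists_block_subset {t : ℕ → ℝ} {N : ℕ} {L α β : ℝ} (h0 : t 0 = 0)
    (hmono : ∀ i < N, t i ≤ t (i + 1)) (hstep : ∀ i < N, t (i + 1) ≤ t i + L) (hL : 0 < L) (hα : 0 ≤ α) (hβ : β ≤ t N)
    (h : α + 4 * L ≤ β) (p : ℕ) (hp : p < 2) :
    ∃ i < N, i % 2 = p ∧ α ≤ t i ∧ t (i + 1) ≤ β := by
  classical
  have hex : ∃ i, α ≤ t i := ⟨N, by linarith⟩
  set i := Nat.find hex with hi
  have h1 : α ≤ t i := Nat.find_spec hex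
  have h2 : i ≤ N := Nat.find_min' hex (by linarith)
  have h3 : t i ≤ α + L := by
    rcases Nat.eq_zero_or_pos i with h' | h'
    · rw [h', h0]; linarith
    · have := Nat.find_min hex (m := i - 1) (by omega)
      have h4 := hstep (i - 1) (by omega)
      rw [show i - 1 + 1 = i by omega] at h4
      linarith
  have hiN : i < N := by
    rcases Nat.lt_or_eq_of_le h2 with h' | h'
    · exact h'
    · rw [h'] at h3; linarith
  have h4 := hstep i hiN
  have hiN' : i + 1 < N := by
    rcases Nat.lt_or_eq_of_le (Nat.succ_le_of_lt hiN) with h' | h'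
    · exact h'
    · rw [← h'] at hβ
      have : t i.succ = t (i + 1) := rfl
      linarith
  have h5 := hstep (i + 1) hiN'
  by_cases hip : i % 2 = p
  · exact ⟨i, hiN, hip, h1, by linarith⟩
  · exact ⟨i + 1, hiN', by omega, h1.trans (hmono i hiN), by linarith⟩

/-- An interval that overlaps with no block of one parity in length `ρ` is confined to one block
of the other parity. -/
theorem exists_block_confining {t : ℕ → ℝ} {N p : ℕ} {ρ α β : ℝ} (h0 : t 0 = 0)
    (hmono : ∀ i < N, t i ≤ t (i + 1)) (hp : p < 2)
    (hlen : ∀ i < N, i % 2 = p → t i + ρ ≤ t (i + 1))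
    (hno : ∀ i < N, i % 2 = p → min β (t (i + 1)) - max α (t i) < ρ) (hα : 0 ≤ α) (hβ : β ≤ t N)
    (hρ : 0 < ρ) (h : α + ρ ≤ β) :
    ∃ i < N, i % 2 ≠ p ∧ t i - ρ ≤ α ∧ β ≤ t (i + 1) + ρ := by
  classical
  -- The interval cannot extend by `ρ` into a block of the forbidden parity, nor beyond the end of
  -- the line.
  have key : ∀ i, i ≤ N → (i < N → i % 2 = p) → α ≤ t i → β ≤ t i + ρ := by
    intro i hi hip hαi
    rcases Nat.lt_or_eq_of_le hi with h1 | rfl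
    · have h2 := hno i h1 (hip h1)
      have h3 := hlen i h1 (hip h1)
      rw [max_eq_right hαi] at h2
      rcases min_choice β (t (i + 1)) with h4 | h4 <;> rw [h4] at h2 <;> linarith
    · linarith
  have hex : ∃ i, α < t i := ⟨N, by linarith⟩
  obtain ⟨i, hi⟩ : ∃ i, Nat.find hex = i + 1 := by
    refine Nat.exists_eq_succ_of_ne_zero fun h' => ?_
    have := Nat.find_spec hex
    rw [h', h0] at this
    linarith
  have h1 : α < t (i + 1) := hi ▸ Nat.find_spec hex
  have h2 : t i ≤ α := not_lt.1 (Nat.find_min hex (by omega))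
  have h3 : i + 1 ≤ N := hi ▸ Nat.find_min' hex (by linarith)
  by_cases hip : i % 2 = p
  -- If `α` lies in a forbidden block, the end of that block is less than `ρ` away, and the next
  -- block is the confining one.
  · have h4 := hno i h3 hip
    rw [max_eq_left h2] at h4
    have h5 : t (i + 1) < α + ρ := by
      rcases min_choice β (t (i + 1)) with h4' | h4' <;> rw [h4'] at h4 <;> linarith
    have h6 : i + 1 < N := by
      rcases Nat.lt_or_eq_of_le h3 with h' | h'
      · exact h'
      · rw [← h'] at hβ; linarith
    have h7 := hmono (i + 1) h6
    exact ⟨i + 1, h6, by omega, by linarith,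
      key (i + 2) h6 (fun _ => by omega) (by linarith [h7])⟩
  · exact ⟨i, h3, hip, by linarith, key (i + 1) h3 (fun _ => by omega) h1.le⟩

end Subdivision

/-! ### Axes of products of powers -/

section Axis

variable {G : Type*} [Group G]

theorem prefixElt_zero (w : ℕ → G) : prefixElt w 0 = 1 := by simp [prefixElt]

theorem prefixElt_succ (w : ℕ → G) (n : ℕ) : prefixElt w (n + 1) = prefixElt w n * w n := by
  simp [prefixElt, List.range_succ]

/-- The periodic sequence `g₁ ^ n, g₂ ^ m, g₁ ^ k, g₂ ^ l, g₁ ^ n, …`. -/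
def blockWord (g₁ g₂ : G) (n m k l : ℕ) (i : ℕ) : G :=
  if i % 4 = 0 then g₁ ^ n else if i % 4 = 1 then g₂ ^ m else if i % 4 = 2 then g₁ ^ k else g₂ ^ l

theorem prefixElt_blockWord (g₁ g₂ : G) (n m k l N : ℕ) :
    prefixElt (blockWord g₁ g₂ n m k l) (4 * N) = (g₁ ^ n * g₂ ^ m * g₁ ^ k * g₂ ^ l) ^ N := by
  induction N with
  | zero => simp [prefixElt_zero]
  | succ N ih =>
    rw [show 4 * (N + 1) = 4 * N + 1 + 1 + 1 + 1 by ring]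
    simp only [prefixElt_succ, ih, pow_succ]
    have h0 : blockWord g₁ g₂ n m k l (4 * N) = g₁ ^ n := by
      simp [blockWord]
    have h1 : blockWord g₁ g₂ n m k l (4 * N + 1) = g₂ ^ m := by
      have : (4 * N + 1) % 4 = 1 := by omega
      simp [blockWord, this]
    have h2 : blockWord g₁ g₂ n m k l (4 * N + 1 + 1) = g₁ ^ k := by
      have : (4 * N + 1 + 1) % 4 = 2 := by omega
      simp [blockWord, this]
    have h3 : blockWord g₁ g₂ n m k l (4 * N + 1 + 1 + 1) = g₂ ^ l := by
      have : (4 * N + 1 + 1 + 1) % 4 = 3 := by omega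
      simp [blockWord, this]
    rw [h0, h1, h2, h3]
    simp only [mul_assoc]

theorem blockWord_eq_pow (g₁ g₂ : G) (n m k l : ℕ) (i : ℕ) :
    ∃ e : ℕ, blockWord g₁ g₂ n m k l i = (if i % 2 = 0 then g₁ else g₂) ^ e := by
  unfold blockWord
  have h : i % 4 = 0 ∨ i % 4 = 1 ∨ i % 4 = 2 ∨ i % 4 = 3 := by omega
  rcases h with h | h | h | h
  · have : i % 2 = 0 := by omega
    exact ⟨n, by simp [h, this]⟩
  · have : i % 2 = 1 := by omega
    exact ⟨m, by simp [h, this]⟩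
  · have : i % 2 = 0 := by omega
    exact ⟨k, by simp [h, this]⟩
  · have : i % 2 = 1 := by omega
    exact ⟨l, by simp [h, this]⟩

variable {X : Type*} [MetricSpace X] [MulAction G X] [IsIsometricSMul G X]

/-- Consecutive blocks are powers of different generators. Translating the middle point to `x₀`
turns the turn into a Gromov product of the two orbits, with the earlier exponent negated. -/
theorem detour_blockWord_le {x₀ : X} {g₁ g₂ : G} {c : ℝ}
    (hc : ∀ i j : ℤ, detour (g₁ ^ i • x₀) x₀ (g₂ ^ j • x₀) ≤ c) (n m k l i : ℕ) :
    detour (prefixElt (blockWord g₁ g₂ n m k l) i • x₀)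
      (prefixElt (blockWord g₁ g₂ n m k l) (i + 1) • x₀)
      (prefixElt (blockWord g₁ g₂ n m k l) (i + 2) • x₀) ≤ c := by
  rw [prefixElt_succ _ (i + 1), prefixElt_succ]
  set P := prefixElt (blockWord g₁ g₂ n m k l) i
  obtain ⟨e, he⟩ := blockWord_eq_pow g₁ g₂ n m k l i
  obtain ⟨e', he'⟩ := blockWord_eq_pow g₁ g₂ n m k l (i + 1)
  rw [he, he', ← detour_smul (P * (if i % 2 = 0 then g₁ else g₂) ^ e)⁻¹]
  simp only [smul_smul, inv_mul_cancel, one_smul, inv_mul_cancel_left, mul_inv_rev, mul_assoc,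
    mul_one]
  rcases Nat.mod_two_eq_zero_or_one i with h | h
  · have h' : (i + 1) % 2 = 1 := by omega
    simpa [h, h'] using hc (-e) e'
  · have h' : (i + 1) % 2 = 0 := by omega
    rw [detour_comm]
    simpa [h, h'] using hc e' (-e)

theorem dist_prefixElt_succ (x₀ : X) (w : ℕ → G) (i : ℕ) :
    dist (prefixElt w i • x₀) (prefixElt w (i + 1) • x₀) = dist x₀ (w i • x₀) := by
  rw [prefixElt_succ, mul_smul, dist_smul]

/-- The geometric data of a pair of elements that play ping-pong in a coarse tree. -/
structure IsPingPong (x₀ : X) (g₁ g₂ : G) (D c : ℝ) : Prop where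
  tree : IsCoarseTree X D
  nonneg : 0 ≤ c
  detour_le : ∀ i j : ℤ, detour (g₁ ^ i • x₀) x₀ (g₂ ^ j • x₀) ≤ c

namespace IsPingPong

variable {x₀ : X} {g₁ g₂ : G} {D c : ℝ} {n m k l : ℕ}

theorem dist_add_le (H : IsPingPong x₀ g₁ g₂ D c)
    (hL : ∀ i, c + 2 * D < dist x₀ (blockWord g₁ g₂ n m k l i • x₀)) (i : ℕ) :
    dist x₀ (prefixElt (blockWord g₁ g₂ n m k l) i • x₀) +
      dist x₀ (blockWord g₁ g₂ n m k l i • x₀) ≤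
        dist x₀ (prefixElt (blockWord g₁ g₂ n m k l) (i + 1) • x₀) + (c + D) := by
  have hD := H.tree.nonneg
  have h := broken_geodesic_detour_le H.tree
    (z := fun i => prefixElt (blockWord g₁ g₂ n m k l) i • x₀) (n := i + 1) (i := i) H.nonneg
    (fun j _ => detour_blockWord_le H.detour_le n m k l j)
    (fun j _ => by rw [dist_prefixElt_succ]; linarith [hL j]) (by omega)
  simp only [prefixElt_zero, one_smul] at h
  unfold detour at h
  rw [dist_prefixElt_succ] at h
  linarith

theorem along (H : IsPingPong x₀ g₁ g₂ D c)
    (hL : ∀ i, c + 2 * D < dist x₀ (blockWord g₁ g₂ n m k l i • x₀)) {i N : ℕ} (hi : i < N) :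
    Along (2 * c + 3 * D) x₀ (prefixElt (blockWord g₁ g₂ n m k l) i • x₀)
      (prefixElt (blockWord g₁ g₂ n m k l) (i + 1) • x₀)
      (prefixElt (blockWord g₁ g₂ n m k l) N • x₀) := by
  have h := broken_geodesic_along H.tree
    (z := fun i => prefixElt (blockWord g₁ g₂ n m k l) i • x₀) (n := N) (i := i) H.nonneg
    (fun j _ => detour_blockWord_le H.detour_le n m k l j)
    (fun j _ => by rw [dist_prefixElt_succ]; linarith [hL j]) hi
  simpa only [prefixElt_zero, one_smul] using h

theorem le_dist_word (H : IsPingPong x₀ g₁ g₂ D c)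
    (hL : ∀ i, c + 2 * D < dist x₀ (blockWord g₁ g₂ n m k l i • x₀)) :
    dist x₀ (g₁ ^ n • x₀) + dist x₀ (g₂ ^ m • x₀) + dist x₀ (g₁ ^ k • x₀) ≤
      dist x₀ ((g₁ ^ n * g₂ ^ m * g₁ ^ k) • x₀) + (2 * c + 3 * D) := by
  have h := H.along hL (i := 1) (N := 3) (by norm_num)
  simp only [Along, prefixElt_succ, prefixElt_zero, blockWord] at h
  norm_num at h
  have h1 : dist (g₁ ^ n • x₀) ((g₁ ^ n * g₂ ^ m) • x₀) = dist x₀ (g₂ ^ m • x₀) := by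
    rw [mul_smul, dist_smul]
  have h2 : dist ((g₁ ^ n * g₂ ^ m) • x₀) ((g₁ ^ n * g₂ ^ m * g₁ ^ k) • x₀) =
      dist x₀ (g₁ ^ k • x₀) := by
    rw [mul_smul _ (g₁ ^ k), dist_smul]
  rwa [h1, h2] at h

theorem le_dist_pow (H : IsPingPong x₀ g₁ g₂ D c)
    (hL : ∀ i, c + 2 * D < dist x₀ (blockWord g₁ g₂ n m k l i • x₀)) (N : ℕ) :
    N * (dist x₀ (g₁ ^ n • x₀) + dist x₀ (g₂ ^ m • x₀) + dist x₀ (g₁ ^ k • x₀) +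
      dist x₀ (g₂ ^ l • x₀) - 4 * (c + D)) ≤
      dist x₀ ((g₁ ^ n * g₂ ^ m * g₁ ^ k * g₂ ^ l) ^ N • x₀) := by
  rw [← prefixElt_blockWord]
  induction N with
  | zero => simp
  | succ N ih =>
    have h0 := H.dist_add_le hL (4 * N)
    have h1 := H.dist_add_le hL (4 * N + 1)
    have h2 := H.dist_add_le hL (4 * N + 1 + 1)
    have h3 := H.dist_add_le hL (4 * N + 1 + 1 + 1)
    have e1 : (4 * N + 1) % 4 = 1 := by omega
    have e2 : (4 * N + 1 + 1) % 4 = 2 := by omega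
    have e3 : (4 * N + 1 + 1 + 1) % 4 = 3 := by omega
    have b0 : blockWord g₁ g₂ n m k l (4 * N) = g₁ ^ n := by simp [blockWord]
    have b1 : blockWord g₁ g₂ n m k l (4 * N + 1) = g₂ ^ m := by simp [blockWord, e1]
    have b2 : blockWord g₁ g₂ n m k l (4 * N + 1 + 1) = g₁ ^ k := by simp [blockWord, e2]
    have b3 : blockWord g₁ g₂ n m k l (4 * N + 1 + 1 + 1) = g₂ ^ l := by simp [blockWord, e3]
    rw [b0] at h0
    rw [b1] at h1
    rw [b2] at h2
    rw [b3] at h3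
    rw [show 4 * (N + 1) = 4 * N + 1 + 1 + 1 + 1 by ring]
    push_cast
    linarith

/-- A segment along the axis that is longer than several blocks overlaps with a block of
either kind. -/
theorem false_of_long (H : IsPingPong x₀ g₁ g₂ D c) {C ρ L : ℝ} (hC : 2 * c + 3 * D ≤ C)
    (hρ : 0 < ρ) (hL : ∀ i, 3 * C + ρ ≤ dist x₀ (blockWord g₁ g₂ n m k l i • x₀))
    (hL' : ∀ i, dist x₀ (blockWord g₁ g₂ n m k l i • x₀) ≤ L) {p : ℕ} (hp : p < 2) {g : G}
    (hg : NoOverlap x₀ C ρ g (if p = 0 then g₁ else g₂)) {Q : G} {e N : ℕ}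
    (hQ : Along C x₀ (Q • x₀) ((Q * g ^ e) • x₀)
      (prefixElt (blockWord g₁ g₂ n m k l) N • x₀))
    (hlong : 4 * L + 2 * C ≤ dist x₀ (g ^ e • x₀)) : False := by
  have hc := H.nonneg
  have hD := H.tree.nonneg
  have hL2 : ∀ i, c + 2 * D < dist x₀ (blockWord g₁ g₂ n m k l i • x₀) := fun i => by
    linarith [hL i]
  set z := fun i => prefixElt (blockWord g₁ g₂ n m k l) i • x₀ with hz
  have hz0 : dist x₀ (z 0) = 0 := by simp [hz, prefixElt_zero]
  have e1 := hQ.dist_sub_le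
  rw [mul_smul, dist_smul, ← mul_smul] at e1
  have e2 := hQ.dist_le
  -- The interval is capped at `dist x₀ (z N)` because `Along` allows an overshoot by `C`. The block
  -- found inside it is longer than the permitted overlap `ρ`.
  obtain ⟨i, hi, hip, h1, h2⟩ := exists_block_subset (t := fun i => dist x₀ (z i)) (N := N)
    (L := L) (α := dist x₀ (Q • x₀)) (β := min (dist x₀ ((Q * g ^ e) • x₀)) (dist x₀ (z N)))
    hz0 (fun i _ => by
      have := H.dist_add_le hL2 i
      have := hL i
      simp only [hz]
      linarith) (fun i _ => by
      have := dist_triangle x₀ (z i) (z (i + 1))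
      simp only [hz] at this ⊢
      rw [dist_prefixElt_succ] at this
      linarith [hL' i]) (by linarith [hL 0, hL' 0]) dist_nonneg (min_le_right _ _)
      (le_min (by linarith) (by linarith)) p hp
  have h3 := le_min_iff.1 h2
  obtain ⟨e', he'⟩ := blockWord_eq_pow g₁ g₂ n m k l i
  have h4 := (H.along hL2 hi).mono hC
  rw [prefixElt_succ, he', hip] at h4
  have h5 := hg x₀ (z N) Q (prefixElt (blockWord g₁ g₂ n m k l) i) e e' (dist x₀ (z i))
    (dist x₀ (z (i + 1))) hQ h4 h1 h3.1 le_rfl (by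
      rw [← hip, ← he', ← prefixElt_succ]) h3.2
  have h6 := H.dist_add_le hL2 i
  have h7 := hL i
  simp only [hz] at h5
  linarith

/-- A segment along the axis that has only short overlaps with the blocks of one kind is confined
to one block of the other kind. -/
theorem exists_confining (H : IsPingPong x₀ g₁ g₂ D c) {C ρ : ℝ} (hC : 2 * c + 3 * D ≤ C)
    (hρ : 0 < ρ) (hL : ∀ i, 3 * C + ρ ≤ dist x₀ (blockWord g₁ g₂ n m k l i • x₀))
    {p : ℕ} (hp : p < 2) {g : G} (hg : NoOverlap x₀ C ρ g (if p = 0 then g₁ else g₂))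
    {Q : G} {e N : ℕ}
    (hQ : Along C x₀ (Q • x₀) ((Q * g ^ e) • x₀)
      (prefixElt (blockWord g₁ g₂ n m k l) N • x₀))
    (hlong : ρ + 2 * C ≤ dist x₀ (g ^ e • x₀)) :
    ∃ i < N, i % 2 ≠ p ∧
      dist x₀ (prefixElt (blockWord g₁ g₂ n m k l) i • x₀) - ρ ≤ dist x₀ (Q • x₀) ∧
      dist x₀ ((Q * g ^ e) • x₀) ≤
        dist x₀ (prefixElt (blockWord g₁ g₂ n m k l) (i + 1) • x₀) + ρ + C := by
  have hc := H.nonneg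
  have hD := H.tree.nonneg
  have hL2 : ∀ i, c + 2 * D < dist x₀ (blockWord g₁ g₂ n m k l i • x₀) := fun i => by
    linarith [hL i]
  set z := fun i => prefixElt (blockWord g₁ g₂ n m k l) i • x₀ with hz
  have hz0 : dist x₀ (z 0) = 0 := by simp [hz, prefixElt_zero]
  have hstep : ∀ i, dist x₀ (z i) + ρ ≤ dist x₀ (z (i + 1)) := fun i => by
    have := H.dist_add_le hL2 i
    have := hL i
    simp only [hz]
    linarith
  have e1 := hQ.dist_sub_le
  rw [mul_smul, dist_smul, ← mul_smul] at e1
  have e2 := hQ.dist_le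
  obtain ⟨i, hi, hip, h1, h2⟩ := exists_block_confining (t := fun i => dist x₀ (z i)) (N := N)
    (ρ := ρ) (α := dist x₀ (Q • x₀)) (β := min (dist x₀ ((Q * g ^ e) • x₀)) (dist x₀ (z N)))
    hz0 (fun i _ => by linarith [hstep i]) hp (fun i _ _ => hstep i) (fun i hi hip => by
      obtain ⟨e', he'⟩ := blockWord_eq_pow g₁ g₂ n m k l i
      have h4 := (H.along hL2 hi).mono hC
      rw [prefixElt_succ, he', hip] at h4
      refine hg x₀ (z N) Q (prefixElt (blockWord g₁ g₂ n m k l) i) e e' _ _ hQ h4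
        (le_max_left _ _) ((min_le_left _ _).trans (min_le_left _ _)) (le_max_right _ _) ?_
        ((min_le_left _ _).trans (min_le_right _ _))
      rw [← hip, ← he', ← prefixElt_succ]
      exact min_le_right _ _) dist_nonneg (min_le_right _ _) hρ
      (le_min (by linarith) (by linarith))
  refine ⟨i, hi, hip, h1, ?_⟩
  rcases min_choice (dist x₀ ((Q * g ^ e) • x₀)) (dist x₀ (z N)) with h | h <;> rw [h] at h2
  · linarith
  · linarith

end IsPingPong

end Axis

/-! ### Aligned segments -/

section Aligned

variable {G : Type*} [Group G] {X : Type*} [MetricSpace X] [MulAction G X] [IsIsometricSMul G X]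

/-- In a coarse tree, a segment whose projection advances almost by its own length must itself run
from near `a` towards `b`; this is the four-point condition for its ends and `a`, `b`. -/
theorem exists_along_of_not_notAligned {D : ℝ} (hX : IsCoarseTree X D) {x₀ : X} {w : G} {W : ℝ}
    {a b : X} (h : ¬ NotAligned x₀ w W a b) (hw : 2 * W + D ≤ 2 * dist x₀ (w • x₀)) :
    ∃ γ : G, dist a (γ • x₀) + dist x₀ (w • x₀) + dist ((γ * w) • x₀) b ≤
      dist a b + (2 * W + D) := by
  unfold NotAligned at h
  push Not at h
  obtain ⟨γ, h⟩ := h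
  refine ⟨γ, ?_⟩
  have e : dist (γ • x₀) ((γ * w) • x₀) = dist x₀ (w • x₀) := by rw [mul_smul, dist_smul]
  rw [← e] at h hw ⊢
  set u := γ • x₀
  set v := (γ * w) • x₀
  have h1 := dist_triangle v u a
  have h2 := dist_triangle u v b
  have := dist_comm u a
  have := dist_comm v a
  have := dist_comm v u
  rcases hX.four_point a v u b with h | h <;> linarith

namespace IsPingPong

variable {x₀ : X} {g₁ g₂ : G} {D c : ℝ} {n m k l n' m' k' l' : ℕ}

theorem exists_of_not_notAligned (H : IsPingPong x₀ g₁ g₂ D c) {W C ρ : ℝ} (hW : 0 ≤ W)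
    (hC : C = 2 * W + 2 * c + 4 * D) (hρ : 0 < ρ)
    (hw : ∀ i, 3 * C + ρ ≤ dist x₀ (blockWord g₁ g₂ n m k l i • x₀)) {a b : X}
    (h : ¬ NotAligned x₀ (g₁ ^ n * g₂ ^ m * g₁ ^ k) W a b) :
    ∃ γ : G, dist a (γ • x₀) + (dist x₀ (g₁ ^ n • x₀) + dist x₀ (g₂ ^ m • x₀) +
      dist x₀ (g₁ ^ k • x₀)) + dist ((γ * (g₁ ^ n * g₂ ^ m * g₁ ^ k)) • x₀) b ≤ dist a b + C := by
  have hc := H.nonneg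
  have hD := H.tree.nonneg
  have h1 := H.le_dist_word (n := n) (m := m) (k := k) (l := l) fun i => by linarith [hw i]
  have h2 : 3 * C + ρ ≤ dist x₀ (g₁ ^ n • x₀) := by simpa [blockWord] using hw 0
  have h3 : (0 : ℝ) ≤ dist x₀ (g₂ ^ m • x₀) := dist_nonneg
  have h4 : (0 : ℝ) ≤ dist x₀ (g₁ ^ k • x₀) := dist_nonneg
  obtain ⟨γ, hγ⟩ := exists_along_of_not_notAligned H.tree h (by linarith)
  exact ⟨γ, by linarith⟩

/-- A copy of the word would contain a `g₁ ^ k`-segment longer than four blocks of the other axis.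
It would cover a `g₂`-block of that axis in the same direction. -/
theorem notAligned_forward (H : IsPingPong x₀ g₁ g₂ D c) {W C ρ L : ℝ} (hW : 0 ≤ W)
    (hC : C = 2 * W + 2 * c + 4 * D) (hρ : 0 < ρ)
    (hw : ∀ i, 3 * C + ρ ≤ dist x₀ (blockWord g₁ g₂ n m k l i • x₀))
    (hL : ∀ i, 3 * C + ρ ≤ dist x₀ (blockWord g₁ g₂ n' m' k' l' i • x₀))
    (hL' : ∀ i, dist x₀ (blockWord g₁ g₂ n' m' k' l' i • x₀) ≤ L)
    (hlong : 4 * L + 2 * C ≤ dist x₀ (g₁ ^ k • x₀)) (hN : NoOverlap x₀ C ρ g₁ g₂) (N : ℕ) :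
    NotAligned x₀ (g₁ ^ n * g₂ ^ m * g₁ ^ k) W x₀
      (prefixElt (blockWord g₁ g₂ n' m' k' l') N • x₀) := by
  by_contra h
  have hD := H.tree.nonneg
  obtain ⟨γ, hγ⟩ := H.exists_of_not_notAligned hW hC hρ hw h
  refine H.false_of_long (p := 1) (g := g₁) (Q := γ * (g₁ ^ n * g₂ ^ m)) (e := k) (N := N)
    (by linarith) hρ hL hL' (by norm_num) (by simpa using hN) ?_ hlong
  have h1 := dist_triangle4 x₀ (γ • x₀) ((γ * g₁ ^ n) • x₀) ((γ * (g₁ ^ n * g₂ ^ m)) • x₀)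
  have h2 : dist (γ • x₀) ((γ * g₁ ^ n) • x₀) = dist x₀ (g₁ ^ n • x₀) := by
    rw [mul_smul, dist_smul]
  have h3 : dist ((γ * g₁ ^ n) • x₀) ((γ * (g₁ ^ n * g₂ ^ m)) • x₀) = dist x₀ (g₂ ^ m • x₀) := by
    rw [← mul_assoc, mul_smul _ (g₂ ^ m), dist_smul]
  have h4 : dist ((γ * (g₁ ^ n * g₂ ^ m)) • x₀) ((γ * (g₁ ^ n * g₂ ^ m) * g₁ ^ k) • x₀) =
      dist x₀ (g₁ ^ k • x₀) := by
    rw [mul_smul _ (g₁ ^ k), dist_smul]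
  unfold Along
  rw [h4, mul_assoc γ _ (g₁ ^ k)]
  linarith

/-- A copy of the word running from `b` to `x₀` is read from `x₀` as `g₁⁻¹ ^ k`, then a `g₂⁻¹ ^ m`
gap, then `g₁⁻¹ ^ n`. The last two conclusions bound the position of the final segment relative to
the end of the first. -/
theorem along_of_backward {C : ℝ} {b : X}
    {γ : G} (hγ : dist b (γ • x₀) + (dist x₀ (g₁ ^ n • x₀) + dist x₀ (g₂ ^ m • x₀) +
      dist x₀ (g₁ ^ k • x₀)) + dist ((γ * (g₁ ^ n * g₂ ^ m * g₁ ^ k)) • x₀) x₀ ≤ dist b x₀ + C) :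
    Along C x₀ ((γ * (g₁ ^ n * g₂ ^ m * g₁ ^ k)) • x₀)
      ((γ * (g₁ ^ n * g₂ ^ m * g₁ ^ k) * g₁⁻¹ ^ k) • x₀) b ∧
    Along C x₀ ((γ * g₁ ^ n) • x₀) ((γ * g₁ ^ n * g₁⁻¹ ^ n) • x₀) b ∧
    dist x₀ ((γ * (g₁ ^ n * g₂ ^ m * g₁ ^ k) * g₁⁻¹ ^ k) • x₀) + dist x₀ (g₂ ^ m • x₀) ≤
      dist x₀ ((γ * g₁ ^ n) • x₀) + C ∧
    dist x₀ ((γ * g₁ ^ n * g₁⁻¹ ^ n) • x₀) ≤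
      dist x₀ ((γ * (g₁ ^ n * g₂ ^ m * g₁ ^ k) * g₁⁻¹ ^ k) • x₀) + dist x₀ (g₂ ^ m • x₀) +
        dist x₀ (g₁ ^ n • x₀) := by
  have e1 : γ * (g₁ ^ n * g₂ ^ m * g₁ ^ k) * g₁⁻¹ ^ k = γ * (g₁ ^ n * g₂ ^ m) := by
    rw [inv_pow]; group
  have e2 : γ * g₁ ^ n * g₁⁻¹ ^ n = γ := by rw [inv_pow]; group
  have h2 : dist (γ • x₀) ((γ * g₁ ^ n) • x₀) = dist x₀ (g₁ ^ n • x₀) := by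
    rw [mul_smul, dist_smul]
  have h3 : dist ((γ * g₁ ^ n) • x₀) ((γ * (g₁ ^ n * g₂ ^ m)) • x₀) = dist x₀ (g₂ ^ m • x₀) := by
    rw [← mul_assoc, mul_smul _ (g₂ ^ m), dist_smul]
  have h4 : dist ((γ * (g₁ ^ n * g₂ ^ m)) • x₀) ((γ * (g₁ ^ n * g₂ ^ m * g₁ ^ k)) • x₀) =
      dist x₀ (g₁ ^ k • x₀) := by
    rw [← mul_assoc γ (g₁ ^ n * g₂ ^ m), mul_smul _ (g₁ ^ k), dist_smul]
  rw [e1, e2]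
  unfold Along
  set y0 := γ • x₀
  set y1 := (γ * g₁ ^ n) • x₀
  set y2 := (γ * (g₁ ^ n * g₂ ^ m)) • x₀
  set y3 := (γ * (g₁ ^ n * g₂ ^ m * g₁ ^ k)) • x₀
  rw [← h2, ← h3, ← h4] at hγ
  rw [← h2, ← h3]
  clear h2 h3 h4
  have t1 := dist_triangle4 b y0 y1 y2
  have t2 := dist_triangle4 x₀ y3 y2 y1
  have t3 := dist_triangle b y0 y1
  have t4 := dist_triangle b y1 x₀
  have t5 := dist_triangle4 x₀ y2 y1 y0
  have t6 := dist_triangle x₀ y3 y2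
  simp only [dist_comm] at *
  refine ⟨by linarith, by linarith, by linarith, by linarith⟩

theorem notAligned_backward (H : IsPingPong x₀ g₁ g₂ D c) {W C ρ L : ℝ} (hW : 0 ≤ W)
    (hC : C = 2 * W + 2 * c + 4 * D) (hρ : 0 < ρ)
    (hw : ∀ i, 3 * C + ρ ≤ dist x₀ (blockWord g₁ g₂ n m k l i • x₀))
    (hL : ∀ i, 3 * C + ρ ≤ dist x₀ (blockWord g₁ g₂ n' m' k' l' i • x₀))
    (hL' : ∀ i, dist x₀ (blockWord g₁ g₂ n' m' k' l' i • x₀) ≤ L)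
    (hlong : 4 * L + 2 * C ≤ dist x₀ (g₁ ^ k • x₀)) {p : ℕ} (hp : p < 2)
    (hN : NoOverlap x₀ C ρ g₁⁻¹ (if p = 0 then g₁ else g₂)) (N : ℕ) :
    NotAligned x₀ (g₁ ^ n * g₂ ^ m * g₁ ^ k) W
      (prefixElt (blockWord g₁ g₂ n' m' k' l') N • x₀) x₀ := by
  by_contra h
  have hD := H.tree.nonneg
  obtain ⟨γ, hγ⟩ := H.exists_of_not_notAligned hW hC hρ hw h
  exact H.false_of_long (by linarith) hρ hL hL' hp hN (along_of_backward hγ).1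
    (by rwa [dist_inv_pow_smul])

/-- On its own axis the `g₁⁻¹ ^ k`-segment of a backward copy is not longer than every block. It is
therefore confined to one block instead of covering some, and only a `g₁ ^ k`-block has room. The
shorter `g₁⁻¹ ^ n`-segment then falls into the following `g₂ ^ l`-block, which is impossible. -/
theorem notAligned_backward_self (H : IsPingPong x₀ g₁ g₂ D c) {W C ρ : ℝ} (hW : 0 ≤ W)
    (hC : C = 2 * W + 2 * c + 4 * D) (hρ : 0 < ρ)
    (hw : ∀ i, 3 * C + ρ ≤ dist x₀ (blockWord g₁ g₂ n m k l i • x₀))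
    (hl : dist x₀ (g₁ ^ n • x₀) + dist x₀ (g₂ ^ m • x₀) + 3 * C + ρ ≤ dist x₀ (g₂ ^ l • x₀))
    (hk : dist x₀ (g₁ ^ n • x₀) + dist x₀ (g₂ ^ m • x₀) + dist x₀ (g₂ ^ l • x₀) + 3 * C + 3 * ρ ≤
      dist x₀ (g₁ ^ k • x₀)) {p : ℕ} (hp : p < 2)
    (hN : NoOverlap x₀ C ρ g₁⁻¹ (if p = 0 then g₁ else g₂)) (N : ℕ) :
    NotAligned x₀ (g₁ ^ n * g₂ ^ m * g₁ ^ k) W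
      (prefixElt (blockWord g₁ g₂ n m k l) (4 * N) • x₀) x₀ := by
  by_contra h
  have hc := H.nonneg
  have hD := H.tree.nonneg
  have hC0 : 0 ≤ C := by linarith
  have hn0 : 3 * C + ρ ≤ dist x₀ (g₁ ^ n • x₀) := by simpa [blockWord] using hw 0
  have hm0 : 3 * C + ρ ≤ dist x₀ (g₂ ^ m • x₀) := by simpa [blockWord] using hw 1
  have hL2 : ∀ i, c + 2 * D < dist x₀ (blockWord g₁ g₂ n m k l i • x₀) := fun i => by
    linarith [hw i]
  obtain ⟨γ, hγ⟩ := H.exists_of_not_notAligned hW hC hρ hw h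
  obtain ⟨a1, a2, a3, a4⟩ := along_of_backward hγ
  obtain ⟨i, hi, hip, b1, b2⟩ := H.exists_confining (by linarith) hρ hw hp hN a1
    (by rw [dist_inv_pow_smul]; linarith [dist_nonneg (x := x₀) (y := g₂ ^ l • x₀)])
  have e1 := a1.dist_sub_le
  rw [mul_smul _ (g₁⁻¹ ^ k), dist_smul, ← mul_smul, dist_inv_pow_smul] at e1
  have e2 := dist_triangle x₀ (prefixElt (blockWord g₁ g₂ n m k l) i • x₀)
    (prefixElt (blockWord g₁ g₂ n m k l) (i + 1) • x₀)
  rw [dist_prefixElt_succ] at e2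
  have cases : i % 4 = 0 ∨ i % 4 = 1 ∨ i % 4 = 2 ∨ i % 4 = 3 := by omega
  rcases cases with h4 | h4 | h4 | h4
  · rw [show blockWord g₁ g₂ n m k l i = g₁ ^ n by simp [blockWord, h4]] at e2
    linarith [dist_nonneg (x := x₀) (y := g₂ ^ l • x₀)]
  · rw [show blockWord g₁ g₂ n m k l i = g₂ ^ m by simp [blockWord, h4]] at e2
    linarith [dist_nonneg (x := x₀) (y := g₂ ^ l • x₀)]
  -- Here the confining block has even index, so `p = 1` and `g₁⁻¹` has no long overlap with `g₂`.
  -- The gap `g₂⁻¹ ^ m` pushes the `g₁⁻¹ ^ n`-segment past the start of the next block, and `l` is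
  -- large enough for that block to contain it.
  · rw [show blockWord g₁ g₂ n m k l i = g₁ ^ k by simp [blockWord, h4]] at e2
    have hp1 : p = 1 := by omega
    subst hp1
    replace hN : NoOverlap x₀ C ρ g₁⁻¹ g₂ := by simpa using hN
    have h5 : (i + 1) % 4 = 3 := by omega
    have b3 : blockWord g₁ g₂ n m k l (i + 1) = g₂ ^ l := by simp [blockWord, h5]
    have hi' : i + 1 < 4 * N := by omega
    have e3 := H.along hL2 hi'
    rw [prefixElt_succ _ (i + 1), b3] at e3
    have e4 := H.dist_add_le hL2 (i + 1)
    rw [prefixElt_succ _ (i + 1), b3] at e4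
    have e5 := H.dist_add_le hL2 i
    rw [show blockWord g₁ g₂ n m k l i = g₁ ^ k by simp [blockWord, h4]] at e5
    have e6 := e3.dist_sub_le
    have e7 := a2.dist_sub_le
    rw [mul_smul _ (g₁⁻¹ ^ n), dist_smul, ← mul_smul, dist_inv_pow_smul] at e7
    have e8 : dist x₀ ((prefixElt (blockWord g₁ g₂ n m k l) (i + 1) * g₂ ^ l) • x₀) ≤
        dist x₀ (prefixElt (blockWord g₁ g₂ n m k l) (4 * N) • x₀) := by
      have f1 : ∀ j, dist x₀ (prefixElt (blockWord g₁ g₂ n m k l) j • x₀) ≤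
          dist x₀ (prefixElt (blockWord g₁ g₂ n m k l) (j + 1) • x₀) := fun j => by
        linarith [H.dist_add_le hL2 j, hw j]
      have f2 := monotone_nat_of_le_succ f1 (show i + 1 + 1 ≤ 4 * N from hi')
      simpa only [prefixElt_succ _ (i + 1), b3] using f2
    have := hN x₀ _ (γ * g₁ ^ n) (prefixElt (blockWord g₁ g₂ n m k l) (i + 1)) n l _ _ a2
      (e3.mono (by linarith)) le_rfl le_rfl (by linarith) (by linarith) (by linarith)
    linarith
  · rw [show blockWord g₁ g₂ n m k l i = g₂ ^ l by simp [blockWord, h4]] at e2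
    linarith [dist_nonneg (x := x₀) (y := g₂ ^ l • x₀)]

end IsPingPong

end Aligned

/-! ### A triangular family of pseudocharacters -/

section Family

variable {G : Type*} [Group G] {X : Type*} [MetricSpace X] [MulAction G X] [IsIsometricSMul G X]

theorem forall_blockWord_iff {g₁ g₂ : G} {n m k l : ℕ} {P : G → Prop} :
    (∀ i, P (blockWord g₁ g₂ n m k l i)) ↔ P (g₁ ^ n) ∧ P (g₂ ^ m) ∧ P (g₁ ^ k) ∧ P (g₂ ^ l) := by
  constructor
  · intro h
    exact ⟨by simpa [blockWord] using h 0, by simpa [blockWord] using h 1,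
      by simpa [blockWord] using h 2, by simpa [blockWord] using h 3⟩
  · rintro ⟨h0, h1, h2, h3⟩ i
    unfold blockWord
    split_ifs <;> assumption

theorem exists_fast_sequence {ℓ : ℕ → ℝ} (h : ∀ T, ∃ n, T ≤ ℓ n) (A B : ℝ) (hB : 0 ≤ B) :
    ∃ k : ℕ → ℕ, (∀ i, A ≤ ℓ (k i)) ∧ ∀ i j, j < i → 4 * ℓ (k j) + B ≤ ℓ (k i) := by
  choose κ hκ using h
  let k : ℕ → ℕ := fun i => Nat.rec (κ (max A 0)) (fun _ r => κ (4 * ℓ r + B + max A 0)) i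
  have h0 : ∀ i, max A 0 ≤ ℓ (k i) := by
    intro i
    induction i with
    | zero => exact hκ _
    | succ i ih =>
      have h1 : 4 * ℓ (k i) + B + max A 0 ≤ ℓ (k (i + 1)) := hκ _
      linarith [le_max_right A 0]
  have h1 : ∀ i, 4 * ℓ (k i) + B ≤ ℓ (k (i + 1)) := by
    intro i
    have h1 : 4 * ℓ (k i) + B + max A 0 ≤ ℓ (k (i + 1)) := hκ _
    linarith [le_max_right A 0]
  have hmono : Monotone fun i => ℓ (k i) := monotone_nat_of_le_succ fun i => by
    linarith [h1 i, h0 i, le_max_right A 0]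
  refine ⟨k, fun i => (le_max_left _ _).trans (h0 i), fun i j hij => ?_⟩
  exact (h1 j).trans (hmono hij)

theorem exists_pseudocharacter_family {D : ℝ} (hX : IsCoarseTree X D) {g₁ g₂ : G}
    (hg : AreIndependent X g₁ g₂) (hBF : ¬ BFRel X g₁ g₂) (x₀ : X) :
    ∃ (f : ℕ → G → ℝ) (e : ℕ → G), (∀ i, IsPseudocharacter (f i)) ∧
      (∀ i g, |f i g| ≤ dist x₀ (g • x₀)) ∧ (∀ i j, j < i → f i (e j) = 0) ∧
      ∀ i, f i (e i) ≠ 0 := by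
  have hD := hX.nonneg
  have u1 := hg.1.isUndistorted x₀
  have u2 := hg.2.1.isUndistorted x₀
  obtain ⟨c, hc, hcg⟩ := hg.exists_detour_le hX x₀
  have H : IsPingPong x₀ g₁ g₂ D c := ⟨hX, hc, hcg⟩
  have no12 : ∀ B, ∃ r, ¬ OrbitsMatch x₀ B r g₁ g₂ := by
    by_contra! h
    obtain ⟨B, hB⟩ := h
    exact hBF (BFRel.of_match hX hg.1 hg.2.1 hB)
  -- If `g₁⁻¹` matched both `g₁` and `g₂`, inverting the first match would make `g₁` match `g₁⁻¹`,
  -- and by transitivity `g₁` would match `g₂`.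
  obtain ⟨p, hp, no1p⟩ : ∃ p < 2, ∀ B, ∃ r,
      ¬ OrbitsMatch x₀ B r g₁⁻¹ (if p = 0 then g₁ else g₂) := by
    by_contra! h
    obtain ⟨B₀, h0⟩ := h 0 (by norm_num)
    obtain ⟨B₁, h1⟩ := h 1 (by norm_num)
    simp only [if_true, one_ne_zero, if_false] at h0 h1
    obtain ⟨B, hB⟩ := OrbitsMatch.trans hX (g := g₁) (k := g₂) u1.inv
      (fun r => by simpa using (h0 r).inv) h1
    exact hBF (BFRel.of_match hX hg.1 hg.2.1 hB)
  have up : IsUndistorted x₀ (if p = 0 then g₁ else g₂) := by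
    split_ifs
    · exact u1
    · exact u2
  -- A period of four blocks loses at most `4 * (c + D)` to backtracking; the discount must exceed
  -- this by `1`.
  set W := 4 * (c + D) + 1 with hW
  have hW0 : 0 ≤ W := by positivity
  set C := 2 * W + 2 * c + 4 * D with hC
  have hC0 : 0 ≤ C := by positivity
  obtain ⟨ρ₁, n1⟩ := exists_noOverlap hX u1 u2 no12 hC0
  obtain ⟨ρ₂, n2⟩ := exists_noOverlap hX u1.inv up no1p hC0
  set ρ := max (max ρ₁ ρ₂) 1 with hρdef
  have hρ : 0 < ρ := lt_max_of_lt_right one_pos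
  replace n1 := n1.mono ((le_max_left ρ₁ ρ₂).trans (le_max_left _ 1))
  replace n2 := n2.mono ((le_max_right ρ₁ ρ₂).trans (le_max_left _ 1))
  have len1 : ∀ T, ∃ n : ℕ, T ≤ dist x₀ (g₁ ^ n • x₀) := fun T => by
    obtain ⟨n, hn⟩ := u1.exists_le_dist T
    exact ⟨n, hn n le_rfl⟩
  have len2 : ∀ T, ∃ n : ℕ, T ≤ dist x₀ (g₂ ^ n • x₀) := fun T => by
    obtain ⟨n, hn⟩ := u2.exists_le_dist T
    exact ⟨n, hn n le_rfl⟩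
  -- The lengths are chosen in the order `n`, `m`, `l`, `k`, where `g₂ ^ l` outweighs the first two
  -- blocks together and every `g₁ ^ k i` outweighs the other three and four times any earlier axis
  -- block.
  obtain ⟨n, hn⟩ := len1 (3 * C + ρ)
  obtain ⟨m, hm⟩ := len2 (3 * C + ρ)
  obtain ⟨l, hl⟩ := len2 (dist x₀ (g₁ ^ n • x₀) + dist x₀ (g₂ ^ m • x₀) + 3 * C + ρ)
  have dn : 0 ≤ dist x₀ (g₁ ^ n • x₀) := dist_nonneg
  have dm : 0 ≤ dist x₀ (g₂ ^ m • x₀) := dist_nonneg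
  have dl : 0 ≤ dist x₀ (g₂ ^ l • x₀) := dist_nonneg
  set S := dist x₀ (g₁ ^ n • x₀) + dist x₀ (g₂ ^ m • x₀) + dist x₀ (g₂ ^ l • x₀) with hS
  obtain ⟨k, hk, hk'⟩ := exists_fast_sequence len1 (S + 3 * C + 3 * ρ) (4 * S + 2 * C)
    (by positivity)
  have hb : ∀ j i, 3 * C + ρ ≤ dist x₀ (blockWord g₁ g₂ n m (k j) l i • x₀) := fun j =>
    forall_blockWord_iff (P := fun g => 3 * C + ρ ≤ dist x₀ (g • x₀)).2
      ⟨hn, hm, by linarith [hk j], by linarith⟩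
  have hb' : ∀ j i, dist x₀ (blockWord g₁ g₂ n m (k j) l i • x₀) ≤
      S + dist x₀ (g₁ ^ k j • x₀) := fun j =>
    forall_blockWord_iff (P := fun g => dist x₀ (g • x₀) ≤ S + dist x₀ (g₁ ^ k j • x₀)).2
      ⟨by linarith [hk j], by linarith [hk j], by linarith, by linarith [hk j]⟩
  have hb2 : ∀ j i, c + 2 * D < dist x₀ (blockWord g₁ g₂ n m (k j) l i • x₀) := fun j i => by
    linarith [hb j i]
  choose f f1 f2 f3 f4 using fun i =>
    exists_counting_pseudocharacter hX x₀ (g₁ ^ n * g₂ ^ m * g₁ ^ k i) hW0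
  refine ⟨f, fun j => g₁ ^ n * g₂ ^ m * g₁ ^ k j * g₂ ^ l, f1, f2, fun i j hij => ?_, fun i => ?_⟩
  · have hlong : 4 * (S + dist x₀ (g₁ ^ k j • x₀)) + 2 * C ≤ dist x₀ (g₁ ^ k i • x₀) := by
      linarith [hk' i j hij]
    refine f3 i _ (fun N => ?_) (fun N => ?_)
    · rw [← prefixElt_blockWord]
      exact H.notAligned_forward hW0 hC hρ (hb i) (hb j) (hb' j) hlong n1 _
    · rw [← prefixElt_blockWord]
      exact H.notAligned_backward hW0 hC hρ (hb i) (hb j) (hb' j) hlong hp n2 _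
  · have hw := H.le_dist_word (hb2 i)
    have hword : dist x₀ ((g₁ ^ n * g₂ ^ m * g₁ ^ k i) • x₀) ≤
        dist x₀ (g₁ ^ n • x₀) + dist x₀ (g₂ ^ m • x₀) + dist x₀ (g₁ ^ k i • x₀) := by
      have h1 := dist_triangle4 x₀ (g₁ ^ n • x₀) (g₁ ^ n • g₂ ^ m • x₀)
        (g₁ ^ n • g₂ ^ m • g₁ ^ k i • x₀)
      simp only [dist_smul] at h1
      simpa only [mul_smul] using h1
    refine ne_of_lt (lt_of_le_of_lt (f4 i (g₂ ^ l) ?_ (fun N => ?_) (fun N => ?_)) (by norm_num))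
    · linarith [hk i]
    · rw [← prefixElt_blockWord]
      exact H.notAligned_backward_self hW0 hC hρ (hb i) (by linarith) (by linarith [hk i]) hp n2 N
    · refine le_trans ?_ (H.le_dist_pow (hb2 i) N)
      gcongr
      linarith

end Family

/-! ### Words and ends -/

section Words

open Filter

variable {G : Type*} [Group G]

theorem IsPseudocharacter.map_pow {F : G → ℝ} (hF : IsPseudocharacter F) (g : G) (n : ℕ) :
    F (g ^ n) = n * F g := by
  simpa using hF.1 g n

theorem IsPseudocharacter.map_inv {F : G → ℝ} (hF : IsPseudocharacter F) (g : G) :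
    F g⁻¹ = -F g := by
  simpa using hF.1 g (-1)

theorem IsPseudocharacter.map_one {F : G → ℝ} (hF : IsPseudocharacter F) : F 1 = 0 := by
  simpa using hF.1 1 0

/-- On `g ^ n` conjugation changes the value by at most `2 * C`, whereas homogeneity multiplies the
change for `g` by `n`. -/
theorem IsPseudocharacter.map_conj {F : G → ℝ} (hF : IsPseudocharacter F) (g h : G) :
    F (h * g * h⁻¹) = F g := by
  obtain ⟨C, hC⟩ := hF.2
  by_contra hne
  have hpos : 0 < |F (h * g * h⁻¹) - F g| := abs_pos.2 (sub_ne_zero.2 hne)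
  obtain ⟨n, hn⟩ := exists_nat_gt (2 * C / |F (h * g * h⁻¹) - F g|)
  rw [div_lt_iff₀ hpos] at hn
  have h1 := hC h (g ^ n)
  have h2 := hC (h * g ^ n) h⁻¹
  rw [← conj_pow, hF.map_pow, hF.map_inv] at h2
  rw [hF.map_pow] at h1
  have h3 : |(n : ℝ) * (F (h * g * h⁻¹) - F g)| ≤ 2 * C := by
    rw [abs_le] at *
    constructor <;> linarith
  rw [abs_mul, Nat.abs_cast] at h3
  linarith

theorem exists_list_prod_eq {S : Finset G} (hS : Subgroup.closure (S : Set G) = ⊤) (g : G) :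
    ∃ L : List G, (∀ x ∈ L, x ∈ S ∨ x⁻¹ ∈ S) ∧ L.prod = g := by
  have h : g ∈ Subgroup.closure (S : Set G) := by rw [hS]; trivial
  rw [← Subgroup.mem_toSubmonoid, Subgroup.closure_toSubmonoid] at h
  obtain ⟨L, hL, rfl⟩ := Submonoid.exists_list_of_mem_closure h
  exact ⟨L, fun x hx => by simpa using hL x hx, rfl⟩

/-- The bi-infinitely periodic word with period `L`. -/
def periodicWord (L : List G) (i : ℕ) : G := L.getD (i % L.length) 1

theorem prefixElt_periodicWord {L : List G} (hL : 0 < L.length) (i : ℕ) :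
    prefixElt (periodicWord L) i = L.prod ^ (i / L.length) * (L.take (i % L.length)).prod := by
  induction i with
  | zero => simp [prefixElt_zero]
  | succ i ih =>
    have hlt : i % L.length < L.length := Nat.mod_lt _ hL
    rw [prefixElt_succ, ih, periodicWord, List.getD_eq_getElem _ _ hlt, mul_assoc,
      ← List.prod_take_succ]
    by_cases h : i % L.length + 1 < L.length
    · have h1 : (i + 1) % L.length = i % L.length + 1 := by
        rw [Nat.add_mod, Nat.mod_eq_of_lt (show 1 < L.length by omega), Nat.mod_eq_of_lt h]
      have h2 : (i + 1) / L.length = i / L.length := by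
        rw [Nat.add_div hL, Nat.mod_eq_of_lt (show 1 < L.length by omega), if_neg (by omega),
          Nat.div_eq_of_lt (show 1 < L.length by omega)]
        simp
      rw [h1, h2]
    · have h0 : i % L.length + 1 = L.length := by omega
      have hd : L.length ∣ i + 1 := by
        rw [Nat.dvd_iff_mod_eq_zero, Nat.add_mod]
        rcases Nat.lt_or_ge 1 L.length with h' | h'
        · rw [Nat.mod_eq_of_lt h', h0, Nat.mod_self]
        · have : L.length = 1 := by omega
          rw [this, Nat.mod_one]
      have h1 : (i + 1) % L.length = 0 := Nat.mod_eq_zero_of_dvd hd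
      have h2 : (i + 1) / L.length = i / L.length + 1 := by
        rw [Nat.succ_div_of_dvd hd]
      rw [h1, h2, h0]
      simp [pow_succ]

theorem mem_of_periodicWord {L : List G} (hL : 0 < L.length) (i : ℕ) : periodicWord L i ∈ L := by
  rw [periodicWord, List.getD_eq_getElem _ _ (Nat.mod_lt _ hL)]
  exact List.getElem_mem _

theorem IsPseudocharacter.tendsto_periodicWord {F : G → ℝ} (hF : IsPseudocharacter F) {L : List G}
    (hL : 0 < L.length) (h : 0 < F L.prod) :
    Tendsto (fun n => F (prefixElt (periodicWord L) n)) atTop atTop := by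
  obtain ⟨C, hC⟩ := hF.2
  set R := ∑ r ∈ Finset.range L.length, |F (L.take r).prod| with hR
  have hb : ∀ i, ((i / L.length : ℕ) : ℝ) * F L.prod - (C + R) ≤
      F (prefixElt (periodicWord L) i) := by
    intro i
    rw [prefixElt_periodicWord hL]
    have h1 := hC (L.prod ^ (i / L.length)) (L.take (i % L.length)).prod
    rw [hF.map_pow] at h1
    have h2 : |F (L.take (i % L.length)).prod| ≤ R :=
      Finset.single_le_sum (f := fun r => |F (L.take r).prod|) (fun _ _ => abs_nonneg _)
        (Finset.mem_range.2 (Nat.mod_lt _ hL))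
    rw [abs_le] at h1 h2
    linarith
  refine tendsto_atTop_mono hb (tendsto_atTop_add_const_right _ _ ?_)
  exact (tendsto_natCast_atTop_atTop.comp (Nat.tendsto_div_const_atTop hL.ne')).atTop_mul_const h

theorem wordSign_eq_one {f : G → ℝ} {w : ℕ → G}
    (h : Tendsto (fun n => f (prefixElt w n)) atTop atTop) : wordSign f w = 1 := by
  simp [wordSign, h]

theorem tendsto_of_wordSign_eq_one {f : G → ℝ} {w : ℕ → G} (h : wordSign f w = 1) :
    Tendsto (fun n => f (prefixElt w n)) atTop atTop := by
  by_contra h1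
  rw [wordSign, if_neg h1] at h
  split_ifs at h
  omega

theorem wordSign_neg (f : G → ℝ) (w : ℕ → G) : wordSign (-f) w = -wordSign f w := by
  have h1 : Tendsto (fun n => (-f) (prefixElt w n)) atTop atTop ↔
      Tendsto (fun n => f (prefixElt w n)) atTop atBot := by
    simp only [Pi.neg_apply, tendsto_neg_atTop_iff]
  have h2 : Tendsto (fun n => (-f) (prefixElt w n)) atTop atBot ↔
      Tendsto (fun n => f (prefixElt w n)) atTop atTop := by
    simp only [Pi.neg_apply, tendsto_neg_atBot_iff]
  unfold wordSign
  rw [h1, h2]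
  by_cases h3 : Tendsto (fun n => f (prefixElt w n)) atTop atTop
  · have h4 : ¬ Tendsto (fun n => f (prefixElt w n)) atTop atBot :=
      h3.not_tendsto disjoint_atTop_atBot
    simp [h3, h4]
  · by_cases h4 : Tendsto (fun n => f (prefixElt w n)) atTop atBot <;> simp [h3, h4]

theorem signedWords_neg (f : G → ℝ) (S : Finset G) : signedWords (-f) S = signedWords f S := by
  ext w
  simp only [signedWords, wordSign_neg, Set.mem_ofPred_eq]
  have : (-wordSign f w = 1 ∨ -wordSign f w = -1) ↔ (wordSign f w = 1 ∨ wordSign f w = -1) := by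
    omega
  rw [this]

theorem WordRel.neg {f : G → ℝ} {S : Finset G} {C : ℝ} {w v : ℕ → G} (h : WordRel f S C w v) :
    WordRel (-f) S C w v := by
  refine ⟨by rw [wordSign_neg, wordSign_neg, h.1], fun D hD => ?_⟩
  rw [wordSign_neg] at hD
  push_cast at hD
  obtain ⟨d, hd, m, n, hmn, hk⟩ := h.2 (-D) (by linarith)
  refine ⟨d, hd, m, n, hmn, fun k hk' => ?_⟩
  have := hk k hk'
  rw [← abs_neg, Pi.neg_apply]
  convert this using 2
  ring

theorem endClass_neg (f : G → ℝ) (S : Finset G) (w : ℕ → G) :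
    endClass (-f) S w = endClass f S w := by
  unfold endClass
  rw [signedWords_neg]
  ext v
  constructor
  · rintro ⟨h1, C, h2⟩
    exact ⟨h1, C, by simpa using h2.neg⟩
  · rintro ⟨h1, C, h2⟩
    exact ⟨h1, C, h2.neg⟩

theorem negEndSet_eq (f : G → ℝ) (S : Finset G) : negEndSet f S = posEndSet (-f) S := by
  have : ∀ w, wordSign f w = -1 ↔ -wordSign f w = 1 := fun w => by omega
  simp only [negEndSet, posEndSet, signedWords_neg, wordSign_neg, this]
  exact Set.image_congr fun w _ => (endClass_neg f S w).symm

theorem IsPseudocharacter.neg {F : G → ℝ} (hF : IsPseudocharacter F) : IsPseudocharacter (-F) := by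
  obtain ⟨h1, C, hC⟩ := hF
  refine ⟨fun g n => by simp [h1], C, fun a b => ?_⟩
  rw [← abs_neg]
  convert hC a b using 2
  simp only [Pi.neg_apply]
  ring

theorem exists_bound_on_letters (S : Finset G) (φ : G → ℝ) (hφ : ∀ g, 0 ≤ φ g)
    (hinv : ∀ g, φ g⁻¹ = φ g) : ∃ M, 0 ≤ M ∧ ∀ x, (x ∈ S ∨ x⁻¹ ∈ S) → φ x ≤ M := by
  refine ⟨∑ s ∈ S, φ s, Finset.sum_nonneg fun s _ => hφ s, ?_⟩
  rintro x (hx | hx)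
  · exact Finset.single_le_sum (fun s _ => hφ s) hx
  · rw [← hinv]
    exact Finset.single_le_sum (fun s _ => hφ s) hx

/-- The empty connecting word suffices: at the first prefix where `F` reaches the level, it
overshoots by at most the defect plus the largest value on a letter. -/
theorem IsPseudocharacter.exists_wordRel_refl {F : G → ℝ} (hF : IsPseudocharacter F) {S : Finset G}
    {w : ℕ → G} (hw : w ∈ signedWords F S) (hs : wordSign F w = 1) :
    ∃ C, WordRel F S C w w := by
  obtain ⟨C, hC⟩ := hF.2
  have hC0 : 0 ≤ C := (abs_nonneg _).trans (hC 1 1)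
  obtain ⟨M, hM0, hM⟩ := exists_bound_on_letters S (fun g => |F g|) (fun _ => abs_nonneg _)
    (fun g => by rw [hF.map_inv, abs_neg])
  refine ⟨C + M, rfl, fun D hD => ⟨[], by simp, ?_⟩⟩
  rw [hs] at hD
  push_cast at hD
  rw [one_mul] at hD
  have ht := tendsto_of_wordSign_eq_one hs
  classical
  have hex : ∃ n, D ≤ F (prefixElt w n) := (ht.eventually_ge_atTop D).exists
  obtain ⟨n, hn⟩ : ∃ n, Nat.find hex = n + 1 := by
    refine Nat.exists_eq_succ_of_ne_zero fun h' => ?_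
    have := Nat.find_spec hex
    rw [h', prefixElt_zero, hF.map_one] at this
    linarith
  have h1 : D ≤ F (prefixElt w (n + 1)) := hn ▸ Nat.find_spec hex
  have h2 : F (prefixElt w n) < D := not_le.1 (Nat.find_min hex (by omega))
  have h3 := hC (prefixElt w n) (w n)
  rw [← prefixElt_succ] at h3
  have h4 := hM (w n) (hw.1 n)
  refine ⟨n + 1, n + 1, by simp, fun k _ => ?_⟩
  simp only [List.take_nil, List.prod_nil, mul_one]
  rw [abs_le] at *
  constructor <;> linarith

end Words

/-! ### Bushy pseudocharacters -/

section Bushy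

open Filter

variable {G : Type*} [Group G] {X : Type*} [MetricSpace X] [MulAction G X] [IsIsometricSMul G X]

/-- A connecting word traces a chain with bounded steps between two diverging rays, so it passes
near `x₀`. There `|F|` is at most `A * (T + D + M)`, and the chain cannot stay at a higher level. -/
theorem not_wordRel_of_detour_le {D : ℝ} (hX : IsCoarseTree X D) {x₀ : X} {F : G → ℝ} {A : ℝ}
    (hA : 0 ≤ A) (hFA : ∀ g, |F g| ≤ A * dist x₀ (g • x₀)) {S : Finset G} {w v : ℕ → G}
    (hw : wordSign F w = 1) {T : ℝ}
    (hT : ∀ i j, detour (prefixElt w i • x₀) x₀ (prefixElt v j • x₀) ≤ T) :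
    ¬ ∃ C, WordRel F S C w v := by
  rintro ⟨C, -, h⟩
  obtain ⟨M, hM0, hM⟩ := exists_bound_on_letters S (fun g => dist x₀ (g • x₀))
    (fun _ => dist_nonneg) (fun g => by simpa using dist_inv_pow_smul x₀ g 1)
  have hAT : A * (T + D + M) ≤ |A * (T + D + M)| := le_abs_self _
  obtain ⟨d, hd, m, n, hmn, hk⟩ := h (C + |A * (T + D + M)| + 1) (by
    rw [hw]
    push_cast
    linarith [abs_nonneg (A * (T + D + M))])
  obtain ⟨k, -, hk', hnear⟩ := hX.exists_near
    (z := fun t => (prefixElt w m * (d.take t).prod) • x₀) (M := M) (Nat.zero_le d.length)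
    (p := x₀) (C := T) (fun t _ ht => by
      rw [List.prod_take_succ _ _ ht, ← mul_assoc, mul_smul _ d[t], dist_smul]
      exact hM _ (hd _ (List.getElem_mem _))) hM0 (by
      simpa [hmn] using hT m n)
  have h1 := hFA (prefixElt w m * (d.take k).prod)
  have h2 := hk k hk'
  rw [dist_comm] at h1
  have h3 := mul_le_mul_of_nonneg_left hnear hA
  rw [abs_le] at h1 h2
  linarith

theorem le_of_detour_chain {D : ℝ} (hX : IsCoarseTree X D) (o p q r : X) :
    detour p o q ≤ detour p o r + D ∨ detour q o r ≤ detour p o r + D := by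
  obtain ⟨i, hi, h⟩ := hX.chain (fun i => if i = 0 then p else if i = 1 then q else r) 2 o
    (by norm_num)
  interval_cases i
  · left; simpa using h
  · right; simpa using h

/-- The forward orbit of `g` diverges from the orbit of one of two independent elements. -/
theorem exists_diverging {D : ℝ} (hX : IsCoarseTree X D) {x₀ : X} {g g₁ g₂ : G}
    (hg : IsUndistorted x₀ g) (h12 : AreIndependent X g₁ g₂) :
    ∃ a : G, IsUndistorted x₀ a ∧
      ∃ c, ∀ (n : ℕ) (k : ℤ), detour (g ^ n • x₀) x₀ (a ^ k • x₀) ≤ c := by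
  have hD := hX.nonneg
  obtain ⟨C, hC, hgC⟩ := hg.exists_detour_le hX
  obtain ⟨c, hc, h⟩ := h12.exists_detour_le hX x₀
  by_contra! hcon
  obtain ⟨n, k, h1⟩ := hcon g₁ (h12.1.isUndistorted x₀) (c + C + 2 * D)
  obtain ⟨n', k', h2⟩ := hcon g₂ (h12.2.1.isUndistorted x₀) (c + C + 2 * D)
  have h3 := h k k'
  -- The orbit of `g` is almost geodesic, so two far points on it have a large Gromov product at
  -- `x₀`. Chaining this with the two assumed large products would give one between `g₁` and `g₂`.
  have h4 : c + 2 * D < detour (g ^ n • x₀) x₀ (g ^ n' • x₀) := by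
    have e1 := detour_le_two_mul (g ^ n • x₀) x₀ (g₁ ^ k • x₀)
    have e2 := detour_le_two_mul (g ^ n' • x₀) x₀ (g₂ ^ k' • x₀)
    rcases le_total n n' with hnn | hnn
    · have := hgC 0 n n' (Nat.zero_le _) hnn
      simp only [pow_zero, one_smul] at this
      unfold detour at this ⊢
      rw [dist_comm x₀ (g ^ n • x₀)] at this
      linarith
    · have := hgC 0 n' n (Nat.zero_le _) hnn
      simp only [pow_zero, one_smul] at this
      unfold detour at this ⊢
      rw [dist_comm x₀ (g ^ n • x₀), dist_comm (g ^ n' • x₀) (g ^ n • x₀)] at this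
      rw [dist_comm x₀] at *
      linarith
  rw [detour_comm] at h1
  rcases le_of_detour_chain hX x₀ (g₁ ^ k • x₀) (g ^ n • x₀) (g₂ ^ k' • x₀) with h5 | h5
  · linarith
  · rcases le_of_detour_chain hX x₀ (g ^ n • x₀) (g ^ n' • x₀) (g₂ ^ k' • x₀) with h6 | h6 <;>
      linarith

/-- With `a` diverging from the forward orbit of `g`, conjugation by a large power of `a` works: the
route `a ^ N • g ^ n • x₀`, `a ^ N • x₀`, `x₀`, `g ^ m • x₀` is a broken geodesic with small defects
and a long middle piece. -/
theorem exists_independent_conj {D : ℝ} (hX : IsCoarseTree X D) {x₀ : X} {g g₁ g₂ : G}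
    (hg : IsUndistorted x₀ g) (h12 : AreIndependent X g₁ g₂) :
    ∃ (h : G) (T : ℝ), ∀ m n : ℕ,
      detour (g ^ m • x₀) x₀ ((h * g * h⁻¹) ^ n • x₀) ≤ T := by
  obtain ⟨a, ha, c, hc⟩ := exists_diverging hX hg h12
  obtain ⟨N, hN⟩ := ha.exists_le_dist (c + D + 1)
  have hN := hN N le_rfl
  have hD := hX.nonneg
  have hc0 : 0 ≤ c := by simpa [detour] using hc 0 0
  refine ⟨a ^ N, c + D + 2 * dist (a ^ N • x₀) x₀, fun m n => ?_⟩
  have h1 : detour (a ^ N • g ^ n • x₀) (a ^ N • x₀) x₀ ≤ c := by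
    have := hc n (-N)
    rw [← detour_smul (a ^ N)] at this
    simpa [smul_smul] using this
  have h2 : detour (a ^ N • x₀) x₀ (g ^ m • x₀) ≤ c := by
    rw [detour_comm]
    simpa using hc m N
  have h3 := detour_le_of_extend hX h1 h2 (by rw [dist_comm]; linarith)
  have h4 := detour_le_detour_add_ends ((a ^ N * g * (a ^ N)⁻¹) ^ n • x₀) x₀ (g ^ m • x₀)
    (a ^ N • g ^ n • x₀) (g ^ m • x₀)
  rw [conj_pow, mul_assoc, mul_smul, mul_smul (g ^ n), dist_smul, dist_smul, dist_self,
    ← dist_smul (a ^ N), smul_inv_smul, dist_comm x₀] at h4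
  rw [detour_comm, conj_pow, mul_assoc, mul_smul, mul_smul (g ^ n)]
  linarith

theorem exists_two_posEnds {D : ℝ} (hX : IsCoarseTree X D) {x₀ : X} {g₁ g₂ : G}
    (h12 : AreIndependent X g₁ g₂) {F : G → ℝ} (hF : IsPseudocharacter F) (hF0 : F ≠ 0) {A : ℝ}
    (hA : 0 ≤ A) (hFA : ∀ g, |F g| ≤ A * dist x₀ (g • x₀)) {S : Finset G}
    (hS : Subgroup.closure (S : Set G) = ⊤) : 1 < (posEndSet F S).encard := by
  obtain ⟨g, hg⟩ : ∃ g, 0 < F g := by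
    obtain ⟨g, hg⟩ := Function.ne_iff.1 hF0
    rcases lt_or_gt_of_ne hg with h | h
    · exact ⟨g⁻¹, by rw [hF.map_inv]; simpa using h⟩
    · exact ⟨g, h⟩
  -- The displacement of `g ^ n` is at least `F (g ^ n) / A`, which is linear in `n`.
  have hu : IsUndistorted x₀ g := by
    refine ⟨A / F g, 0, by positivity, fun n => ?_⟩
    have := (le_abs_self _).trans (hFA (g ^ n))
    rw [hF.map_pow] at this
    rw [add_zero, div_mul_eq_mul_div, le_div_iff₀ hg]
    exact this
  have word : ∀ k : G, 0 < F k → ∃ w ∈ signedWords F S, wordSign F w = 1 ∧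
      ∃ R, ∀ i, ∃ q : ℕ, dist (prefixElt w i • x₀) (k ^ q • x₀) ≤ R := by
    intro k hk
    obtain ⟨L, hLS, rfl⟩ := exists_list_prod_eq hS k
    have hL : 0 < L.length := by
      rcases L with _ | ⟨x, L⟩
      · rw [List.prod_nil, hF.map_one] at hk
        exact absurd hk (lt_irrefl _)
      · simp
    have hs := wordSign_eq_one (hF.tendsto_periodicWord hL hk)
    refine ⟨periodicWord L, ⟨fun i => hLS _ (mem_of_periodicWord hL i), Or.inl hs⟩, hs,
      ∑ r ∈ Finset.range L.length, dist ((L.take r).prod • x₀) x₀, fun i => ⟨i / L.length, ?_⟩⟩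
    rw [prefixElt_periodicWord hL, mul_smul, dist_smul]
    exact Finset.single_le_sum (f := fun r => dist ((L.take r).prod • x₀) x₀)
      (fun _ _ => dist_nonneg) (Finset.mem_range.2 (Nat.mod_lt _ hL))
  obtain ⟨h, T, hT⟩ := exists_independent_conj hX hu h12
  obtain ⟨w, hw, hws, R, hR⟩ := word g hg
  obtain ⟨v, hv, hvs, R', hR'⟩ := word (h * g * h⁻¹) (by rwa [hF.map_conj])
  rw [Set.one_lt_encard_iff]
  refine ⟨endClass F S w, endClass F S v, ⟨w, ⟨hw, hws⟩, rfl⟩, ⟨v, ⟨hv, hvs⟩, rfl⟩, fun he => ?_⟩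
  have hvv : v ∈ endClass F S v := ⟨hv, hF.exists_wordRel_refl hv hvs⟩
  rw [← he] at hvv
  refine not_wordRel_of_detour_le hX hA hFA hws (T := T + 2 * (R + R')) (fun i j => ?_) hvv.2
  obtain ⟨q, hq⟩ := hR i
  obtain ⟨q', hq'⟩ := hR' j
  have := detour_le_detour_add_ends (prefixElt w i • x₀) x₀ (prefixElt v j • x₀) (g ^ q • x₀)
    ((h * g * h⁻¹) ^ q' • x₀)
  linarith [hT q q']

/-- A nontrivial pseudocharacter that is bounded by a multiple of the displacement is bushy. -/
theorem isBushy_of_le_dist {D : ℝ} (hX : IsCoarseTree X D) {x₀ : X} {g₁ g₂ : G}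
    (h12 : AreIndependent X g₁ g₂) {F : G → ℝ} (hF : IsPseudocharacter F) (hF0 : F ≠ 0) {A : ℝ}
    (hA : 0 ≤ A) (hFA : ∀ g, |F g| ≤ A * dist x₀ (g • x₀)) : IsBushy F := by
  refine ⟨hF, hF0, fun S hS => ?_⟩
  have hpos := exists_two_posEnds hX h12 hF hF0 hA hFA hS
  have hneg : 1 < (negEndSet F S).encard := by
    rw [negEndSet_eq]
    exact exists_two_posEnds hX h12 hF.neg (neg_ne_zero.2 hF0) hA
      (fun g => by simpa using hFA g) hS
  refine ⟨fun hu => ?_, fun hu => ?_⟩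
  -- If there were only two ends, the positive and the negative ends would each be all of them; but
  -- equivalent words have equal signs.
  · have hfin : (endSet F S).Finite := Set.finite_of_encard_eq_coe (k := 2) hu
    have hsub : posEndSet F S ⊆ endSet F S := by
      rintro _ ⟨w, hw, rfl⟩
      exact ⟨w, hw.1, rfl⟩
    have hsub' : negEndSet F S ⊆ endSet F S := by
      rintro _ ⟨w, hw, rfl⟩
      exact ⟨w, hw.1, rfl⟩
    have h1 : posEndSet F S = endSet F S := by
      refine hfin.eq_of_subset_of_encard_le' hsub ?_
      rw [show (endSet F S).encard = 2 from hu]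
      exact Order.add_one_le_of_lt hpos
    have h2 : negEndSet F S = endSet F S := by
      refine hfin.eq_of_subset_of_encard_le' hsub' ?_
      rw [show (endSet F S).encard = 2 from hu]
      exact Order.add_one_le_of_lt hneg
    have hne : (posEndSet F S).Nonempty := by
      rw [← Set.encard_pos]
      exact zero_lt_one.trans hpos
    obtain ⟨_, w, ⟨hw, hws⟩, rfl⟩ := hne
    have hmem : endClass F S w ∈ negEndSet F S := by
      rw [h2, ← h1]
      exact ⟨w, ⟨hw, hws⟩, rfl⟩
    obtain ⟨v, ⟨hv, hvs⟩, he⟩ := hmem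
    have hww : w ∈ endClass F S w := ⟨hw, hF.exists_wordRel_refl hw hws⟩
    rw [← he] at hww
    obtain ⟨C, hC⟩ := hww.2
    have := hC.1
    omega
  · rcases hu.1 with h | h
    · rw [h] at hpos
      exact lt_irrefl _ hpos
    · rw [h] at hneg
      exact lt_irrefl _ hneg

end Bushy

/-! ### The dimension of the span of the bushy pseudocharacters -/

section Dimension

/-- Power sums with pairwise distinct nodes determine the weights. -/
theorem eq_zero_of_forall_sum_mul_pow {ι : Type*} {s : Finset ι} {c x : ι → ℝ}
    (hx : Function.Injective x) (h : ∀ n : ℕ, ∑ i ∈ s, c i * x i ^ n = 0) {i : ι} (hi : i ∈ s) :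
    c i = 0 := by
  classical
  have hp : ∀ p : Polynomial ℝ, ∑ j ∈ s, c j * p.eval (x j) = 0 := fun p => by
    simp only [Polynomial.eval_eq_sum_range, Finset.mul_sum]
    rw [Finset.sum_comm]
    refine Finset.sum_eq_zero fun n _ => ?_
    have : ∀ j, c j * (p.coeff n * x j ^ n) = p.coeff n * (c j * x j ^ n) := fun j => by ring
    simp only [this]
    rw [← Finset.mul_sum, h n, mul_zero]
  -- This Lagrange-type polynomial vanishes at every node except `x i`.
  have h1 := hp (∏ j ∈ s.erase i, (Polynomial.X - Polynomial.C (x j)))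
  simp only [Polynomial.eval_prod, Polynomial.eval_sub, Polynomial.eval_X, Polynomial.eval_C] at h1
  rw [Finset.sum_eq_single_of_mem i hi] at h1
  · refine (mul_eq_zero.1 h1).resolve_right (Finset.prod_ne_zero_iff.2 fun j hj => ?_)
    exact sub_ne_zero.2 fun he => (Finset.mem_erase.1 hj).1 (hx he).symm
  · intro j hj hji
    rw [Finset.prod_eq_zero (Finset.mem_erase.2 ⟨hji, hj⟩) (sub_self _), mul_zero]

/-- At `e j` the series stops at `i = j`. By strong induction on `j`, a linear relation evaluated
there leaves only the moment `∑ c t * t ^ j` times a nonzero factor; all moments vanish, hence so do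
the coefficients. -/
theorem linearIndependent_tsum_pow_mul {α : Type*} {a : ℕ → α → ℝ} {e : ℕ → α}
    (h0 : ∀ i j, j < i → a i (e j) = 0) (h1 : ∀ i, a i (e i) ≠ 0) :
    LinearIndependent ℝ
      (fun (t : Set.Ioo (0 : ℝ) 1) (x : α) => ∑' i, (t : ℝ) ^ i * a i x) := by
  rw [linearIndependent_iff']
  intro s c hc t ht
  refine eq_zero_of_forall_sum_mul_pow (x := fun t : Set.Ioo (0 : ℝ) 1 => (t : ℝ))
    Subtype.val_injective (fun j => ?_) ht
  induction j using Nat.strong_induction_on with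
  | _ j ih =>
    have hj := congrFun hc (e j)
    simp only [Finset.sum_apply, Pi.smul_apply, smul_eq_mul, Pi.zero_apply] at hj
    have hfin : ∀ t : Set.Ioo (0 : ℝ) 1, ∑' i, (t : ℝ) ^ i * a i (e j) =
        ∑ i ∈ Finset.range (j + 1), (t : ℝ) ^ i * a i (e j) := fun t => by
      refine tsum_eq_sum fun i hi => ?_
      rw [h0 i j (by simpa [Nat.lt_succ_iff] using hi), mul_zero]
    simp only [hfin, Finset.mul_sum] at hj
    rw [Finset.sum_comm, Finset.sum_range_succ] at hj
    have hz : ∀ i, ∑ t ∈ s, c t * ((t : ℝ) ^ i * a i (e j)) =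
        (∑ t ∈ s, c t * (t : ℝ) ^ i) * a i (e j) := fun i => by
      rw [Finset.sum_mul]
      exact Finset.sum_congr rfl fun t _ => by ring
    simp only [hz] at hj
    rw [Finset.sum_eq_zero fun i hi => by rw [ih i (Finset.mem_range.1 hi), zero_mul],
      zero_add] at hj
    exact (mul_eq_zero.1 hj).resolve_right (h1 j)

theorem summable_pow_mul {t : ℝ} (ht : t ∈ Set.Ioo (0 : ℝ) 1) {a : ℕ → ℝ} {M : ℝ}
    (ha : ∀ i, |a i| ≤ M) : Summable fun i => t ^ i * a i := by
  refine Summable.of_norm_bounded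
    ((summable_geometric_of_lt_one ht.1.le ht.2).mul_right M) fun i => ?_
  rw [Real.norm_eq_abs, abs_mul, abs_of_nonneg (pow_nonneg ht.1.le i)]
  exact mul_le_mul_of_nonneg_left (ha i) (pow_nonneg ht.1.le i)

theorem abs_tsum_pow_mul_le {t : ℝ} (ht : t ∈ Set.Ioo (0 : ℝ) 1) {a : ℕ → ℝ} {M : ℝ}
    (ha : ∀ i, |a i| ≤ M) : |∑' i, t ^ i * a i| ≤ (1 - t)⁻¹ * M := by
  have hs := (hasSum_geometric_of_lt_one ht.1.le ht.2).mul_right M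
  rw [← Real.norm_eq_abs]
  refine tsum_of_norm_bounded hs fun i => ?_
  rw [Real.norm_eq_abs, abs_mul, abs_of_nonneg (pow_nonneg ht.1.le i)]
  exact mul_le_mul_of_nonneg_left (ha i) (pow_nonneg ht.1.le i)

/-- The whole function space has at most `𝔠 ^ ℵ₀ = 𝔠` elements. -/
theorem rank_submodule_fun_le_continuum {α : Type*} [Countable α] (W : Submodule ℝ (α → ℝ)) :
    Module.rank ℝ W ≤ Cardinal.continuum := by
  refine (rank_le_card ℝ W).trans ((Cardinal.mk_subtype_le _).trans ?_)
  rw [Cardinal.mk_arrow, Cardinal.mk_real, Cardinal.lift_continuum]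
  calc Cardinal.continuum ^ Cardinal.lift (Cardinal.mk α)
      ≤ Cardinal.continuum ^ Cardinal.aleph0 :=
        Cardinal.power_le_power_left Cardinal.continuum_ne_zero
          (Cardinal.lift_le_aleph0.2 (Cardinal.mk_le_aleph0_iff.2 inferInstance))
    _ = Cardinal.continuum := Cardinal.continuum_power_aleph0

variable {G : Type*} [Group G]

/-- A geometric series of pseudocharacters with uniformly bounded defects is a pseudocharacter. -/
theorem IsPseudocharacter.tsum_pow_mul {t : ℝ} (ht : t ∈ Set.Ioo (0 : ℝ) 1) {a : ℕ → G → ℝ}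
    {M : G → ℝ} (hM : ∀ i g, |a i g| ≤ M g) (hhom : ∀ i g (n : ℤ), a i (g ^ n) = n * a i g)
    {C : ℝ} (hC : ∀ i g h, |a i g + a i h - a i (g * h)| ≤ C) :
    IsPseudocharacter fun g => ∑' i, t ^ i * a i g := by
  have hs : ∀ g, Summable fun i => t ^ i * a i g := fun g => summable_pow_mul ht fun i => hM i g
  refine ⟨fun g n => ?_, (1 - t)⁻¹ * C, fun g h => ?_⟩
  · rw [← tsum_mul_left]
    exact tsum_congr fun i => by rw [hhom]; ring
  · rw [← (hs g).tsum_add (hs h), ← ((hs g).add (hs h)).tsum_sub (hs (g * h))]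
    have := abs_tsum_pow_mul_le ht fun i => hC i g h
    refine le_of_eq_of_le (congrArg _ (tsum_congr fun i => ?_)) this
    ring

theorem countable_of_isFinitelyPresented [Group.IsFinitelyPresented G] : Countable G := by
  obtain ⟨n, φ, hφ, -⟩ := Group.IsFinitelyPresented.out (G := G)
  have : Countable (FreeGroup (Fin n)) := Quot.mk_surjective.countable
  exact hφ.countable

theorem continuum_le_rank_bushySpan {X : Type*} [MetricSpace X] [MulAction G X]
    [IsIsometricSMul G X] {D : ℝ} (hX : IsCoarseTree X D) {g₁ g₂ : G}
    (hg : AreIndependent X g₁ g₂) (hBF : ¬ BFRel X g₁ g₂) (x₀ : X) :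
    Cardinal.continuum ≤ Module.rank ℝ (bushySpan G) := by
  obtain ⟨f, e, hf, hle, h0, h1⟩ := exists_pseudocharacter_family hX hg hBF x₀
  choose C hC using fun i => (hf i).2
  have hC0 : ∀ i, 0 ≤ C i := fun i => (abs_nonneg _).trans (hC i 1 1)
  have hC1 : ∀ i, 0 < 1 + C i := fun i => by linarith [hC0 i]
  -- The normalization bounds all defects by `1`, so the geometric series has finite defect; the
  -- displacement bound and the triangular shape survive.
  set a : ℕ → G → ℝ := fun i g => f i g / (1 + C i) with ha
  have hM : ∀ i g, |a i g| ≤ dist x₀ (g • x₀) := fun i g => by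
    rw [ha, abs_div, abs_of_pos (hC1 i)]
    exact (div_le_self (abs_nonneg _) (by linarith [hC0 i])).trans (hle i g)
  have hdef : ∀ i g h, |a i g + a i h - a i (g * h)| ≤ 1 := fun i g h => by
    simp only [ha]
    rw [← add_div, ← sub_div, abs_div, abs_of_pos (hC1 i), div_le_one (hC1 i)]
    linarith [hC i g h]
  have hli := linearIndependent_tsum_pow_mul (a := a) (e := e)
    (fun i j hij => by simp [ha, h0 i j hij]) (fun i => div_ne_zero (h1 i) (hC1 i).ne')
  have hbushy : ∀ t : Set.Ioo (0 : ℝ) 1,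
      (fun g => ∑' i, (t : ℝ) ^ i * a i g) ∈ bushySpan G := fun t => by
    refine Submodule.subset_span (isBushy_of_le_dist (x₀ := x₀) hX hg
      (IsPseudocharacter.tsum_pow_mul t.2 hM (fun i g n => ?_) hdef) (hli.ne_zero t)
      (inv_nonneg.2 (sub_nonneg.2 t.2.2.le)) fun g => abs_tsum_pow_mul_le t.2 fun i => hM i g)
    simp only [ha, (hf i).1 g n]
    ring
  have hli' : LinearIndependent ℝ (fun t : Set.Ioo (0 : ℝ) 1 =>
      (⟨fun g => ∑' i, (t : ℝ) ^ i * a i g, hbushy t⟩ : bushySpan G)) :=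
    LinearIndependent.of_comp (bushySpan G).subtype hli
  have := hli'.cardinal_lift_le_rank
  rwa [Cardinal.mk_Ioo_real zero_lt_one, Cardinal.lift_continuum, Cardinal.lift_id'.{0}] at this

/-- Finite presentability enters through the countability of `G`, which gives the upper bound; the
geometry gives the lower bound. -/
theorem ConnectedGraph.rank_bushySpan_eq_continuum [Group.IsFinitelyPresented G] {V E : Type*}
    (Γ : ConnectedGraph V E) [MulAction G Γ.Realization] [IsIsometricSMul G Γ.Realization]
    (hb : HasBottleneckProperty Γ.Realization)
    (hBF : IsBestvinaFujiwaraAction G Γ.Realization) :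
    Module.rank ℝ (bushySpan G) = Cardinal.continuum := by
  obtain ⟨hyp, -, g₁, g₂, hg, hBF⟩ := hBF
  obtain ⟨D, hX⟩ := exists_isCoarseTree hyp hb (E := 6) (by norm_num) fun x y => by
    obtain ⟨γ, hγ⟩ := Γ.exists_almost_geodesic x y
    exact ⟨γ, fun t => by unfold detour; linarith [hγ t]⟩
  obtain ⟨v⟩ := Γ.connected.nonempty
  have := countable_of_isFinitelyPresented (G := G)
  exact le_antisymm (rank_submodule_fun_le_continuum _)
    (continuum_le_rank_bushySpan hX hg hBF (SeparationQuotient.mk (.vertex v)))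

end Dimension

theorem mainTheorem9 {G : Type*} [Group G] [Group.IsFinitelyPresented G] :
    (∀ {V : Type*} {E : Type*} (Γ : ConnectedGraph V E) [MulAction G Γ.Realization]
        [IsIsometricSMul G Γ.Realization],
      HasBottleneckProperty Γ.Realization → IsBestvinaFujiwaraAction G Γ.Realization →
        Module.rank ℝ (bushySpan G) = Cardinal.continuum) ∧
    (∀ (S : Finset G) (hS : Subgroup.closure (S : Set G) = ⊤),
      HasBottleneckProperty (cayleyGraph S hS).Realization →
        IsBestvinaFujiwaraAction G (cayleyGraph S hS).Realization →
          Module.rank ℝ (bushySpan G) = Cardinal.continuum) :=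
  ⟨fun Γ _ _ hb hBF => Γ.rank_bushySpan_eq_continuum hb hBF,
    fun S hS hb hBF => (cayleyGraph S hS).rank_bushySpan_eq_continuum hb hBF⟩
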